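/- Let $k$ be an algebraically closed field (of any characteristic) and let $n\ge 2$. Let $Q_n$ be the quiver with vertices $e_{i,u}$, $(i,u)\in\mathbb Z/n\times\mathbb Z/n$, and with arrows $a_{i,u}\colon e_{i,u}\to e_{i-1,u}$ for $u\neq i-1$ and $b_{i,u}\colon e_{i,u}\to e_{i,u-1}$ for $u\ne i$. Let $\Gamma_{\Lambda_n}$ (the Auslander algebra of the Taft algebra $\Lambda_n$) be the quotient of the path algebra $kQ_n$, with paths composed from right to left, by the two-sided ideal generated by the mesh relations $a_{i,i-2}\,b_{i,i-1}=0$ for all $i\in\mathbb Z/n$, and $a_{i,u-1}\,b_{i,u}+b_{i-1,u}\,a_{i,u}=0$ for all $i,u\in\mathbb Z/n$ with $u\ne i$ and $u\neq i-1$. Let $kQ_0$ be the $k$-vector space with basis the vertices of $Q_n$, let $\mathrm{HH}_*$ denote the Hochschild homology over $k$ of an algebra with coefficients in itself, and let $\mathrm{HC}_*$ denote cyclic homology over $k$, that is, the homology of the total complex of the cyclic bicomplex. Then: 1. $\mathrm{HH}_0(\Gamma_{\Lambda_n})=kQ_0\cong k^{n^2}$, in the sense that the classes of the vertices $e_{i,u}$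 form a basis of $\mathrm{HH}_0(\Gamma_{\Lambda_n})$, and $\mathrm{HH}_p(\Gamma_{\Lambda_n})=0$ for all $p>0$. 2. $\mathrm{HC}_{2p}(\Gamma_{\Lambda_n})\cong kQ_0\cong k^{n^2}$ and $\mathrm{HC}_{2p+1}(\Gamma_{\Lambda_n})=0$ for all $p\ge 0$. -/

import Mathlib

/-! ### The path algebra of a quiver -/

namespace TaftAuslander

/-- The underlying module of the path algebra `kQ` of a quiver `Q` with vertex set `V`:
the free `k`-module on all (possibly trivial) paths of `Q`. -/
def PathAlgebra (k V : Type*) [Quiver V] [CommRing k] : Type _ :=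
  (Σ x y : V, Quiver.Path x y) →₀ k

namespace PathAlgebra

section

variable {k V : Type*} [Quiver V] [CommRing k]

noncomputable instance : AddCommGroup (PathAlgebra k V) :=
  inferInstanceAs (AddCommGroup ((Σ x y : V, Quiver.Path x y) →₀ k))

noncomputable instance : Module k (PathAlgebra k V) :=
  inferInstanceAs (Module k ((Σ x y : V, Quiver.Path x y) →₀ k))

/-- The basis element of the path algebra given by a path from `x` to `y`. -/
noncomputable def ofPath (k : Type*) [CommRing k] {x y : V} (p : Quiver.Path x y) :
    PathAlgebra k V :=
  Finsupp.single (⟨x, y, p⟩ : Σ x y : V, Quiver.Path x y) (1 : k)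

theorem induction {P : PathAlgebra k V → Prop} (h0 : P 0)
    (hadd : ∀ f g, P f → P g → P (f + g)) (hsmul : ∀ (c : k) f, P f → P (c • f))
    (hpath : ∀ (x y : V) (p : Quiver.Path x y), P (ofPath k p)) (f : PathAlgebra k V) : P f := by
  refine Finsupp.induction_linear (motive := P) f h0 hadd ?_
  rintro ⟨x, y, p⟩ c
  have h := hsmul c _ (hpath x y p)
  have e : c • ofPath k p = Finsupp.single (⟨x, y, p⟩ : Σ x y : V, Quiver.Path x y) c :=
    (Finsupp.smul_single _ _ _).trans (by simp)
  exact e ▸ h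

variable [DecidableEq V]

/-- The product of two paths, composed from right to left: `p * q` is "first `q`, then `p`" if
`q` ends where `p` starts, and `0` otherwise. -/
noncomputable def pathMul (k : Type*) [CommRing k] (p q : Σ x y : V, Quiver.Path x y) :
    PathAlgebra k V :=
  if h : q.2.1 = p.1 then ofPath k ((q.2.2.cast rfl h).comp p.2.2) else 0

/-- The `k`-bilinear extension of the product of paths. -/
noncomputable def mulLin : PathAlgebra k V →ₗ[k] PathAlgebra k V →ₗ[k] PathAlgebra k V :=
  Finsupp.linearCombination k (fun p => Finsupp.linearCombination k (fun q => pathMul k p q))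

theorem mulLin_ofPath {x y y' z : V} (p : Quiver.Path y' z) (q : Quiver.Path x y) :
    mulLin (ofPath k p) (ofPath k q) = pathMul k ⟨y', z, p⟩ ⟨x, y, q⟩ := by
  have h1 : mulLin (ofPath k p) =
      Finsupp.linearCombination k (fun q => pathMul k ⟨y', z, p⟩ q) :=
    (Finsupp.linearCombination_single k (1 : k) _).trans (one_smul _ _)
  rw [h1]
  exact (Finsupp.linearCombination_single k (1 : k) _).trans (one_smul _ _)

theorem mulLin_ofPath_comp {x y z : V} (p : Quiver.Path y z) (q : Quiver.Path x y) :
    mulLin (ofPath k p) (ofPath k q) = ofPath k (q.comp p) := by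
  rw [mulLin_ofPath]
  simp [pathMul]

theorem mulLin_ofPath_ne {x y y' z : V} (p : Quiver.Path y' z) (q : Quiver.Path x y)
    (h : y ≠ y') : mulLin (ofPath k p) (ofPath k q) = 0 := by
  rw [mulLin_ofPath]
  simp [pathMul, h]

theorem mulLin_assoc (f g h : PathAlgebra k V) :
    mulLin (mulLin f g) h = mulLin f (mulLin g h) := by
  induction f using PathAlgebra.induction with
  | h0 => simp
  | hadd f f' hf hf' => simp [hf, hf']
  | hsmul c f hf => simp [hf]
  | hpath y z p =>
  induction g using PathAlgebra.induction with
  | h0 => simp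
  | hadd f f' hf hf' => simp [hf, hf']
  | hsmul c f hf => simp [hf]
  | hpath x y' q =>
  induction h using PathAlgebra.induction with
  | h0 => simp
  | hadd f f' hf hf' => simp [hf, hf']
  | hsmul c f hf => simp [hf]
  | hpath w x' r =>
  by_cases h1 : y' = y
  · subst h1
    by_cases h2 : x' = x
    · subst h2
      simp [mulLin_ofPath_comp]
    · rw [mulLin_ofPath_comp, mulLin_ofPath_ne _ _ h2, mulLin_ofPath_ne _ _ h2, map_zero]
  · by_cases h2 : x' = x
    · subst h2
      rw [mulLin_ofPath_comp, mulLin_ofPath_ne _ _ h1, mulLin_ofPath_ne _ _ h1, map_zero]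
      rfl
    · rw [mulLin_ofPath_ne _ _ h1, mulLin_ofPath_ne _ _ h2, map_zero, map_zero]
      rfl

variable [Fintype V]

theorem sum_nil_mulLin (f : PathAlgebra k V) :
    mulLin (∑ x : V, ofPath k (Quiver.Path.nil : Quiver.Path x x)) f = f := by
  induction f using PathAlgebra.induction with
  | h0 => simp
  | hadd f f' hf hf' => rw [map_add, hf, hf']
  | hsmul c f hf => rw [map_smul, hf]
  | hpath x y p =>
    rw [map_sum, LinearMap.sum_apply, Finset.sum_eq_single y]
    · rw [mulLin_ofPath_comp, Quiver.Path.comp_nil]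
    · intro z _ hz
      exact mulLin_ofPath_ne _ _ hz.symm
    · simp

theorem mulLin_sum_nil (f : PathAlgebra k V) :
    mulLin f (∑ x : V, ofPath k (Quiver.Path.nil : Quiver.Path x x)) = f := by
  induction f using PathAlgebra.induction with
  | h0 => simp
  | hadd f f' hf hf' => rw [map_add, LinearMap.add_apply, hf, hf']
  | hsmul c f hf => rw [map_smul, LinearMap.smul_apply, hf]
  | hpath x y p =>
    rw [map_sum, Finset.sum_eq_single x]
    · rw [mulLin_ofPath_comp, Quiver.Path.nil_comp]
    · intro z _ hz
      exact mulLin_ofPath_ne _ _ hz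
    · simp

/-- The ring structure of the path algebra of a quiver with finitely many vertices; its unit is
the sum of the trivial paths. -/
noncomputable instance : Ring (PathAlgebra k V) :=
  { (inferInstance : AddCommGroup (PathAlgebra k V)) with
    mul := fun f g => mulLin f g
    one := ∑ x : V, ofPath k (Quiver.Path.nil : Quiver.Path x x)
    mul_assoc := mulLin_assoc
    one_mul := sum_nil_mulLin
    mul_one := mulLin_sum_nil
    zero_mul := fun f => by
      change mulLin 0 f = 0
      simp
    mul_zero := fun f => by
      change mulLin f 0 = 0
      simp
    left_distrib := fun f g h => map_add (mulLin f) g h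
    right_distrib := fun f g h => by
      change mulLin (f + g) h = mulLin f h + mulLin g h
      simp }

noncomputable instance : Algebra k (PathAlgebra k V) :=
  Algebra.ofModule
    (fun c f g => by
      change mulLin (c • f) g = c • mulLin f g
      simp)
    (fun c f g => map_smul (mulLin f) c g)

end

end PathAlgebra

/-! ### The cylinder quiver and the Auslander algebra of the Taft algebra -/

/-- The vertices `e_{i,u}` of the quiver `Q_n`. -/
def Vertex (n : ℕ) : Type := ZMod n × ZMod n

instance (n : ℕ) : DecidableEq (Vertex n) := inferInstanceAs (DecidableEq (ZMod n × ZMod n))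

instance (n : ℕ) [NeZero n] : Fintype (Vertex n) := inferInstanceAs (Fintype (ZMod n × ZMod n))

/-- The arrows of the quiver `Q_n`: arrows `a_{i,u} : (i,u) ⟶ (i-1,u)` for `u ≠ i - 1`, and arrows
`b_{i,u} : (i,u) ⟶ (i,u-1)` for `u ≠ i`.  The vertices `(i,i)` and the vertices `(i,i-1)` lie on the
two boundary circles of the cylinder, and no arrow joins the two circles around the outside. -/
inductive Arrow (n : ℕ) : Vertex n → Vertex n → Type
  | a (i u : ZMod n) (h : u ≠ i - 1) : Arrow n (i, u) (i - 1, u)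
  | b (i u : ZMod n) (h : u ≠ i) : Arrow n (i, u) (i, u - 1)

instance (n : ℕ) : Quiver (Vertex n) := ⟨Arrow n⟩

section

variable (k : Type*) [CommRing k] (n : ℕ)

/-- The arrow `a_{i,u}` as an element of `kQ_n`; it is read as `0` if `u = i - 1`, where `Q_n` has
no such arrow. -/
noncomputable def arrowA (i u : ZMod n) : PathAlgebra k (Vertex n) :=
  if h : u ≠ i - 1 then
    PathAlgebra.ofPath k (Quiver.Hom.toPath (V := Vertex n) (Arrow.a i u h)) else 0

/-- The arrow `b_{i,u}` as an element of `kQ_n`; it is read as `0` if `u = i`, where `Q_n` has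
no such arrow. -/
noncomputable def arrowB (i u : ZMod n) : PathAlgebra k (Vertex n) :=
  if h : u ≠ i then
    PathAlgebra.ofPath k (Quiver.Hom.toPath (V := Vertex n) (Arrow.b i u h)) else 0

variable [NeZero n]

/-- The mesh relations: the paths `a_{i,i-2} b_{i,i-1}` along the boundary circle of the vertices
`(i,i-1)` vanish, and every square of the quiver (the four arrows involved all exist exactly if
`u ≠ i` and `u ≠ i - 1`) anticommutes. -/
def meshRelations : Set (PathAlgebra k (Vertex n)) :=
  {r | ∃ i : ZMod n, r = arrowA k n i (i - 2) * arrowB k n i (i - 1)} ∪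
  {r | ∃ i u : ZMod n, u ≠ i ∧ u ≠ i - 1 ∧
    r = arrowA k n i (u - 1) * arrowB k n i u + arrowB k n (i - 1) u * arrowA k n i u}

/-- The congruence on `kQ_n` of the two-sided ideal generated by the mesh relations. -/
noncomputable def meshCon : RingCon (PathAlgebra k (Vertex n)) :=
  (TwoSidedIdeal.span (meshRelations k n)).ringCon

/-- The Auslander algebra of the Taft algebra: the quotient of the path algebra `kQ_n` by the
two-sided ideal generated by the mesh relations. -/
def AuslanderTaft : Type _ := (meshCon k n).Quotient

noncomputable instance : Ring (AuslanderTaft k n) :=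
  inferInstanceAs (Ring (meshCon k n).Quotient)

noncomputable instance : Algebra k (AuslanderTaft k n) :=
  inferInstanceAs (Algebra k (meshCon k n).Quotient)

/-- The idempotent of the Auslander algebra at the vertex `x` of `Q_n`. -/
noncomputable def vertexIdem (x : Vertex n) : AuslanderTaft k n :=
  (meshCon k n).mk' (PathAlgebra.ofPath k (Quiver.Path.nil : Quiver.Path x x))

end

/-! ### Hochschild and cyclic homology of an algebra -/

section

variable (k : Type*) [CommRing k] (A : Type*) [Ring A] [Algebra k A]

/-- The module `A^{⊗(m+1)}` of Hochschild `m`-chains. -/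
abbrev Chains (m : ℕ) : Type _ := PiTensorProduct k (fun _ : Fin (m + 1) => A)

theorem exists_contractNth_update (m : ℕ) (i : Fin (m + 1)) (c : Fin (m + 2) → A)
    (l : Fin (m + 2)) : ∃ (j : Fin (m + 1)) (g : A →ₗ[k] A), ∀ x : A,
      Fin.contractNth i.castSucc (fun x y : A => x * y) (Function.update c l x) =
        Function.update (Fin.contractNth i.castSucc (fun x y : A => x * y) c) j (g x) := by
  rcases lt_trichotomy (l : ℕ) (i : ℕ) with h | h | h
  · refine ⟨⟨l, by omega⟩, LinearMap.id, fun x => funext fun a => ?_⟩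
    simp only [Fin.contractNth, Function.update_apply, Fin.ext_iff, Fin.val_castSucc, Fin.val_succ,
      LinearMap.id_apply]
    split_ifs <;> first | rfl | omega
  · refine ⟨i, LinearMap.mulRight k (c i.succ), fun x => funext fun a => ?_⟩
    simp only [Fin.contractNth, Function.update_apply, Fin.ext_iff, Fin.val_castSucc, Fin.val_succ,
      LinearMap.mulRight_apply]
    split_ifs with h1 h2 h3 h4 h5 h6 h7 <;> first | rfl | omega | skip
    all_goals (obtain rfl : a = i := Fin.ext (by omega); rfl)
  · rcases Nat.eq_or_lt_of_le (Nat.succ_le_of_lt h) with h' | h'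
    · refine ⟨i, LinearMap.mulLeft k (c i.castSucc), fun x => funext fun a => ?_⟩
      simp only [Fin.contractNth, Function.update_apply, Fin.ext_iff, Fin.val_castSucc,
        Fin.val_succ, LinearMap.mulLeft_apply]
      split_ifs with h1 h2 h3 h4 h5 h6 h7 <;> first | rfl | omega | skip
      all_goals (obtain rfl : a = i := Fin.ext (by omega); rfl)
    · refine ⟨⟨l - 1, by omega⟩, LinearMap.id, fun x => funext fun a => ?_⟩
      simp only [Fin.contractNth, Function.update_apply, Fin.ext_iff, Fin.val_castSucc,
        Fin.val_succ, LinearMap.id_apply]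
      split_ifs <;> first | rfl | omega

/-- The multilinear map `(a_0, …, a_{m+1}) ↦ a_0 ⊗ ⋯ ⊗ a_i a_{i+1} ⊗ ⋯ ⊗ a_{m+1}`. -/
noncomputable def faceMultilinear (m : ℕ) (i : Fin (m + 1)) :
    MultilinearMap k (fun _ : Fin (m + 2) => A) (Chains k A m) :=
  MultilinearMap.mk'
    (fun c => PiTensorProduct.tprod k (Fin.contractNth i.castSucc (fun x y : A => x * y) c))
    (fun c l x y => by
      obtain ⟨j, g, hg⟩ := exists_contractNth_update k A m i c l
      simp only [hg, map_add, MultilinearMap.map_update_add])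
    (fun c l r x => by
      obtain ⟨j, g, hg⟩ := exists_contractNth_update k A m i c l
      simp only [hg, map_smul, MultilinearMap.map_update_smul])

/-- The inner face `a_0 ⊗ ⋯ ⊗ a_{m+1} ↦ a_0 ⊗ ⋯ ⊗ a_i a_{i+1} ⊗ ⋯ ⊗ a_{m+1}`, `0 ≤ i ≤ m`. -/
noncomputable def face (m : ℕ) (i : Fin (m + 1)) : Chains k A (m + 1) →ₗ[k] Chains k A m :=
  PiTensorProduct.lift (faceMultilinear k A m i)

/-- The unsigned cyclic rotation `a_0 ⊗ ⋯ ⊗ a_m ↦ a_m ⊗ a_0 ⊗ ⋯ ⊗ a_{m-1}`. -/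
noncomputable def rotation (m : ℕ) : Chains k A m →ₗ[k] Chains k A m :=
  (PiTensorProduct.reindex k (fun _ : Fin (m + 1) => A) (finRotate (m + 1))).toLinearMap

/-- The cyclic operator `t`, `a_0 ⊗ ⋯ ⊗ a_m ↦ (-1)^m a_m ⊗ a_0 ⊗ ⋯ ⊗ a_{m-1}`. -/
noncomputable def cyclicT (m : ℕ) : Chains k A m →ₗ[k] Chains k A m :=
  (-1 : k) ^ m • rotation k A m

/-- The norm operator `N = 1 + t + ⋯ + t^m` on `A^{⊗(m+1)}`. -/
noncomputable def cyclicN (m : ℕ) : Chains k A m →ₗ[k] Chains k A m :=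
  ∑ j ∈ Finset.range (m + 1), cyclicT k A m ^ j

/-- The bar differential `b'`, the alternating sum of the inner faces. -/
noncomputable def barB (m : ℕ) : Chains k A (m + 1) →ₗ[k] Chains k A m :=
  ∑ i : Fin (m + 1), (-1 : k) ^ (i : ℕ) • face k A m i

/-- The Hochschild differential `b`: the sum of `b'` and of the last, cyclic, face
`(-1)^{m+1} a_{m+1} a_0 ⊗ a_1 ⊗ ⋯ ⊗ a_m`. -/
noncomputable def hochschildB (m : ℕ) : Chains k A (m + 1) →ₗ[k] Chains k A m :=
  barB k A m + (-1 : k) ^ (m + 1) • (face k A m 0 ∘ₗ rotation k A (m + 1))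

/-- Hochschild `m`-cycles. -/
noncomputable def hochschildCycles : (m : ℕ) → Submodule k (Chains k A m)
  | 0 => ⊤
  | m + 1 => LinearMap.ker (hochschildB k A m)

/-- The Hochschild homology `HH_m(A)` of the `k`-algebra `A` with coefficients in `A`: cycles modulo
boundaries of the Hochschild complex. -/
abbrev HochschildHomology (m : ℕ) : Type _ :=
  hochschildCycles k A m ⧸
    (LinearMap.range (hochschildB k A m)).submoduleOf (hochschildCycles k A m)

/-- The class in `HH_0(A)` of an element of `A`. -/
noncomputable def hochschildClassZero (x : A) : HochschildHomology k A 0 :=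
  Submodule.Quotient.mk ⟨PiTensorProduct.tprod k (fun _ : Fin 1 => x), Submodule.mem_top⟩

/-- Degree `m` of the total complex of the cyclic bicomplex `CC(A)`, whose entry in column `p` and
row `q` is `A^{⊗(q+1)}`: the sum over `p + q = m`, indexed by the row `q`. -/
abbrev CyclicTot (m : ℕ) : Type _ := (q : Fin (m + 1)) → Chains k A q

/-- The differential of the total complex of `CC(A)`.  The columns with `p` even carry `b`, those
with `p` odd carry `-b'`; the horizontal maps are `1 - t` from odd to even columns and `N` from
even to odd columns.  The component of the differential at row `q`, column `p = m - q`, comes from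
row `q + 1` in the same column and from row `q` in the column `p + 1`. -/
noncomputable def cyclicTotD (m : ℕ) : CyclicTot k A (m + 1) →ₗ[k] CyclicTot k A m :=
  LinearMap.pi fun q : Fin (m + 1) =>
    if Even (m - (q : ℕ)) then
      hochschildB k A q ∘ₗ LinearMap.proj (R := k) (φ := fun q : Fin (m + 2) => Chains k A q) q.succ
        + (LinearMap.id - cyclicT k A q) ∘ₗ
          LinearMap.proj (R := k) (φ := fun q : Fin (m + 2) => Chains k A q) q.castSucc
    else
      -(barB k A q ∘ₗ LinearMap.proj (R := k) (φ := fun q : Fin (m + 2) => Chains k A q) q.succ)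
        + cyclicN k A q ∘ₗ
          LinearMap.proj (R := k) (φ := fun q : Fin (m + 2) => Chains k A q) q.castSucc

/-- Cycles of degree `m` of the total complex of `CC(A)`. -/
noncomputable def cyclicCycles : (m : ℕ) → Submodule k (CyclicTot k A m)
  | 0 => ⊤
  | m + 1 => LinearMap.ker (cyclicTotD k A m)

/-- The cyclic homology `HC_m(A)` of the `k`-algebra `A`: the homology of the total complex of the
cyclic bicomplex, cycles modulo boundaries. -/
abbrev CyclicHomology (m : ℕ) : Type _ :=
  cyclicCycles k A m ⧸ (LinearMap.range (cyclicTotD k A m)).submoduleOf (cyclicCycles k A m)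

end

end TaftAuslander

namespace TaftAuslander

open scoped TensorProduct

universe u

/-! ### Hochschild chains with coefficients in a bimodule -/

/-! Normal forms. Give the vertex `(j, u)` the level `j - u - 1`, read in `{0, …, n - 1}`. Arrows
`a` lower the level by one and arrows `b` raise it by one. The mesh relations replace "`b`, then
`a`" by minus "`a`, then `b`", and kill such a path when it starts at level 0. So every path is zero
or, up to sign, a monomial `b^t a^s` that descends to a turning vertex `(j, u)` and then climbs. An
explicit model of the regular representation shows that the monomials with `level + s < n` and
`level + t < n` form a basis (`linearCombination_coords`, `coords_monomial`).

Hochschild homology in positive degrees. Write `A` for the algebra. If a set `F` of vertices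
contains everything of smaller level than any of its members, the monomials turning in `F` span a
two-sided ideal `I_F`. Let `e` be a vertex `(j, u)` of least level outside `F`, let `F'` be `F` with
this vertex added, `B = A / I_F`, `α = a_{j,u}`, and `p` the vertex where `α` ends (`p = 0` at level
0, where `α` does not exist). Right multiplication by `α` embeds `A p` in `A e`; the cokernel has
the powers `b^t` as a basis, `e B` has the powers `a^s`, and the products `b^t a^s` form a basis of
`I_F' / I_F`. Hence there is an exact sequence of bimodules 0 → A p ⊗ e B → A e ⊗ e B → A / I_F → A
/ I_F' → 0. For idempotent `p` the bimodule `A p ⊗ e B` has no homology in positive degrees, and its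
homology in degree 0 is `e B p`, which vanishes because `e A p = 0`. So vanishing in positive
degrees passes from `A / I_F'` to `A / I_F`. Starting with all vertices, where the quotient is zero,
one arrives at `F = ∅` and at `A` itself. The argument is carried by `Ch.acyclic_of_splitting`,
`Ch.acyclic_of_exact`, `acyclic_quot_of_heredity` and `acyclic_quot_insert`.

Degree 0. A monomial with distinct ends is a commutator, and one with equal ends is a vertex because
`s, t < n`. The augmentation that kills the arrows separates the vertices.

Cyclic homology. The column with `b'` is exact because `A` has a unit, and the column with `b` is
exact in positive degrees by the above. So the first two columns of the bicomplex form a complex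
that is exact in positive degrees (`exists_cyclicTotD_eq`), the periodicity map from degree `m + 2`
to degree `m` is an isomorphism, and it remains to look at degrees 0 and 1. Nothing is divided by,
so the characteristic plays no role. -/

/-- An `A`-bimodule structure on a `k`-module `M`, given by commuting left and right actions. -/
structure Bimod (k A M : Type u) [CommRing k] [Ring A] [Algebra k A] [AddCommGroup M]
    [Module k M] where
  l : A →ₗ[k] M →ₗ[k] M
  r : A →ₗ[k] M →ₗ[k] M
  l_mul : ∀ a b x, l (a * b) x = l a (l b x)
  r_mul : ∀ a b x, r (a * b) x = r b (r a x)
  comm : ∀ a b x, l a (r b x) = r b (l a x)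

section Chains

variable (k A M : Type u) [CommRing k] [Ring A] [Algebra k A] [AddCommGroup M] [Module k M]

/-- The modules `M ⊗ A^{⊗m}`, built by adding one tensor factor on the right at a time. -/
noncomputable def chainModule : ℕ → ModuleCat.{u} k
  | 0 => ModuleCat.of k M
  | m + 1 => ModuleCat.of k (chainModule m ⊗[k] A)

/-- Hochschild `m`-chains `M ⊗ A^{⊗m}` with coefficients in `M`. -/
def Ch (m : ℕ) : Type u := chainModule k A M m

noncomputable instance (m : ℕ) : AddCommGroup (Ch k A M m) :=
  inferInstanceAs (AddCommGroup (chainModule k A M m))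

noncomputable instance (m : ℕ) : Module k (Ch k A M m) :=
  inferInstanceAs (Module k (chainModule k A M m))

namespace Ch

/-- Chains of degree `0`. -/
noncomputable def zeroEquiv : M ≃ₗ[k] Ch k A M 0 := LinearEquiv.refl k M

/-- Chains of degree `m + 1`. -/
noncomputable def succEquiv (m : ℕ) : Ch k A M m ⊗[k] A ≃ₗ[k] Ch k A M (m + 1) :=
  LinearEquiv.refl k (Ch k A M m ⊗[k] A)

variable {k A M}

/-- The chain `x ⊗ a`. -/
noncomputable def mk {m : ℕ} : Ch k A M m →ₗ[k] A →ₗ[k] Ch k A M (m + 1) :=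
  (TensorProduct.mk k (Ch k A M m) A).compr₂ (succEquiv k A M m).toLinearMap

@[simp] theorem succEquiv_tmul {m : ℕ} (x : Ch k A M m) (a : A) :
    succEquiv k A M m (x ⊗ₜ[k] a) = mk x a := rfl

@[simp] theorem succEquiv_symm_mk {m : ℕ} (x : Ch k A M m) (a : A) :
    (succEquiv k A M m).symm (mk x a) = x ⊗ₜ[k] a := rfl

variable {P : Type*} [AddCommGroup P] [Module k P]

/-- The linear map on chains of degree `m + 1` induced by a bilinear map. -/
noncomputable def lift {m : ℕ} (f : Ch k A M m →ₗ[k] A →ₗ[k] P) : Ch k A M (m + 1) →ₗ[k] P :=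
  TensorProduct.lift f ∘ₗ (succEquiv k A M m).symm.toLinearMap

@[simp] theorem lift_mk {m : ℕ} (f : Ch k A M m →ₗ[k] A →ₗ[k] P) (x : Ch k A M m) (a : A) :
    lift f (mk x a) = f x a := by
  simp [lift]

theorem hom_ext {m : ℕ} {f g : Ch k A M (m + 1) →ₗ[k] P} (h : ∀ x a, f (mk x a) = g (mk x a)) :
    f = g := by
  have : f ∘ₗ (succEquiv k A M m).toLinearMap = g ∘ₗ (succEquiv k A M m).toLinearMap :=
    TensorProduct.ext' fun x a => h x a
  ext y
  simpa using LinearMap.congr_fun this ((succEquiv k A M m).symm y)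

theorem zero_ext {f g : Ch k A M 0 →ₗ[k] P}
    (h : ∀ x : M, f (zeroEquiv k A M x) = g (zeroEquiv k A M x)) : f = g := by
  ext y
  simpa using h ((zeroEquiv k A M).symm y)

variable (B : Bimod k A M)

/-- Right multiplication on the last tensor factor. -/
noncomputable def rmul : (m : ℕ) → Ch k A M m →ₗ[k] A →ₗ[k] Ch k A M m
  | 0 => B.r.flip.compr₂ (zeroEquiv k A M).toLinearMap ∘ₗ (zeroEquiv k A M).symm.toLinearMap
  | _ + 1 => lift (LinearMap.mk₂ k (fun x c => (mk x) ∘ₗ (LinearMap.mul k A c))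
      (fun x y c => by simp [LinearMap.add_comp]) (fun s x c => by simp [LinearMap.smul_comp])
      (fun x c d => by simp [LinearMap.comp_add]) (fun s x c => by simp [LinearMap.comp_smul]))

/-- Left multiplication on the coefficients. -/
noncomputable def lmul : (m : ℕ) → Ch k A M m →ₗ[k] A →ₗ[k] Ch k A M m
  | 0 => B.l.flip.compr₂ (zeroEquiv k A M).toLinearMap ∘ₗ (zeroEquiv k A M).symm.toLinearMap
  | m + 1 => lift (LinearMap.mk₂ k (fun x c => (mk.flip c) ∘ₗ (lmul m x))
      (fun x y c => by simp [LinearMap.comp_add]) (fun s x c => by simp [LinearMap.comp_smul])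
      (fun x c d => by simp [LinearMap.add_comp]) (fun s x c => by simp [LinearMap.smul_comp]))

@[simp] theorem rmul_zero_apply (x : M) (a : A) :
    rmul B 0 (zeroEquiv k A M x) a = zeroEquiv k A M (B.r a x) := by
  simp [rmul]

@[simp] theorem lmul_zero_apply (x : M) (a : A) :
    lmul B 0 (zeroEquiv k A M x) a = zeroEquiv k A M (B.l a x) := by
  simp [lmul]

@[simp] theorem rmul_mk {m : ℕ} (x : Ch k A M m) (c a : A) :
    rmul B (m + 1) (mk x c) a = mk x (c * a) := by
  simp [rmul]

@[simp] theorem lmul_mk {m : ℕ} (x : Ch k A M m) (c a : A) :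
    lmul B (m + 1) (mk x c) a = mk (lmul B m x a) c := by
  simp [lmul]

/-- The sum of all the faces but the cyclic one, with signs. -/
noncomputable def bar : (m : ℕ) → Ch k A M (m + 1) →ₗ[k] Ch k A M m
  | 0 => lift (rmul B 0)
  | m + 1 => lift (mk ∘ₗ bar m + (-1 : k) ^ (m + 1) • rmul B (m + 1))

/-- The cyclic face. -/
noncomputable def cyc (m : ℕ) : Ch k A M (m + 1) →ₗ[k] Ch k A M m := lift (lmul B m)

/-- The Hochschild differential with coefficients in a bimodule. -/
noncomputable def diff (m : ℕ) : Ch k A M (m + 1) →ₗ[k] Ch k A M m :=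
  bar B m + (-1 : k) ^ (m + 1) • cyc B m

@[simp] theorem bar_zero_mk (x : Ch k A M 0) (a : A) : bar B 0 (mk x a) = rmul B 0 x a := by
  simp [bar]

@[simp] theorem bar_succ_mk {m : ℕ} (x : Ch k A M (m + 1)) (a : A) :
    bar B (m + 1) (mk x a) = mk (bar B m x) a + (-1 : k) ^ (m + 1) • rmul B (m + 1) x a := by
  simp [bar]

@[simp] theorem cyc_mk {m : ℕ} (x : Ch k A M m) (a : A) : cyc B m (mk x a) = lmul B m x a := by
  simp [cyc]

theorem diff_apply {m : ℕ} (x : Ch k A M (m + 1)) :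
    diff B m x = bar B m x + (-1 : k) ^ (m + 1) • cyc B m x := rfl

theorem bar_rmul {m : ℕ} (x : Ch k A M (m + 1)) (a : A) :
    bar B m (rmul B (m + 1) x a) = rmul B m (bar B m x) a := by
  suffices bar B m ∘ₗ (rmul B (m + 1)).flip a = (rmul B m).flip a ∘ₗ bar B m from
    LinearMap.congr_fun this x
  refine hom_ext fun x c => ?_
  cases m with
  | zero =>
    obtain ⟨x, rfl⟩ := (zeroEquiv k A M).surjective x
    simp [B.r_mul]
  | succ m =>
    suffices h : rmul B (m + 1) x (c * a) = rmul B (m + 1) (rmul B (m + 1) x c) a by simp [h]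
    suffices (rmul B (m + 1)).flip (c * a) =
        (rmul B (m + 1)).flip a ∘ₗ (rmul B (m + 1)).flip c from LinearMap.congr_fun this x
    exact hom_ext fun y d => by simp [mul_assoc]

theorem lmul_rmul {m : ℕ} (x : Ch k A M m) (a c : A) :
    lmul B m (rmul B m x a) c = rmul B m (lmul B m x c) a := by
  cases m with
  | zero =>
    obtain ⟨x, rfl⟩ := (zeroEquiv k A M).surjective x
    simp [B.comm]
  | succ m =>
    suffices (lmul B (m + 1)).flip c ∘ₗ (rmul B (m + 1)).flip a =
        (rmul B (m + 1)).flip a ∘ₗ (lmul B (m + 1)).flip c from LinearMap.congr_fun this x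
    exact hom_ext fun y d => by simp

theorem bar_lmul {m : ℕ} (x : Ch k A M (m + 1)) (a : A) :
    bar B m (lmul B (m + 1) x a) = lmul B m (bar B m x) a := by
  suffices bar B m ∘ₗ (lmul B (m + 1)).flip a = (lmul B m).flip a ∘ₗ bar B m from
    LinearMap.congr_fun this x
  induction m with
  | zero => exact hom_ext fun x c => by simp [lmul_rmul]
  | succ m ih =>
    refine hom_ext fun x c => ?_
    have h : bar B m (lmul B (m + 1) x a) = lmul B m (bar B m x) a :=
      LinearMap.congr_fun (ih x) x
    simp [h, lmul_rmul]

theorem lmul_mul {m : ℕ} (x : Ch k A M m) (a c : A) :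
    lmul B m x (a * c) = lmul B m (lmul B m x c) a := by
  suffices (lmul B m).flip (a * c) = (lmul B m).flip a ∘ₗ (lmul B m).flip c from
    LinearMap.congr_fun this x
  induction m with
  | zero => exact zero_ext fun x => by simp [B.l_mul]
  | succ m ih =>
    refine hom_ext fun y d => ?_
    have h : lmul B m y (a * c) = lmul B m (lmul B m y c) a := LinearMap.congr_fun (ih y) y
    simp [h]

theorem bar_bar {m : ℕ} (x : Ch k A M (m + 2)) : bar B m (bar B (m + 1) x) = 0 := by
  suffices bar B m ∘ₗ bar B (m + 1) = 0 from LinearMap.congr_fun this x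
  induction m with
  | zero =>
    refine hom_ext fun x a => ?_
    simp [bar_rmul]
  | succ m ih =>
    refine hom_ext fun x a => ?_
    have h : bar B m (bar B (m + 1) x) = 0 := LinearMap.congr_fun (ih x) x
    simp [bar_rmul, h, pow_succ]

/-- The inner faces already square to zero. What remains cancels because merging the last two
factors and then moving the result to the front is the same as moving the two factors to the front
one after the other, which is `lmul_mul`. -/
theorem diff_diff {m : ℕ} (x : Ch k A M (m + 2)) : diff B m (diff B (m + 1) x) = 0 := by
  suffices diff B m ∘ₗ diff B (m + 1) = 0 from LinearMap.congr_fun this x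
  refine hom_ext fun x a => ?_
  have h0 := bar_bar B (mk x a)
  suffices e : cyc B m (bar B (m + 1) (mk x a)) = bar B m (cyc B (m + 1) (mk x a)) -
      (-1 : k) ^ m • cyc B m (cyc B (m + 1) (mk x a)) by
    simp only [LinearMap.comp_apply, diff_apply, map_add, map_smul, h0, e, LinearMap.zero_apply]
    module
  suffices h : (-1 : k) ^ (m + 1) • cyc B m (rmul B (m + 1) x a) +
      (-1 : k) ^ m • cyc B m (lmul B (m + 1) x a) = 0 by
    simp only [bar_succ_mk, cyc_mk, map_add, map_smul, bar_lmul]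
    rw [eq_neg_of_add_eq_zero_left h, sub_eq_add_neg]
  suffices h : cyc B m (rmul B (m + 1) x a) = cyc B m (lmul B (m + 1) x a) by
    rw [h, ← add_smul, pow_succ]
    simp
  suffices cyc B m ∘ₗ (rmul B (m + 1)).flip a = cyc B m ∘ₗ (lmul B (m + 1)).flip a from
    LinearMap.congr_fun this x
  exact hom_ext fun y c => by simp [lmul_mul]

/-- The Hochschild cycles. -/
def IsCycle : (m : ℕ) → Ch k A M m → Prop
  | 0, _ => True
  | m + 1, x => diff B m x = 0

/-- The homology of `A` with coefficients in the bimodule vanishes in degree `m`. -/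
def Acyclic (m : ℕ) : Prop := ∀ x : Ch k A M m, IsCycle B m x → ∃ y, diff B m y = x

end Ch

end Chains

/-! ### Functoriality of the chains in the coefficient bimodule -/

section

variable {k A M M' M'' : Type u} [CommRing k] [Ring A] [Algebra k A]
  [AddCommGroup M] [Module k M] [AddCommGroup M'] [Module k M'] [AddCommGroup M''] [Module k M'']

/-- A linear map between bimodules is a bimodule morphism. -/
def Bimod.IsHom (B : Bimod k A M) (B' : Bimod k A M') (f : M →ₗ[k] M') : Prop :=
  (∀ a x, f (B.l a x) = B'.l a (f x)) ∧ ∀ a x, f (B.r a x) = B'.r a (f x)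

namespace Ch

/-- The map induced on chains by a linear map between coefficients. -/
noncomputable def map (f : M →ₗ[k] M') : (m : ℕ) → Ch k A M m →ₗ[k] Ch k A M' m
  | 0 => (zeroEquiv k A M').toLinearMap ∘ₗ f ∘ₗ (zeroEquiv k A M).symm.toLinearMap
  | m + 1 => lift (mk ∘ₗ map f m)

@[simp] theorem map_zero_apply (f : M →ₗ[k] M') (x : M) :
    map f 0 (zeroEquiv k A M x) = zeroEquiv k A M' (f x) := by
  simp [map]

@[simp] theorem map_mk (f : M →ₗ[k] M') {m : ℕ} (x : Ch k A M m) (a : A) :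
    map f (m + 1) (mk x a) = mk (map f m x) a := by
  simp [map]

/-- In this form surjectivity, injectivity and exactness climb from one degree to the next by the
properties of tensoring with `A`. -/
theorem map_succ_eq (f : M →ₗ[k] M') (m : ℕ) :
    map (A := A) f (m + 1) = (succEquiv k A M' m).toLinearMap ∘ₗ (map f m).rTensor A ∘ₗ
      (succEquiv k A M m).symm.toLinearMap :=
  hom_ext fun x a => by simp

section naturality

variable {B : Bimod k A M} {B' : Bimod k A M'} {f : M →ₗ[k] M'} (hf : B.IsHom B' f)

include hf

theorem map_rmul {m : ℕ} (x : Ch k A M m) (a : A) :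
    map f m (rmul B m x a) = rmul B' m (map f m x) a := by
  suffices map f m ∘ₗ (rmul B m).flip a = (rmul B' m).flip a ∘ₗ map f m from
    LinearMap.congr_fun this x
  cases m with
  | zero => exact zero_ext fun x => by simp [hf.2]
  | succ m => exact hom_ext fun x c => by simp

theorem map_lmul {m : ℕ} (x : Ch k A M m) (a : A) :
    map f m (lmul B m x a) = lmul B' m (map f m x) a := by
  suffices map f m ∘ₗ (lmul B m).flip a = (lmul B' m).flip a ∘ₗ map f m from
    LinearMap.congr_fun this x
  induction m with
  | zero => exact zero_ext fun x => by simp [hf.1]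
  | succ m ih =>
    refine hom_ext fun x c => ?_
    have h : map f m (lmul B m x a) = lmul B' m (map f m x) a := LinearMap.congr_fun (ih x) x
    simp [h]

theorem map_bar {m : ℕ} (x : Ch k A M (m + 1)) :
    map f m (bar B m x) = bar B' m (map f (m + 1) x) := by
  suffices map f m ∘ₗ bar B m = bar B' m ∘ₗ map f (m + 1) from LinearMap.congr_fun this x
  induction m with
  | zero => exact hom_ext fun x c => by simp [map_rmul hf]
  | succ m ih =>
    refine hom_ext fun x c => ?_
    have h : map f m (bar B m x) = bar B' m (map f (m + 1) x) := LinearMap.congr_fun (ih x) x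
    have h' := map_rmul hf x c
    simp only [LinearMap.comp_apply, bar_succ_mk, map_add, map_smul, map_mk, h, h']

theorem map_diff {m : ℕ} (x : Ch k A M (m + 1)) :
    map f m (diff B m x) = diff B' m (map f (m + 1) x) := by
  suffices map f m ∘ₗ cyc B m = cyc B' m ∘ₗ map f (m + 1) by
    have h : map f m (cyc B m x) = cyc B' m (map f (m + 1) x) := LinearMap.congr_fun this x
    simp [diff_apply, map_bar hf, h]
  exact hom_ext fun x c => by simp [map_lmul hf]

theorem IsCycle.map {m : ℕ} {x : Ch k A M m} (hx : IsCycle B m x) : IsCycle B' m (map f m x) := by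
  cases m with
  | zero => trivial
  | succ m =>
    have hx : diff B m x = 0 := hx
    change diff B' m _ = 0
    rw [← map_diff hf, hx, map_zero]

end naturality

theorem isCycle_diff (B : Bimod k A M) {m : ℕ} (x : Ch k A M (m + 1)) :
    IsCycle B m (diff B m x) := by
  cases m with
  | zero => trivial
  | succ m => exact diff_diff B x

theorem IsCycle.sub {B : Bimod k A M} {m : ℕ} {x y : Ch k A M m} (hx : IsCycle B m x)
    (hy : IsCycle B m y) : IsCycle B m (x - y) := by
  cases m with
  | zero => trivial
  | succ m =>
    change diff B m _ = 0
    rw [map_sub, show diff B m x = 0 from hx, show diff B m y = 0 from hy, sub_zero]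

theorem map_surjective {f : M →ₗ[k] M'} (hf : Function.Surjective f) (m : ℕ) :
    Function.Surjective (map (A := A) f m) := by
  induction m with
  | zero =>
    intro y
    obtain ⟨y, rfl⟩ := (zeroEquiv k A M').surjective y
    obtain ⟨x, rfl⟩ := hf y
    exact ⟨zeroEquiv k A M x, by simp⟩
  | succ m ih =>
    rw [map_succ_eq]
    simpa using LinearMap.rTensor_surjective A ih

end Ch

/-! ### Relatively projective bimodules -/

section Split

variable {B : Bimod k A M} (σ : M →ₗ[k] M ⊗[k] A)

/-- The multiplication `M ⊗ A → M`, `x ⊗ a ↦ a x`. -/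
noncomputable def Bimod.lAction (B : Bimod k A M) : M ⊗[k] A →ₗ[k] M := TensorProduct.lift B.l.flip

/-- The multiplication `M ⊗ A → M`, `x ⊗ a ↦ x a`. -/
noncomputable def Bimod.rAction (B : Bimod k A M) : M ⊗[k] A →ₗ[k] M := TensorProduct.lift B.r.flip

/-- A splitting of the left multiplication of a bimodule by a bimodule morphism. -/
structure Bimod.Splitting (B : Bimod k A M) (σ : M →ₗ[k] M ⊗[k] A) : Prop where
  action : ∀ x, B.lAction (σ x) = x
  l : ∀ a x, σ (B.l a x) = (LinearMap.mul k A a).lTensor M (σ x)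
  r : ∀ a x, σ (B.r a x) = (B.r a).rTensor A (σ x)

namespace Ch

theorem rTensor_lTensor_apply {V W : Type*} [AddCommGroup V] [Module k V] [AddCommGroup W]
    [Module k W] (f : V →ₗ[k] W) (g : A →ₗ[k] A) (y : V ⊗[k] A) :
    f.rTensor A (g.lTensor V y) = g.lTensor W (f.rTensor A y) := by
  rw [← LinearMap.comp_apply, ← LinearMap.comp_apply, LinearMap.rTensor_comp_lTensor,
    LinearMap.lTensor_comp_rTensor]

/-- The contracting homotopy defined by a splitting. -/
noncomputable def homotopy : (m : ℕ) → Ch k A M m →ₗ[k] Ch k A M m ⊗[k] A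
  | 0 => (zeroEquiv k A M).toLinearMap.rTensor A ∘ₗ σ ∘ₗ (zeroEquiv k A M).symm.toLinearMap
  | m + 1 => lift ((LinearMap.lcomp k _ (homotopy m)) ∘ₗ
      (LinearMap.rTensorHom A) ∘ₗ (mk (m := m)).flip).flip

/-- The homotopy applies `σ` to the coefficient only and keeps the resulting element of `A` as an
extra factor to the right of all others, which is where the cyclic face looks for it. -/
theorem homotopy_zero_apply (x : M) :
    homotopy σ 0 (zeroEquiv k A M x) = (zeroEquiv k A M).toLinearMap.rTensor A (σ x) := by
  simp [homotopy]

theorem homotopy_mk {m : ℕ} (x : Ch k A M m) (a : A) :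
    homotopy σ (m + 1) (mk x a) = (mk.flip a).rTensor A (homotopy σ m x) := by
  simp [homotopy]

variable {σ} (hσ : B.Splitting σ)

include hσ

theorem homotopy_rmul {m : ℕ} (x : Ch k A M m) (a : A) :
    homotopy σ m (rmul B m x a) = ((rmul B m).flip a).rTensor A (homotopy σ m x) := by
  suffices homotopy σ m ∘ₗ (rmul B m).flip a =
      ((rmul B m).flip a).rTensor A ∘ₗ homotopy σ m from LinearMap.congr_fun this x
  cases m with
  | zero =>
    refine zero_ext fun x => ?_
    simp only [LinearMap.comp_apply, LinearMap.flip_apply, rmul_zero_apply, homotopy_zero_apply,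
      hσ.r, ← LinearMap.rTensor_comp_apply]
    congr 2
  | succ m =>
    refine hom_ext fun x c => ?_
    simp only [LinearMap.comp_apply, LinearMap.flip_apply, rmul_mk, homotopy_mk,
      ← LinearMap.rTensor_comp_apply]
    congr 2

theorem homotopy_lmul {m : ℕ} (x : Ch k A M m) (a : A) :
    homotopy σ m (lmul B m x a) = (LinearMap.mul k A a).lTensor _ (homotopy σ m x) := by
  suffices homotopy σ m ∘ₗ (lmul B m).flip a =
      (LinearMap.mul k A a).lTensor _ ∘ₗ homotopy σ m from LinearMap.congr_fun this x
  induction m with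
  | zero =>
    refine zero_ext fun x => ?_
    simp only [LinearMap.comp_apply, LinearMap.flip_apply, lmul_zero_apply, homotopy_zero_apply,
      hσ.l, rTensor_lTensor_apply]
  | succ m ih =>
    refine hom_ext fun x c => ?_
    have h : homotopy σ m (lmul B m x a) = (LinearMap.mul k A a).lTensor _ (homotopy σ m x) :=
      LinearMap.congr_fun (ih x) x
    simp only [LinearMap.comp_apply, LinearMap.flip_apply, lmul_mk, homotopy_mk, h,
      rTensor_lTensor_apply]

/-- The factors between the coefficient and the new one are passive, so this is the identity
`lAction ∘ σ = id` of the splitting. -/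
theorem lift_lmul_homotopy {m : ℕ} (x : Ch k A M m) :
    TensorProduct.lift (lmul B m) (homotopy σ m x) = x := by
  suffices TensorProduct.lift (lmul B m) ∘ₗ homotopy σ m = LinearMap.id from
    LinearMap.congr_fun this x
  induction m with
  | zero =>
    refine zero_ext fun x => ?_
    have h : TensorProduct.lift (lmul B 0) ∘ₗ (zeroEquiv k A M).toLinearMap.rTensor A =
        (zeroEquiv k A M).toLinearMap ∘ₗ B.lAction :=
      TensorProduct.ext' fun x a => by simp [Bimod.lAction]
    have := LinearMap.congr_fun h (σ x)
    simpa [homotopy_zero_apply, hσ.action] using this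
  | succ m ih =>
    refine hom_ext fun x c => ?_
    have h : TensorProduct.lift (lmul B (m + 1)) ∘ₗ ((mk (m := m)).flip c).rTensor A =
        (mk.flip c) ∘ₗ TensorProduct.lift (lmul B m) :=
      TensorProduct.ext' fun x a => by simp
    have h' : TensorProduct.lift (lmul B m) (homotopy σ m x) = x := LinearMap.congr_fun (ih x) x
    have := LinearMap.congr_fun h (homotopy σ m x)
    simpa [homotopy_mk, h'] using this

/-- The inner faces touch the coefficient only through the right action, so right linearity of `σ`
suffices. -/
theorem rTensor_bar_homotopy {m : ℕ} (x : Ch k A M (m + 1)) :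
    (bar B m).rTensor A (homotopy σ (m + 1) x) = homotopy σ m (bar B m x) := by
  suffices (bar B m).rTensor A ∘ₗ homotopy σ (m + 1) = homotopy σ m ∘ₗ bar B m from
    LinearMap.congr_fun this x
  induction m with
  | zero =>
    refine hom_ext fun x c => ?_
    simp only [LinearMap.comp_apply, bar_zero_mk, homotopy_mk, homotopy_rmul hσ,
      ← LinearMap.rTensor_comp_apply]
    congr 2
  | succ m ih =>
    refine hom_ext fun x c => ?_
    have h : (bar B m).rTensor A (homotopy σ (m + 1) x) = homotopy σ m (bar B m x) :=
      LinearMap.congr_fun (ih x) x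
    have e : bar B (m + 1) ∘ₗ mk.flip c =
        mk.flip c ∘ₗ bar B m + (-1 : k) ^ (m + 1) • (rmul B (m + 1)).flip c := by
      ext y
      simp
    simp only [LinearMap.comp_apply, bar_succ_mk, homotopy_mk, map_add, map_smul,
      homotopy_rmul hσ, ← h, ← LinearMap.rTensor_comp_apply, e, LinearMap.rTensor_add,
      LinearMap.rTensor_smul, LinearMap.add_apply, LinearMap.smul_apply]

/-- By left linearity of `σ`, merging the last factor `c` with the factor produced by `σ` amounts to
multiplying the coefficient by `c` on the left before applying `σ`. Thus the new last inner face
reproduces the old cyclic face. -/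
theorem lift_rmul_homotopy {m : ℕ} (x : Ch k A M (m + 1)) :
    TensorProduct.lift (rmul B (m + 1)) (homotopy σ (m + 1) x) =
      succEquiv k A M m (homotopy σ m (cyc B m x)) := by
  suffices TensorProduct.lift (rmul B (m + 1)) ∘ₗ homotopy σ (m + 1) =
      (succEquiv k A M m).toLinearMap ∘ₗ homotopy σ m ∘ₗ cyc B m from LinearMap.congr_fun this x
  refine hom_ext fun x c => ?_
  have h : TensorProduct.lift (rmul B (m + 1)) ∘ₗ ((mk (m := m)).flip c).rTensor A =
      (succEquiv k A M m).toLinearMap ∘ₗ (LinearMap.mul k A c).lTensor _ :=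
    TensorProduct.ext' fun x a => by simp
  have := LinearMap.congr_fun h (homotopy σ m x)
  simpa [homotopy_mk, homotopy_lmul hσ] using this

theorem bar_homotopy {m : ℕ} (x : Ch k A M (m + 1)) :
    bar B (m + 1) (succEquiv k A M (m + 1) (homotopy σ (m + 1) x)) =
      succEquiv k A M m (homotopy σ m (bar B m x)) + (-1 : k) ^ (m + 1) •
        succEquiv k A M m (homotopy σ m (cyc B m x)) := by
  rw [← rTensor_bar_homotopy hσ, ← lift_rmul_homotopy hσ]
  generalize homotopy σ (m + 1) x = y
  suffices bar B (m + 1) ∘ₗ (succEquiv k A M (m + 1)).toLinearMap =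
      (succEquiv k A M m).toLinearMap ∘ₗ (bar B m).rTensor A +
        (-1 : k) ^ (m + 1) • TensorProduct.lift (rmul B (m + 1)) from LinearMap.congr_fun this y
  refine TensorProduct.ext' fun x a => ?_
  simp

theorem cyc_homotopy {m : ℕ} (x : Ch k A M m) :
    cyc B m (succEquiv k A M m (homotopy σ m x)) = x := by
  conv_rhs => rw [← lift_lmul_homotopy hσ x]
  simp [cyc, lift]

/-- The inner faces after the homotopy account for the whole differential before it, and the cyclic
face gives back `x`; a cycle is therefore a boundary up to sign. -/
theorem diff_homotopy {m : ℕ} (x : Ch k A M (m + 1)) :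
    diff B (m + 1) (succEquiv k A M (m + 1) (homotopy σ (m + 1) x)) =
      succEquiv k A M m (homotopy σ m (diff B m x)) + (-1 : k) ^ (m + 2) • x := by
  rw [diff_apply, bar_homotopy hσ, cyc_homotopy hσ, diff_apply, map_add, map_add, map_smul,
    map_smul]

theorem acyclic_of_splitting (m : ℕ) : Acyclic B (m + 1) := fun x hx => by
  have hx : diff B m x = 0 := hx
  have h := diff_homotopy hσ x
  rw [hx, map_zero, map_zero, zero_add] at h
  refine ⟨(-1 : k) ^ (m + 2) • succEquiv k A M (m + 1) (homotopy σ (m + 1) x), ?_⟩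
  rw [map_smul, h, smul_smul, ← mul_pow]
  simp

/-- In degree 0 the differential of `σ x` is `rAction (σ x) - x`, so `x` is a boundary as soon as
the first term vanishes. -/
theorem acyclic_zero_of_splitting (h0 : ∀ x, B.rAction (σ x) = 0) : Acyclic B 0 := fun x _ => by
  obtain ⟨x, rfl⟩ := (zeroEquiv k A M).surjective x
  refine ⟨-succEquiv k A M 0 (homotopy σ 0 (zeroEquiv k A M x)), ?_⟩
  rw [map_neg, diff_apply, cyc_homotopy hσ, homotopy_zero_apply]
  have h : bar B 0 ∘ₗ (succEquiv k A M 0).toLinearMap ∘ₗ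
      (zeroEquiv k A M).toLinearMap.rTensor A = (zeroEquiv k A M).toLinearMap ∘ₗ B.rAction := by
    refine TensorProduct.ext' fun x a => ?_
    simp [Bimod.rAction]
  have := LinearMap.congr_fun h (σ x)
  simp only [LinearMap.comp_apply, h0, LinearEquiv.coe_coe, map_zero] at this
  rw [this]
  simp

end Ch

end Split

end

/-! ### Exact sequences of coefficients -/

section

variable {k A X Y M M'' : Type u} [Field k] [Ring A] [Algebra k A]
  [AddCommGroup X] [Module k X] [AddCommGroup Y] [Module k Y]
  [AddCommGroup M] [Module k M] [AddCommGroup M''] [Module k M'']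

namespace Ch

/-- Over a field `A` is flat, which is what makes the chains an exact functor of the coefficients.
-/
theorem map_injective {f : X →ₗ[k] Y} (hf : Function.Injective f) (m : ℕ) :
    Function.Injective (map (A := A) f m) := by
  induction m with
  | zero =>
    intro x y h
    obtain ⟨x, rfl⟩ := (zeroEquiv k A X).surjective x
    obtain ⟨y, rfl⟩ := (zeroEquiv k A X).surjective y
    simp only [map_zero_apply, EmbeddingLike.apply_eq_iff_eq] at h
    rw [hf h]
  | succ m ih =>
    rw [map_succ_eq]
    simpa using Module.Flat.rTensor_preserves_injective_linearMap (M := A) _ ih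

theorem map_exact {f : X →ₗ[k] Y} {g : Y →ₗ[k] M} (h : Function.Exact f g) (m : ℕ) :
    Function.Exact (map (A := A) f m) (map (A := A) g m) := by
  induction m with
  | zero =>
    intro y
    obtain ⟨y, rfl⟩ := (zeroEquiv k A Y).surjective y
    simp only [map_zero_apply, LinearEquiv.map_eq_zero_iff, h y]
    constructor
    · rintro ⟨x, rfl⟩
      exact ⟨zeroEquiv k A X x, by simp⟩
    · rintro ⟨x, hx⟩
      obtain ⟨x, rfl⟩ := (zeroEquiv k A X).surjective x
      exact ⟨x, by simpa using hx⟩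
  | succ m ih =>
    have e := Module.Flat.rTensor_exact A ih
    intro y
    obtain ⟨y, rfl⟩ := (succEquiv k A Y m).surjective y
    simp only [map_succ_eq, LinearMap.comp_apply, LinearEquiv.coe_coe,
      LinearEquiv.symm_apply_apply, LinearEquiv.map_eq_zero_iff, e y]
    constructor
    · rintro ⟨x, rfl⟩
      exact ⟨succEquiv k A X m x, by simp⟩
    · rintro ⟨x, hx⟩
      obtain ⟨x, rfl⟩ := (succEquiv k A X m).surjective x
      exact ⟨x, by simpa using hx⟩

/-- The homology with coefficients in the third term of an exact sequence `0 → X → Y → M → M'' → 0`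
vanishes in positive degrees if that of `Y` and `M''` does, and that of `X` vanishes. -/
theorem acyclic_of_exact {BX : Bimod k A X} {BY : Bimod k A Y} {BM : Bimod k A M}
    {BM'' : Bimod k A M''} {f : X →ₗ[k] Y} {g : Y →ₗ[k] M} {q : M →ₗ[k] M''}
    (hf : BX.IsHom BY f) (hg : BY.IsHom BM g) (hq : BM.IsHom BM'' q)
    (f_inj : Function.Injective f) (fg : Function.Exact f g) (gq : Function.Exact g q)
    (q_surj : Function.Surjective q) (hX : ∀ m, Acyclic BX m) (hY : ∀ m, Acyclic BY (m + 1))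
    (hM'' : ∀ m, Acyclic BM'' (m + 1)) (m : ℕ) : Acyclic BM (m + 1) := fun x hx => by
  -- Subtract a boundary from `x` so that its image in `M''` is zero; the difference then lifts to a
  -- chain `v` with coefficients in `Y`.
  obtain ⟨y'', hy''⟩ := hM'' m (map q (m + 1) x) (hx.map hq)
  obtain ⟨y, rfl⟩ := map_surjective q_surj _ y''
  obtain ⟨v, hv⟩ := (map_exact gq (m + 1) (x - diff BM (m + 1) y)).1 (by
    rw [map_sub, map_diff hq, hy'', sub_self])
  have hcyc : IsCycle BM (m + 1) (x - diff BM (m + 1) y) := hx.sub (isCycle_diff BM y)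
  rw [← hv] at hcyc
  have hcyc : diff BM m (map g (m + 1) v) = 0 := hcyc
  -- The connecting map: the boundary of `v` dies in `M`, hence comes from a cycle `w` with
  -- coefficients in `X`, one degree lower. For `m = 0` this is why the homology of `X` must vanish
  -- in degree 0 too.
  obtain ⟨w, hw⟩ := (map_exact fg m (diff BY m v)).1 (by rw [map_diff hg, hcyc])
  have hwc : IsCycle BX m w := by
    cases m with
    | zero => trivial
    | succ m =>
      change diff BX m w = 0
      apply map_injective f_inj m
      rw [map_diff hf, hw, diff_diff, map_zero]
  obtain ⟨t, ht⟩ := hX m w hwc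
  -- Subtracting `f t` turns `v` into a cycle without changing its image in `M`.
  obtain ⟨c, hc⟩ := hY m (v - map f (m + 1) t) (by
    change diff BY m _ = 0
    rw [map_sub, ← map_diff hf, ht, hw, sub_self])
  refine ⟨map g (m + 2) c + y, ?_⟩
  have h0 : map g (m + 1) (map f (m + 1) t) = 0 := (map_exact fg (m + 1) _).2 ⟨t, rfl⟩
  rw [map_add, ← map_diff hg, hc, map_sub, h0, hv]
  abel

end Ch

end

/-! ### Bimodules attached to idempotents and ideals -/

section

variable {k A M : Type u} [CommRing k] [Ring A] [Algebra k A] [AddCommGroup M] [Module k M]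

variable (k A) in
/-- The regular bimodule. -/
noncomputable def Bimod.self : Bimod k A A where
  l := LinearMap.mul k A
  r := (LinearMap.mul k A).flip
  l_mul a b x := by simp [mul_assoc]
  r_mul a b x := by simp [mul_assoc]
  comm a b x := by simp [mul_assoc]

variable (k) in
/-- A subspace of an algebra is a two-sided ideal. -/
structure IsTwoSided (I : Submodule k A) : Prop where
  left : ∀ a, ∀ x ∈ I, a * x ∈ I
  right : ∀ a, ∀ x ∈ I, x * a ∈ I

/-- The quotient of an algebra by a two-sided ideal, as a bimodule. -/
noncomputable def Bimod.quot (I : Submodule k A) (hI : IsTwoSided k I) : Bimod k A (A ⧸ I) where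
  l := LinearMap.mk₂ k (fun a => I.mapQ I (LinearMap.mulLeft k a) (hI.left a))
    (fun a b x => by
      obtain ⟨x, rfl⟩ := I.mkQ_surjective x
      exact congrArg I.mkQ (add_mul a b x))
    (fun c a x => by
      obtain ⟨x, rfl⟩ := I.mkQ_surjective x
      exact congrArg I.mkQ (smul_mul_assoc c a x))
    (fun a x y => map_add _ _ _) (fun c a x => map_smul _ _ _)
  r := LinearMap.mk₂ k (fun a => I.mapQ I (LinearMap.mulRight k a) (hI.right a))
    (fun a b x => by
      obtain ⟨x, rfl⟩ := I.mkQ_surjective x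
      exact congrArg I.mkQ (mul_add x a b))
    (fun c a x => by
      obtain ⟨x, rfl⟩ := I.mkQ_surjective x
      exact congrArg I.mkQ (mul_smul_comm c x a))
    (fun a x y => map_add _ _ _) (fun c a x => map_smul _ _ _)
  l_mul a b x := by
    obtain ⟨x, rfl⟩ := I.mkQ_surjective x
    exact congrArg I.mkQ (mul_assoc a b x)
  r_mul a b x := by
    obtain ⟨x, rfl⟩ := I.mkQ_surjective x
    exact congrArg I.mkQ (mul_assoc x a b).symm
  comm a b x := by
    obtain ⟨x, rfl⟩ := I.mkQ_surjective x
    exact congrArg I.mkQ (mul_assoc a x b).symm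

@[simp] theorem Bimod.quot_l_mk (I : Submodule k A) (hI : IsTwoSided k I) (a x : A) :
    (Bimod.quot I hI).l a (I.mkQ x) = I.mkQ (a * x) := rfl

@[simp] theorem Bimod.quot_r_mk (I : Submodule k A) (hI : IsTwoSided k I) (a x : A) :
    (Bimod.quot I hI).r a (I.mkQ x) = I.mkQ (x * a) := rfl

variable (k) in
/-- The left ideal `A p`. -/
abbrev leftIdeal (p : A) : Submodule k A := LinearMap.range (LinearMap.mulRight k p)

/-- The subspace `e M` of a bimodule `M`. -/
abbrev Bimod.row (B : Bimod k A M) (e : A) : Submodule k M := LinearMap.range (B.l e)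

variable (k) in
/-- The action of `A` on `A p`. -/
noncomputable def leftIdealAct (p : A) : A →ₗ[k] leftIdeal k p →ₗ[k] leftIdeal k p :=
  LinearMap.mk₂ k
    (fun a x => ⟨a * x.1, by
      obtain ⟨x, y, rfl⟩ := x
      exact ⟨a * y, by simp [mul_assoc]⟩⟩)
    (fun a b x => Subtype.ext (add_mul _ _ _)) (fun c a x => Subtype.ext (smul_mul_assoc _ _ _))
    (fun a x y => Subtype.ext (mul_add _ _ _)) (fun c a x => Subtype.ext (mul_smul_comm _ _ _))

/-- The right action of `A` on `e M`. -/
noncomputable def Bimod.rowAct (B : Bimod k A M) (e : A) : A →ₗ[k] B.row e →ₗ[k] B.row e :=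
  LinearMap.mk₂ k
    (fun a x => ⟨B.r a x.1, by
      obtain ⟨x, y, rfl⟩ := x
      exact ⟨B.r a y, B.comm _ _ _⟩⟩)
    (fun a b x => Subtype.ext (by simp)) (fun c a x => Subtype.ext (by simp))
    (fun a x y => Subtype.ext (by simp)) (fun c a x => Subtype.ext (by simp))

@[simp] theorem coe_leftIdealAct (p a : A) (x : leftIdeal k p) :
    (leftIdealAct k p a x : A) = a * x := rfl

@[simp] theorem Bimod.coe_rowAct (B : Bimod k A M) (e a : A) (x : B.row e) :
    (B.rowAct e a x : M) = B.r a x := rfl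

/-- The bimodule `A p ⊗ e M`. -/
noncomputable def Bimod.outer (B : Bimod k A M) (p e : A) :
    Bimod k A (leftIdeal k p ⊗[k] B.row e) where
  l := LinearMap.rTensorHom _ ∘ₗ leftIdealAct k p
  r := LinearMap.lTensorHom _ ∘ₗ B.rowAct e
  l_mul a b x := by
    have : leftIdealAct k p (a * b) = leftIdealAct k p a ∘ₗ leftIdealAct k p b := by
      ext x
      simp [mul_assoc]
    simp [this, LinearMap.rTensor_comp]
  r_mul a b x := by
    have : B.rowAct e (a * b) = B.rowAct e b ∘ₗ B.rowAct e a := by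
      ext x
      simp [B.r_mul]
    simp [this, LinearMap.lTensor_comp]
  comm a b x := by
    simp only [LinearMap.comp_apply, LinearMap.coe_rTensorHom, LinearMap.coe_lTensorHom]
    rw [← LinearMap.comp_apply, ← LinearMap.comp_apply, LinearMap.rTensor_comp_lTensor,
      LinearMap.lTensor_comp_rTensor]

@[simp] theorem Bimod.outer_l_tmul (B : Bimod k A M) (p e a : A) (x : leftIdeal k p)
    (y : B.row e) : (B.outer p e).l a (x ⊗ₜ y) = leftIdealAct k p a x ⊗ₜ y := rfl

@[simp] theorem Bimod.outer_r_tmul (B : Bimod k A M) (p e a : A) (x : leftIdeal k p)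
    (y : B.row e) : (B.outer p e).r a (x ⊗ₜ y) = x ⊗ₜ B.rowAct e a y := rfl

/-- The splitting of `A p ⊗ e M`. -/
noncomputable def Bimod.outerσ (B : Bimod k A M) (p e : A) :
    leftIdeal k p ⊗[k] B.row e →ₗ[k] (leftIdeal k p ⊗[k] B.row e) ⊗[k] A :=
  TensorProduct.lift (LinearMap.mk₂ k
    (fun x y => ((⟨p, 1, one_mul p⟩ : leftIdeal k p) ⊗ₜ[k] y) ⊗ₜ[k] (x : A))
    (fun x x' y => by simp [TensorProduct.tmul_add]) (fun c x y => by simp)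
    (fun x y y' => by simp [TensorProduct.tmul_add, TensorProduct.add_tmul])
    (fun c x y => by simp [TensorProduct.smul_tmul']))

@[simp] theorem Bimod.outerσ_tmul (B : Bimod k A M) (p e : A) (x : leftIdeal k p)
    (y : B.row e) : B.outerσ p e (x ⊗ₜ y) =
      ((⟨p, 1, one_mul p⟩ : leftIdeal k p) ⊗ₜ[k] y) ⊗ₜ[k] (x : A) := rfl

theorem mul_of_mem_leftIdeal {p : A} (hp : p * p = p) (x : leftIdeal k p) : (x : A) * p = x := by
  obtain ⟨x, y, rfl⟩ := x
  simp [mul_assoc, hp]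

/-- The splitting is `x ⊗ y ↦ (p ⊗ y) ⊗ x`. Acting back gives `x p ⊗ y`, and `x p = x` on `A p` for
idempotent `p`; linearity holds because the left action sees only `x` and the right action only `y`.
-/
theorem Bimod.outer_splitting (B : Bimod k A M) {p : A} (hp : p * p = p) (e : A) :
    (B.outer p e).Splitting (B.outerσ p e) where
  action x := by
    suffices (B.outer p e).lAction ∘ₗ B.outerσ p e = LinearMap.id from LinearMap.congr_fun this x
    refine TensorProduct.ext' fun x y => ?_
    simp only [LinearMap.comp_apply, outerσ_tmul, lAction, TensorProduct.lift.tmul,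
      LinearMap.flip_apply, outer_l_tmul, LinearMap.id_apply]
    congr 1
    exact Subtype.ext (mul_of_mem_leftIdeal hp x)
  l a x := by
    suffices B.outerσ p e ∘ₗ (B.outer p e).l a =
      (LinearMap.mul k A a).lTensor _ ∘ₗ B.outerσ p e from LinearMap.congr_fun this x
    exact TensorProduct.ext' fun x y => by simp
  r a x := by
    suffices B.outerσ p e ∘ₗ (B.outer p e).r a =
      ((B.outer p e).r a).rTensor _ ∘ₗ B.outerσ p e from LinearMap.congr_fun this x
    exact TensorProduct.ext' fun x y => by simp

theorem Bimod.outer_acyclic (B : Bimod k A M) {p : A} (hp : p * p = p) (e : A) (m : ℕ) :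
    Ch.Acyclic (B.outer p e) (m + 1) :=
  Ch.acyclic_of_splitting (B.outer_splitting hp e) m

/-- The right action sends the splitting of `x ⊗ y` to `p ⊗ y x`, and `y x = y x p` lies in `e M p =
0`. -/
theorem Bimod.outer_acyclic_zero (B : Bimod k A M) {p : A} (hp : p * p = p) {e : A}
    (h : ∀ x, B.l e (B.r p x) = 0) : Ch.Acyclic (B.outer p e) 0 := by
  refine Ch.acyclic_zero_of_splitting (B.outer_splitting hp e) fun x => ?_
  suffices (B.outer p e).rAction ∘ₗ B.outerσ p e = 0 from LinearMap.congr_fun this x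
  refine TensorProduct.ext' fun x y => ?_
  have : B.rowAct e x y = 0 := by
    obtain ⟨y, z, rfl⟩ := y
    refine Subtype.ext ?_
    rw [coe_rowAct, ← mul_of_mem_leftIdeal hp x, B.r_mul]
    simp [← B.comm, h]
  simp [rAction, this]

theorem Ch.acyclic_of_bijective {M' : Type u} [AddCommGroup M'] [Module k M'] {B : Bimod k A M}
    {B' : Bimod k A M'} {e : M ≃ₗ[k] M'} (he : B.IsHom B' e.toLinearMap) {m : ℕ}
    (h : Acyclic B' m) : Acyclic B m := fun x hx => by
  obtain ⟨y, hy⟩ := h _ (hx.map he)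
  obtain ⟨y, rfl⟩ := map_surjective e.surjective _ y
  have h1 : ∀ j, map (A := A) e.symm.toLinearMap j ∘ₗ map e.toLinearMap j = LinearMap.id := by
    intro j
    induction j with
    | zero => exact zero_ext fun x => by simp
    | succ j ih =>
      refine hom_ext fun x a => ?_
      have : map (A := A) e.symm.toLinearMap j (map e.toLinearMap j x) = x :=
        LinearMap.congr_fun ih x
      simp only [LinearMap.comp_apply, map_mk, this, LinearMap.id_apply]
  refine ⟨y, ?_⟩
  rw [← map_diff he] at hy
  have := congrArg (map e.symm.toLinearMap m) hy
  rw [← LinearMap.comp_apply (f := map (A := A) e.symm.toLinearMap m),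
    ← LinearMap.comp_apply (f := map (A := A) e.symm.toLinearMap m), h1] at this
  exact this

theorem Ch.acyclic_of_subsingleton [Subsingleton M] (B : Bimod k A M) (m : ℕ) :
    Acyclic B m := by
  have h : (LinearMap.id : Ch k A M m →ₗ[k] _) = 0 := by
    induction m with
    | zero => exact zero_ext fun x => by rw [Subsingleton.elim x 0]; simp
    | succ m ih =>
      refine hom_ext fun x a => ?_
      rw [show x = 0 from LinearMap.congr_fun ih x]
      simp
  exact fun x _ => ⟨0, by rw [map_zero]; exact (LinearMap.congr_fun h x).symm⟩

end

/-! ### Passing from a quotient algebra to a larger one -/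

section

variable {k A : Type u} [Field k] [Ring A] [Algebra k A]

/-- The step in a filtration of an algebra by ideals: if `I' = I + A e A`, where `A e` has a
presentation `0 → A p → A e`, given by the right multiplication with `α`, whose cokernel has a
basis `x`, `e A` has a basis `y` modulo `I`, and the products `x_i y_j` are independent modulo `I`,
then the vanishing of the homology in positive degrees passes from `A / I'` to `A / I`. -/
theorem acyclic_quot_of_heredity {I I' : Submodule k A} (hI : IsTwoSided k I)
    (hI' : IsTwoSided k I') {e p α : A} (he : e * e = e) (hp : p * p = p) (hpα : p * α = α)
    (hαe : α * e = α) (hα : α ∈ I) (hinj : ∀ a, a * α = 0 → a * p = 0)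
    (hep : ∀ a, e * a * p ∈ I) (hle : I ≤ I') (heI' : e ∈ I')
    (hgen : I' ≤ I ⊔ Submodule.span k (Set.range fun ac : A × A => ac.1 * e * ac.2))
    {P Q : Type*} (x : P → A) (y : Q → A)
    (hx : ∀ a, a * e ∈ Submodule.span k (Set.range x) ⊔ LinearMap.range (LinearMap.mulRight k α))
    (hxe : ∀ i, x i * e = x i)
    (hy : ∀ a, e * a ∈ Submodule.span k (Set.range y) ⊔ I)
    (hind : LinearIndependent k fun ij : P × Q => I.mkQ (x ij.1 * y ij.2))
    (h : ∀ m, Ch.Acyclic (Bimod.quot I' hI') (m + 1)) (m : ℕ) :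
    Ch.Acyclic (Bimod.quot I hI) (m + 1) := by
  set B := Bimod.quot I hI with hB
  -- These are the maps of 0 → A p ⊗ e B → A e ⊗ e B → A / I → A / I' → 0: `f` is right
  -- multiplication by `α` on the first factor, and `g` multiplies the two factors. The tensors `Φ a
  -- c`, that is `a e ⊗ e c`, generate the second term.
  let f₀ : leftIdeal k p →ₗ[k] leftIdeal k e :=
    (LinearMap.mulRight k α).restrict (fun a _ => ⟨a * α, by simp [mul_assoc, hαe]⟩)
  let f := f₀.rTensor (B.row e)
  let g : leftIdeal k e ⊗[k] B.row e →ₗ[k] A ⧸ I :=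
    TensorProduct.lift (B.l.compl₁₂ (leftIdeal k e).subtype (B.row e).subtype)
  let q : A ⧸ I →ₗ[k] A ⧸ I' := I.mapQ I' LinearMap.id hle
  have q_mk (a : A) : q (I.mkQ a) = I'.mkQ a := rfl
  let Φ : A →ₗ[k] A →ₗ[k] leftIdeal k e ⊗[k] B.row e :=
    (TensorProduct.mk k _ _).compl₁₂ (LinearMap.mulRight k e).rangeRestrict
      ((B.l e).rangeRestrict ∘ₗ I.mkQ)
  have gΦ (a c : A) : g (Φ a c) = I.mkQ (a * e * c) := by
    have : I.mkQ (a * e * (e * c)) = I.mkQ (a * e * c) := by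
      rw [mul_assoc a, ← mul_assoc e e, he, ← mul_assoc]
    exact this
  have Φ_surj (z : leftIdeal k e) (w : B.row e) : ∃ a c, Φ a c = z ⊗ₜ w := by
    obtain ⟨z, a, rfl⟩ := z
    obtain ⟨w, c, rfl⟩ := w
    obtain ⟨c, rfl⟩ := I.mkQ_surjective c
    exact ⟨a, c, rfl⟩
  have Φ_induction {S : Submodule k (leftIdeal k e ⊗[k] B.row e)} (hS : ∀ a c, Φ a c ∈ S) :
      S = ⊤ := by
    refine eq_top_iff.2 fun w _ => ?_
    induction w with
    | zero => exact S.zero_mem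
    | add w w' hw hw' => exact S.add_mem (hw trivial) (hw' trivial)
    | tmul z w =>
      obtain ⟨a, c, h⟩ := Φ_surj z w
      exact h ▸ hS a c
  have Φα (a c : A) : Φ (a * α) c ∈ LinearMap.range f := by
    refine ⟨(⟨a * p, a, rfl⟩ : leftIdeal k p) ⊗ₜ (B.l e).rangeRestrict (I.mkQ c), ?_⟩
    simp only [f, LinearMap.rTensor_tmul, Φ, LinearMap.compl₁₂_apply, TensorProduct.mk_apply,
      LinearMap.comp_apply]
    congr 1
    refine Subtype.ext ?_
    have : a * p * α = a * α * e := by rw [mul_assoc, hpα, mul_assoc, hαe]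
    exact this
  have Φe (a c : A) : Φ (a * e) (e * c) = Φ a c := by
    have h1 : (LinearMap.mulRight k e).rangeRestrict (a * e) =
        (LinearMap.mulRight k e).rangeRestrict a := Subtype.ext (by simp [mul_assoc, he])
    have h2 : (B.l e).rangeRestrict (I.mkQ (e * c)) = (B.l e).rangeRestrict (I.mkQ c) :=
      
      Subtype.ext (congrArg I.mkQ (by rw [← mul_assoc, he] : e * (e * c) = e * c))
    simp only [Φ, LinearMap.compl₁₂_apply, LinearMap.comp_apply, h1, h2]
  have gf (v) : g (f v) = 0 := by
    suffices g ∘ₗ f = 0 from LinearMap.congr_fun this v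
    refine TensorProduct.ext' fun a w => ?_
    obtain ⟨w, c, rfl⟩ := w
    obtain ⟨c, rfl⟩ := I.mkQ_surjective c
    change I.mkQ (a * α * (e * c)) = 0
    exact (Submodule.Quotient.mk_eq_zero I).2 (hI.right _ _ (hI.left _ _ hα))
  refine Ch.acyclic_of_exact (BX := B.outer p e) (BY := B.outer e e) (BM := B)
    (BM'' := Bimod.quot I' hI') (f := f) (g := g) (q := q) ⟨fun a v => ?_, fun a v => ?_⟩
    ⟨fun a v => ?_, fun a v => ?_⟩ ⟨fun a v => ?_, fun a v => ?_⟩ ?_ ?_ ?_ ?_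
    (fun j => ?_) (fun j => B.outer_acyclic he e j) h m
  · suffices f ∘ₗ (B.outer p e).l a = (B.outer e e).l a ∘ₗ f from LinearMap.congr_fun this v
    refine TensorProduct.ext' fun v w => ?_
    simp only [f, LinearMap.comp_apply, Bimod.outer_l_tmul, LinearMap.rTensor_tmul]
    congr 1
    exact Subtype.ext (mul_assoc _ _ _)
  · suffices f ∘ₗ (B.outer p e).r a = (B.outer e e).r a ∘ₗ f from LinearMap.congr_fun this v
    exact TensorProduct.ext' fun v w => by simp [f]
  · suffices g ∘ₗ (B.outer e e).l a = B.l a ∘ₗ g from LinearMap.congr_fun this v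
    exact TensorProduct.ext' fun v w => by simp [g, B.l_mul]
  · suffices g ∘ₗ (B.outer e e).r a = B.r a ∘ₗ g from LinearMap.congr_fun this v
    exact TensorProduct.ext' fun v w => by simp [g, B.comm]
  · obtain ⟨v, rfl⟩ := I.mkQ_surjective v
    rfl
  · obtain ⟨v, rfl⟩ := I.mkQ_surjective v
    rfl
  · refine Module.Flat.rTensor_preserves_injective_linearMap _ ?_
    refine (injective_iff_map_eq_zero _).2 fun v hv => Subtype.ext ?_
    rw [← mul_of_mem_leftIdeal hp v]
    exact hinj _ (congrArg Subtype.val hv)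
  -- Exactness at `A e ⊗ e B`: modulo the image of `f` the tensors of `x i` with `y j` span, and `g`
  -- sends them to independent vectors, so the kernel of `g` is no larger than the image of `f`.
  · refine fun w => ⟨fun hw => ?_, fun ⟨v, hv⟩ => hv ▸ gf v⟩
    let S := Submodule.span k (Set.range fun ij : P × Q => Φ (x ij.1) (y ij.2)) ⊔
      LinearMap.range f
    have hS : S = ⊤ := by
      have h1 (i : P) (c : A) : Φ (x i) c ∈ S := by
        rw [← Φe, hxe]
        have : Submodule.span k (Set.range y) ⊔ I ≤ S.comap (Φ (x i)) := by
          refine sup_le (Submodule.span_le.2 ?_) fun b hb => ?_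
          · rintro _ ⟨j, rfl⟩
            exact Submodule.mem_sup_left (Submodule.subset_span ⟨(i, j), rfl⟩)
          · have : I.mkQ b = 0 := (Submodule.Quotient.mk_eq_zero I).2 hb
            have : Φ (x i) b = 0 := by
              simp only [Φ, LinearMap.compl₁₂_apply, LinearMap.comp_apply, this, map_zero]
            rw [Submodule.mem_comap, this]
            exact S.zero_mem
        exact this (hy c)
      refine Φ_induction fun a c => ?_
      have : Submodule.span k (Set.range x) ⊔ LinearMap.range (LinearMap.mulRight k α) ≤
          S.comap (Φ.flip (e * c)) := by
        refine sup_le (Submodule.span_le.2 ?_) ?_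
        · rintro _ ⟨i, rfl⟩
          exact h1 i _
        · rintro _ ⟨b, rfl⟩
          exact Submodule.mem_sup_right (Φα b _)
      rw [← Φe]
      exact this (hx a)
    obtain ⟨s, hs, t, ⟨v, rfl⟩, rfl⟩ := Submodule.mem_sup.1 (hS ▸ Submodule.mem_top (x := w))
    obtain ⟨c, rfl⟩ := (Finsupp.mem_span_range_iff_exists_finsupp).1 hs
    rw [map_add, gf, add_zero, map_finsuppSum] at hw
    have hc : c = 0 := by
      refine linearIndependent_iff.1 hind c ?_
      rw [← hw, Finsupp.linearCombination_apply]
      refine Finsupp.sum_congr fun ij _ => ?_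
      rw [map_smul, gΦ, hxe]
    exact ⟨v, by simp [hc]⟩
  -- Exactness at `A / I`: the kernel `I' / I` of `q` is spanned by the classes of the products `a e
  -- c`, which are the `g (Φ a c)`.
  · refine fun w => ⟨fun hw => ?_, ?_⟩
    · obtain ⟨w, rfl⟩ := I.mkQ_surjective w
      rw [q_mk] at hw
      have hw : w ∈ I' := (Submodule.Quotient.mk_eq_zero I').1 hw
      have : I ⊔ Submodule.span k (Set.range fun ac : A × A => ac.1 * e * ac.2) ≤
          (LinearMap.range g).comap I.mkQ := by
        refine sup_le (fun b hb => ?_) (Submodule.span_le.2 ?_)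
        · have : I.mkQ b = 0 := (Submodule.Quotient.mk_eq_zero I).2 hb
          rw [Submodule.mem_comap, this]
          exact Submodule.zero_mem _
        · rintro _ ⟨ac, rfl⟩
          exact ⟨Φ ac.1 ac.2, gΦ _ _⟩
      exact this (hgen hw)
    · rintro ⟨v, rfl⟩
      suffices h : LinearMap.ker (q ∘ₗ g) = ⊤ from
        LinearMap.mem_ker.1 (h.ge (Submodule.mem_top (x := v)))
      refine Φ_induction fun a c => ?_
      rw [LinearMap.mem_ker, LinearMap.comp_apply, gΦ, q_mk]
      exact (Submodule.Quotient.mk_eq_zero I').2 (hI'.right _ _ (hI'.left _ _ heI'))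
  · intro v
    obtain ⟨v, rfl⟩ := I'.mkQ_surjective v
    exact ⟨I.mkQ v, rfl⟩
  -- In positive degrees the splitting suffices; only degree 0 needs `e A p ⊆ I`.
  · cases j with
    | succ j => exact B.outer_acyclic hp e j
    | zero =>
      refine B.outer_acyclic_zero hp fun v => ?_
      obtain ⟨v, rfl⟩ := I.mkQ_surjective v
      simp only [hB, Bimod.quot_r_mk, Bimod.quot_l_mk, ← mul_assoc]
      exact (Submodule.Quotient.mk_eq_zero I).2 (hep v)

end

/-! ### The universal property of the path algebra -/

namespace PathAlgebra

section

variable {k V R : Type*} [Quiver V] [CommRing k] [Fintype V] [Ring R] [Algebra k R]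

/-- A complete system of orthogonal idempotents indexed by the vertices of a quiver and elements
indexed by the arrows which are compatible with it. -/
structure IsRep (e : V → R) (F : ∀ {x y : V}, (x ⟶ y) → R) : Prop where
  idem : ∀ x, e x * e x = e x
  ortho : ∀ x y, x ≠ y → e x * e y = 0
  sum : ∑ x, e x = 1
  source : ∀ {x y : V} (f : x ⟶ y), F f * e x = F f
  target : ∀ {x y : V} (f : x ⟶ y), e y * F f = F f

/-- The product of the elements assigned to the arrows of a path. -/
def evalPath (e : V → R) (F : ∀ {x y : V}, (x ⟶ y) → R) {x : V} :
    ∀ {y : V}, Quiver.Path x y → R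
  | _, .nil => e x
  | _, .cons p f => F f * evalPath e F p

variable {e : V → R} {F : ∀ {x y : V}, (x ⟶ y) → R} (h : IsRep e F)

include h

theorem IsRep.evalPath_source {x y : V} (p : Quiver.Path x y) :
    evalPath e F p * e x = evalPath e F p := by
  induction p with
  | nil => exact h.idem x
  | cons p f ih => simp only [evalPath, mul_assoc, ih]

theorem IsRep.evalPath_target {x y : V} (p : Quiver.Path x y) :
    e y * evalPath e F p = evalPath e F p := by
  cases p with
  | nil => exact h.idem x
  | cons p f => simp only [evalPath, ← mul_assoc, h.target]

theorem IsRep.evalPath_comp {x y z : V} (q : Quiver.Path x y) (p : Quiver.Path y z) :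
    evalPath e F (q.comp p) = evalPath e F p * evalPath e F q := by
  induction p with
  | nil => exact (h.evalPath_target q).symm
  | cons p f ih => simp only [Quiver.Path.comp_cons, evalPath, mul_assoc, ih]

omit h in
variable (k e F) in
/-- The linear extension of `evalPath`. -/
noncomputable def evalLin : PathAlgebra k V →ₗ[k] R :=
  Finsupp.linearCombination k (fun p : Σ x y : V, Quiver.Path x y => evalPath e F p.2.2)

variable (e F) in
omit h [Fintype V] in
theorem evalLin_ofPath {x y : V} (p : Quiver.Path x y) :
    evalLin k e F (ofPath k p) = evalPath e F p :=
  (Finsupp.linearCombination_single k (1 : k) _).trans (one_smul _ _)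

variable [DecidableEq V]

theorem IsRep.evalLin_mul (f g : PathAlgebra k V) :
    evalLin k e F (f * g) = evalLin k e F f * evalLin k e F g := by
  change evalLin k e F (mulLin f g) = _
  induction f using PathAlgebra.induction with
  | h0 => simp
  | hadd f f' hf hf' => simp [hf, hf', add_mul]
  | hsmul c f hf => simp [hf]
  | hpath y z p =>
  induction g using PathAlgebra.induction with
  | h0 => simp
  | hadd f f' hf hf' => simp [hf, hf', mul_add]
  | hsmul c f hf => simp [hf]
  | hpath x y' q =>
  by_cases hy : y' = y
  · subst hy
    rw [mulLin_ofPath_comp]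
    simp only [evalLin_ofPath, h.evalPath_comp]
  · rw [mulLin_ofPath_ne _ _ hy, map_zero, evalLin_ofPath, evalLin_ofPath,
      ← h.evalPath_source p, ← h.evalPath_target q, mul_assoc, ← mul_assoc (e y),
      h.ortho _ _ (Ne.symm hy), zero_mul, mul_zero]

variable (k) in
/-- The algebra homomorphism on the path algebra defined by its values on vertices and arrows. -/
noncomputable def IsRep.hom : PathAlgebra k V →ₐ[k] R :=
  AlgHom.ofLinearMap (evalLin k e F)
    (by
      change evalLin k e F (∑ x : V, ofPath k (Quiver.Path.nil : Quiver.Path x x)) = 1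
      rw [map_sum, ← h.sum]
      exact Finset.sum_congr rfl fun x _ => evalLin_ofPath e F _)
    h.evalLin_mul

theorem IsRep.hom_nil (x : V) : h.hom k (ofPath k (Quiver.Path.nil : Quiver.Path x x)) = e x :=
  evalLin_ofPath e F _

theorem IsRep.hom_arrow {x y : V} (f : x ⟶ y) : h.hom k (ofPath k f.toPath) = F f := by
  refine (evalLin_ofPath e F _).trans ?_
  simp only [Quiver.Hom.toPath, evalPath, h.source]

end

end PathAlgebra

/-! ### Generators and relations of the Auslander algebra -/

section Vertex

variable {n : ℕ}

/-- The first coordinate of a vertex. -/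
def Vertex.left (x : Vertex n) : ZMod n := Prod.fst x

/-- The second coordinate of a vertex. -/
def Vertex.right (x : Vertex n) : ZMod n := Prod.snd x

theorem Vertex.ext {x y : Vertex n} (h : x.left = y.left) (h' : x.right = y.right) : x = y :=
  Prod.ext h h'

/-- The vertex `(i, u)`. -/
def Vertex.mk (i u : ZMod n) : Vertex n := (i, u)

@[simp] theorem Vertex.left_mk (i u : ZMod n) : (Vertex.mk i u).left = i := rfl

@[simp] theorem Vertex.right_mk (i u : ZMod n) : (Vertex.mk i u).right = u := rfl

@[elab_as_elim]
theorem arrow_cases {motive : ∀ x y : Vertex n, (x ⟶ y) → Prop}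
    (a : ∀ i u h, motive (.mk i u) (.mk (i - 1) u) (Arrow.a i u h))
    (b : ∀ i u h, motive (.mk i u) (.mk i (u - 1)) (Arrow.b i u h)) {x y : Vertex n} (f : x ⟶ y) :
    motive x y f :=
  Arrow.rec (motive := motive) a b f

end Vertex

section Generators

variable (k : Type*) [CommRing k] (n : ℕ) [NeZero n]

/-- The projection of the path algebra onto the Auslander algebra. -/
noncomputable def proj : PathAlgebra k (Vertex n) →ₐ[k] AuslanderTaft k n := (meshCon k n).mkₐ k

theorem proj_surjective : Function.Surjective (proj k n) := (meshCon k n).mkₐ_surjective (α := k)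

/-- The idempotent at the vertex `(i, u)`. -/
noncomputable def vert (i u : ZMod n) : AuslanderTaft k n := vertexIdem k n (i, u)

/-- The class of the arrow `a_{i,u}`. -/
noncomputable def arrA (i u : ZMod n) : AuslanderTaft k n := proj k n (arrowA k n i u)

/-- The class of the arrow `b_{i,u}`. -/
noncomputable def arrB (i u : ZMod n) : AuslanderTaft k n := proj k n (arrowB k n i u)

theorem vert_eq (i u : ZMod n) : vert k n i u =
    proj k n (PathAlgebra.ofPath k (Quiver.Path.nil : Quiver.Path (V := Vertex n) (i, u) (i, u))) :=
  rfl

variable {n}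

theorem proj_eq_zero {r : PathAlgebra k (Vertex n)} (hr : r ∈ meshRelations k n) :
    proj k n r = 0 := by
  have : meshCon k n r 0 := TwoSidedIdeal.subset_span hr
  rw [← map_zero (proj k n)]
  exact Quotient.sound this

theorem vert_mul_self (i u : ZMod n) : vert k n i u * vert k n i u = vert k n i u := by
  rw [vert_eq, ← map_mul]
  congr 1
  exact PathAlgebra.mulLin_ofPath_comp _ _

theorem vert_mul_of_ne {i u j v : ZMod n} (h : (i, u) ≠ (j, v)) :
    vert k n i u * vert k n j v = 0 := by
  rw [vert_eq, vert_eq, ← map_mul, ← map_zero (proj k n)]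
  congr 1
  exact PathAlgebra.mulLin_ofPath_ne _ _ h.symm

theorem sum_vert : ∑ x : Vertex n, vertexIdem k n x = 1 := by
  rw [← map_one (proj k n)]
  change _ = proj k n (∑ x : Vertex n, _)
  rw [map_sum]
  rfl

theorem arrA_eq_zero {i u : ZMod n} (h : u = i - 1) : arrA k n i u = 0 := by
  simp [arrA, arrowA, h]

theorem arrB_eq_zero {i u : ZMod n} (h : u = i) : arrB k n i u = 0 := by
  simp [arrB, arrowB, h]

theorem arrA_mul_vert (i u : ZMod n) : arrA k n i u * vert k n i u = arrA k n i u := by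
  rw [arrA, vert_eq, ← map_mul, arrowA]
  congr 1
  split_ifs
  · exact PathAlgebra.mulLin_ofPath_comp _ _
  · exact zero_mul _

theorem vert_mul_arrA (i u : ZMod n) : vert k n (i - 1) u * arrA k n i u = arrA k n i u := by
  rw [arrA, vert_eq, ← map_mul, arrowA]
  congr 1
  split_ifs
  · exact PathAlgebra.mulLin_ofPath_comp _ _
  · exact mul_zero _

theorem arrB_mul_vert (i u : ZMod n) : arrB k n i u * vert k n i u = arrB k n i u := by
  rw [arrB, vert_eq, ← map_mul, arrowB]
  congr 1
  split_ifs
  · exact PathAlgebra.mulLin_ofPath_comp _ _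
  · exact zero_mul _

theorem vert_mul_arrB (i u : ZMod n) : vert k n i (u - 1) * arrB k n i u = arrB k n i u := by
  rw [arrB, vert_eq, ← map_mul, arrowB]
  congr 1
  split_ifs
  · exact PathAlgebra.mulLin_ofPath_comp _ _
  · exact mul_zero _

/-- This unites both kinds of mesh relations: for `u = i - 1` the arrow on the right does not exist
and is read as `0`, which leaves the boundary relation. -/
theorem arrA_mul_arrB {i u : ZMod n} (h : u ≠ i) :
    arrA k n i (u - 1) * arrB k n i u = -(arrB k n (i - 1) u * arrA k n i u) := by
  by_cases h' : u = i - 1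
  · rw [arrA_eq_zero k h', mul_zero, neg_zero, arrA, arrB, ← map_mul]
    refine proj_eq_zero k (Or.inl ⟨i, ?_⟩)
    subst h'
    rw [sub_sub, one_add_one_eq_two]
  · rw [eq_neg_iff_add_eq_zero]
    simp only [arrA, arrB, ← map_mul, ← map_add]
    exact proj_eq_zero k (Or.inr ⟨i, u, h, h', rfl⟩)

variable {k} in
theorem generators_induction {P : AuslanderTaft k n → Prop}
    (add : ∀ x y, P x → P y → P (x + y)) (smul : ∀ (c : k) x, P x → P (c • x))
    (mul : ∀ x y, P x → P y → P (x * y)) (vert : ∀ i u, P (vert k n i u))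
    (a : ∀ i u, P (arrA k n i u)) (b : ∀ i u, P (arrB k n i u)) (x : AuslanderTaft k n) : P x := by
  obtain ⟨x, rfl⟩ := proj_surjective k n x
  induction x using PathAlgebra.induction with
  | h0 => simpa using smul 0 _ (vert 0 0)
  | hadd f g hf hg =>
    rw [map_add]
    exact add _ _ hf hg
  | hsmul c f hf =>
    rw [map_smul]
    exact smul _ _ hf
  | hpath x y p =>
    induction p with
    | nil => exact vert x.1 x.2
    | cons p f ih =>
      have : PathAlgebra.ofPath k (p.cons f) =
          PathAlgebra.ofPath k f.toPath * PathAlgebra.ofPath k p :=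
        (PathAlgebra.mulLin_ofPath_comp (k := k) (Quiver.Hom.toPath f) p).symm
      rw [this, map_mul]
      refine mul _ _ ?_ ih
      cases f using arrow_cases with
      | a i u h =>
        have := a i u
        rw [arrA, arrowA, dif_pos h] at this
        exact this
      | b i u h =>
        have := b i u
        rw [arrB, arrowB, dif_pos h] at this
        exact this

/-- A family of elements satisfying the relations of the Auslander algebra defines an algebra
homomorphism. -/
noncomputable def liftHom {R : Type*} [Ring R] [Algebra k R] (f : PathAlgebra k (Vertex n) →ₐ[k] R)
    (hf : ∀ r ∈ meshRelations k n, f r = 0) : AuslanderTaft k n →ₐ[k] R :=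
  (meshCon k n).liftₐ f (by
    have h : TwoSidedIdeal.span (meshRelations k n) ≤ TwoSidedIdeal.ker f :=
      TwoSidedIdeal.span_le.2 fun r hr => (TwoSidedIdeal.mem_ker f).2 (hf r hr)
    exact TwoSidedIdeal.ringCon_le_iff.1 h)

end Generators

/-! ### Normal forms -/

section NormalForm

variable {n : ℕ} [NeZero n]

/-- The level of a vertex, which is its distance from the boundary circle of the vertices
`(i, i - 1)`. -/
def level (j u : ZMod n) : ℕ := (j - u - 1).val

theorem level_lt (j u : ZMod n) : level j u < n := ZMod.val_lt _

theorem cast_level (j u : ZMod n) : (level j u : ZMod n) = j - u - 1 := ZMod.natCast_zmod_val _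

omit [NeZero n] in
theorem level_eq {j u : ZMod n} {m : ℕ} (hm : m < n) (h : (m : ZMod n) = j - u - 1) :
    level j u = m := by
  rw [level, ← h, ZMod.val_cast_of_lt hm]

omit [NeZero n] in
theorem level_eq_zero_iff {j u : ZMod n} : level j u = 0 ↔ u = j - 1 := by
  rw [level, ZMod.val_eq_zero, sub_right_comm, sub_eq_zero, eq_comm]

/-- After `t` climbing steps the path has reached the top level `n - 1`, the circle of the vertices
`(j, j)`, where no arrow `b` starts. -/
theorem eq_of_level_add {j u : ZMod n} {t : ℕ} (h : level j u + t + 1 = n) : u - t = j := by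
  have := congrArg (Nat.cast : ℕ → ZMod n) h
  push_cast at this
  rw [cast_level, ZMod.natCast_self] at this
  linear_combination -this

omit [NeZero n] in
theorem natCast_eq_zero_of_lt {t : ℕ} (ht : t < n) (h : (t : ZMod n) = 0) : t = 0 := by
  rw [← ZMod.val_cast_of_lt ht, h, ZMod.val_zero]

theorem level_shift {j u j' u' : ZMod n} {t : ℕ} (h : level j u + t < n)
    (e : j' - u' = j - u + t) : level j' u' = level j u + t := by
  refine level_eq h ?_
  push_cast
  rw [cast_level, e]
  ring

theorem level_pred {j u j' u' : ZMod n} (h : level j u ≠ 0) (e : j' - u' + 1 = j - u) :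
    level j' u' + 1 = level j u := by
  obtain ⟨m, hm⟩ := Nat.exists_eq_succ_of_ne_zero h
  rw [hm, level_eq (m := m)]
  · have := level_lt j u
    omega
  · have := cast_level j u
    rw [hm] at this
    push_cast at this
    linear_combination this - e

variable (k : Type*) [CommRing k]

/-- The path `b^t` starting at `(j, u)`. -/
noncomputable def bPath (j u : ZMod n) : ℕ → AuslanderTaft k n
  | 0 => vert k n j u
  | t + 1 => arrB k n j (u - t) * bPath j u t

/-- The path `a^s` ending at `(j, u)`. -/
noncomputable def aPath (j u : ZMod n) : ℕ → AuslanderTaft k n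
  | 0 => vert k n j u
  | s + 1 => aPath j u s * arrA k n (j + s + 1) u

/-- The path `b^t a^s` passing through `(j, u)`. -/
noncomputable def monomial (j u : ZMod n) (s t : ℕ) : AuslanderTaft k n :=
  bPath k j u t * aPath k j u s

theorem vert_mul_bPath (j u : ZMod n) (t : ℕ) :
    vert k n j (u - t) * bPath k j u t = bPath k j u t := by
  cases t with
  | zero => simp [bPath, vert_mul_self]
  | succ t =>
    rw [bPath, ← mul_assoc]
    congr 1
    rw [← vert_mul_arrB k j (u - t), ← mul_assoc, Nat.cast_add, Nat.cast_one, ← sub_sub,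
      vert_mul_self]

theorem bPath_mul_vert (j u : ZMod n) (t : ℕ) :
    bPath k j u t * vert k n j u = bPath k j u t := by
  induction t with
  | zero => simp [bPath, vert_mul_self]
  | succ t ih => rw [bPath, mul_assoc, ih]

theorem vert_mul_aPath (j u : ZMod n) (s : ℕ) :
    vert k n j u * aPath k j u s = aPath k j u s := by
  induction s with
  | zero => simp [aPath, vert_mul_self]
  | succ s ih => rw [aPath, ← mul_assoc, ih]

theorem aPath_mul_vert (j u : ZMod n) (s : ℕ) :
    aPath k j u s * vert k n (j + s) u = aPath k j u s := by
  cases s with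
  | zero => simp [aPath, vert_mul_self]
  | succ s =>
    rw [aPath, mul_assoc]
    congr 1
    rw [Nat.cast_add, Nat.cast_one, ← add_assoc, arrA_mul_vert]

/-- Each `b` climbs one level, so a path this long would have to leave the top circle. -/
theorem bPath_eq_zero {j u : ZMod n} {t : ℕ} (h : n ≤ level j u + t) : bPath k j u t = 0 := by
  induction t with
  | zero => exact absurd (level_lt j u) (by omega)
  | succ t ih =>
    rw [bPath]
    by_cases h' : n ≤ level j u + t
    · rw [ih h', mul_zero]
    · rw [arrB_eq_zero k (eq_of_level_add (by omega)), zero_mul]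

/-- Followed backwards from `(j, u)`, each `a` climbs one level, and no `a` comes from above the top
circle. -/
theorem aPath_eq_zero {j u : ZMod n} {s : ℕ} (h : n ≤ level j u + s) : aPath k j u s = 0 := by
  induction s with
  | zero => exact absurd (level_lt j u) (by omega)
  | succ s ih =>
    rw [aPath]
    by_cases h' : n ≤ level j u + s
    · rw [ih h', zero_mul]
    · have := eq_of_level_add (j := j) (u := u) (t := s) (by omega)
      rw [arrA_eq_zero k (by linear_combination this), mul_zero]

theorem monomial_eq_zero {j u : ZMod n} {s t : ℕ} (h : ¬(level j u + s < n ∧ level j u + t < n)) :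
    monomial k j u s t = 0 := by
  rw [monomial]
  by_cases h' : level j u + t < n
  · rw [aPath_eq_zero k (by omega), mul_zero]
  · rw [bPath_eq_zero k (by omega), zero_mul]

theorem vert_mul_monomial (j u : ZMod n) (s t : ℕ) :
    vert k n j (u - t) * monomial k j u s t = monomial k j u s t := by
  rw [monomial, ← mul_assoc, vert_mul_bPath]

theorem monomial_mul_vert (j u : ZMod n) (s t : ℕ) :
    monomial k j u s t * vert k n (j + s) u = monomial k j u s t := by
  rw [monomial, mul_assoc, aPath_mul_vert]

theorem vert_mul_monomial_of_ne {i v j u : ZMod n} {s t : ℕ} (h : (i, v) ≠ (j, u - t)) :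
    vert k n i v * monomial k j u s t = 0 := by
  rw [← vert_mul_monomial, ← mul_assoc, vert_mul_of_ne k h, zero_mul]

theorem monomial_mul_vert_of_ne {i v j u : ZMod n} {s t : ℕ} (h : (i, v) ≠ (j + s, u)) :
    monomial k j u s t * vert k n i v = 0 := by
  rw [← monomial_mul_vert, mul_assoc, vert_mul_of_ne k h.symm, mul_zero]

theorem monomial_zero_zero (j u : ZMod n) : monomial k j u 0 0 = vert k n j u :=
  vert_mul_self k j u

theorem aPath_succ' (j u : ZMod n) (s : ℕ) :
    aPath k j u (s + 1) = arrA k n (j + 1) u * aPath k (j + 1) u s := by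
  induction s with
  | zero =>
    have := vert_mul_arrA k (j + 1) u
    rw [add_sub_cancel_right] at this
    simp [aPath, arrA_mul_vert, this]
  | succ s ih =>
    rw [aPath, ih, aPath, mul_assoc]
    congr 3
    push_cast
    ring

theorem bPath_succ' (j u : ZMod n) (t : ℕ) :
    bPath k j u (t + 1) = bPath k j (u - 1) t * arrB k n j u := by
  induction t with
  | zero => simp [bPath, arrB_mul_vert, vert_mul_arrB]
  | succ t ih =>
    rw [bPath, ih, bPath, mul_assoc]
    congr 2
    push_cast
    ring

/-- The arrow `a` moves past the arrows `b` one at a time, each mesh relation costing a sign. -/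
theorem arrA_mul_bPath {j u : ZMod n} {t : ℕ} (h : level j u + t < n) :
    arrA k n j (u - t) * bPath k j u t = (-1 : k) ^ t • (bPath k (j - 1) u t * arrA k n j u) := by
  induction t with
  | zero => simp [bPath, arrA_mul_vert, vert_mul_arrA]
  | succ t ih =>
    -- By the bound, `(j, u - t)` is still below the top circle, so that the mesh relation applies
    -- there.
    have hne : u - t ≠ j := fun e => by
      have h1 : ((level j u + t + 1 : ℕ) : ZMod n) = 0 := by
        push_cast
        rw [cast_level]
        linear_combination -e
      exact absurd (natCast_eq_zero_of_lt h h1) (by omega)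
    have := arrA_mul_arrB k hne
    rw [bPath, ← mul_assoc, Nat.cast_add, Nat.cast_one, ← sub_sub, this, neg_mul, mul_assoc,
      ih (by omega), mul_smul_comm, ← mul_assoc, pow_succ, mul_neg_one, neg_smul, bPath]

theorem aPath_mul_arrB {j u : ZMod n} {s : ℕ} (h : level j u + s < n) :
    aPath k j u s * arrB k n (j + s) (u + 1) =
      (-1 : k) ^ s • (arrB k n j (u + 1) * aPath k j (u + 1) s) := by
  induction s with
  | zero =>
    have := vert_mul_arrB k j (u + 1)
    rw [add_sub_cancel_right] at this
    simp [aPath, arrB_mul_vert, this]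
  | succ s ih =>
    have hne : u + 1 ≠ j + s + 1 := fun e => by
      have h1 : ((level j u + s + 1 : ℕ) : ZMod n) = 0 := by
        push_cast
        rw [cast_level]
        linear_combination -e
      exact absurd (natCast_eq_zero_of_lt h h1) (by omega)
    have := arrA_mul_arrB k hne
    rw [add_sub_cancel_right, add_sub_cancel_right] at this
    rw [aPath, mul_assoc, Nat.cast_add, Nat.cast_one, ← add_assoc, this, mul_neg, ← mul_assoc,
      ih (by omega), smul_mul_assoc, mul_assoc, pow_succ, mul_neg_one, neg_smul, aPath]

theorem arrB_mul_monomial (j u : ZMod n) (s t : ℕ) :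
    arrB k n j (u - t) * monomial k j u s t = monomial k j u s (t + 1) := by
  rw [monomial, monomial, bPath, mul_assoc]

theorem monomial_mul_arrA (j u : ZMod n) (s t : ℕ) :
    monomial k j u s t * arrA k n (j + s + 1) u = monomial k j u (s + 1) t := by
  rw [monomial, monomial, aPath, mul_assoc]

theorem arrA_mul_monomial {j u : ZMod n} {s t : ℕ} (h : level j u + t < n) :
    arrA k n j (u - t) * monomial k j u s t = (-1 : k) ^ t • monomial k (j - 1) u (s + 1) t := by
  rw [monomial, monomial, ← mul_assoc, arrA_mul_bPath k h, aPath_succ', smul_mul_assoc, mul_assoc,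
    sub_add_cancel]

theorem monomial_mul_arrB {j u : ZMod n} {s t : ℕ} (h : level j u + s < n) :
    monomial k j u s t * arrB k n (j + s) (u + 1) =
      (-1 : k) ^ s • monomial k j (u + 1) s (t + 1) := by
  rw [monomial, monomial, mul_assoc, aPath_mul_arrB k h, bPath_succ', mul_smul_comm,
    add_sub_cancel_right, mul_assoc]

/-- There is no level below 0: modulo `n`, the vertex `(j - 1, u)` wraps around to the top circle,
and no arrow `a` joins `(j, u)` to it. -/
theorem monomial_pred_eq_zero {j u : ZMod n} (h : level j u = 0) (s t : ℕ) :
    monomial k (j - 1) u (s + 1) t = 0 := by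
  rw [monomial, aPath_succ', sub_add_cancel, arrA_eq_zero k (level_eq_zero_iff.1 h), zero_mul,
    mul_zero]

theorem monomial_succ_eq_zero {j u : ZMod n} (h : level j u = 0) (s t : ℕ) :
    monomial k j (u + 1) s (t + 1) = 0 := by
  rw [monomial, bPath_succ', arrB_eq_zero k (by linear_combination level_eq_zero_iff.1 h),
    mul_zero, zero_mul]

/-- The span of the monomials passing through a vertex in `F`. -/
noncomputable def levelIdeal (F : Set (ZMod n × ZMod n)) : Submodule k (AuslanderTaft k n) :=
  Submodule.span k {x | ∃ j u s t, (j, u) ∈ F ∧ x = monomial k j u s t}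

theorem monomial_mem_levelIdeal {F : Set (ZMod n × ZMod n)} {j u : ZMod n} (h : (j, u) ∈ F)
    (s t : ℕ) : monomial k j u s t ∈ levelIdeal k F :=
  Submodule.subset_span ⟨j, u, s, t, h, rfl⟩

/-- Multiplication by an arrow either lengthens one leg of the monomial, keeping its turning vertex,
or after straightening by the mesh relations moves the turning vertex one level down. Neither leaves
`F`. -/
theorem levelIdeal_isTwoSided {F : Set (ZMod n × ZMod n)}
    (hF : ∀ j u j' u', (j, u) ∈ F → level j' u' < level j u → (j', u') ∈ F) :
    IsTwoSided k (levelIdeal k F) where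
  left a := by
    induction a using generators_induction with
    | add a b ha hb => exact fun x hx => add_mul a b x ▸ Submodule.add_mem _ (ha x hx) (hb x hx)
    | smul c a ha => exact fun x hx => smul_mul_assoc c a x ▸ Submodule.smul_mem _ c (ha x hx)
    | mul a b ha hb => exact fun x hx => mul_assoc a b x ▸ ha _ (hb x hx)
    | vert i v =>
      suffices levelIdeal k F ≤ (levelIdeal k F).comap (LinearMap.mulLeft k (vert k n i v)) from
        this
      refine Submodule.span_le.2 ?_
      rintro _ ⟨j, u, s, t, h, rfl⟩
      simp only [Submodule.comap_coe, Set.mem_preimage, LinearMap.mulLeft_apply, SetLike.mem_coe]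
      by_cases e : (i, v) = (j, u - t)
      · obtain ⟨rfl, rfl⟩ := Prod.mk.inj e
        rw [vert_mul_monomial]
        exact monomial_mem_levelIdeal k h s t
      · rw [vert_mul_monomial_of_ne k e]
        exact Submodule.zero_mem _
    | a i v =>
      suffices levelIdeal k F ≤ (levelIdeal k F).comap (LinearMap.mulLeft k (arrA k n i v)) from
        this
      refine Submodule.span_le.2 ?_
      rintro _ ⟨j, u, s, t, h, rfl⟩
      simp only [Submodule.comap_coe, Set.mem_preimage, LinearMap.mulLeft_apply, SetLike.mem_coe]
      by_cases ht : level j u + t < n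
      · by_cases e : (i, v) = (j, u - t)
        · obtain ⟨rfl, rfl⟩ := Prod.mk.inj e
          rw [arrA_mul_monomial k ht]
          refine Submodule.smul_mem _ _ ?_
          -- From level 0 the turning vertex cannot move down; the product is zero there.
          by_cases hl : level i u = 0
          · rw [monomial_pred_eq_zero k hl]
            exact Submodule.zero_mem _
          · have := level_pred hl (j' := i - 1) (u' := u) (by ring)
            exact monomial_mem_levelIdeal k (hF _ _ _ _ h (by omega)) _ _
        · rw [← arrA_mul_vert, mul_assoc, vert_mul_monomial_of_ne k e, mul_zero]
          exact Submodule.zero_mem _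
      · rw [monomial_eq_zero k (by tauto), mul_zero]
        exact Submodule.zero_mem _
    | b i v =>
      suffices levelIdeal k F ≤ (levelIdeal k F).comap (LinearMap.mulLeft k (arrB k n i v)) from
        this
      refine Submodule.span_le.2 ?_
      rintro _ ⟨j, u, s, t, h, rfl⟩
      simp only [Submodule.comap_coe, Set.mem_preimage, LinearMap.mulLeft_apply, SetLike.mem_coe]
      by_cases e : (i, v) = (j, u - t)
      · obtain ⟨rfl, rfl⟩ := Prod.mk.inj e
        rw [arrB_mul_monomial]
        exact monomial_mem_levelIdeal k h _ _
      · rw [← arrB_mul_vert, mul_assoc, vert_mul_monomial_of_ne k e, mul_zero]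
        exact Submodule.zero_mem _
  right a := by
    induction a using generators_induction with
    | add a b ha hb => exact fun x hx => mul_add x a b ▸ Submodule.add_mem _ (ha x hx) (hb x hx)
    | smul c a ha => exact fun x hx => mul_smul_comm c x a ▸ Submodule.smul_mem _ c (ha x hx)
    | mul a b ha hb => exact fun x hx => mul_assoc x a b ▸ hb _ (ha x hx)
    | vert i v =>
      suffices levelIdeal k F ≤ (levelIdeal k F).comap (LinearMap.mulRight k (vert k n i v)) from
        this
      refine Submodule.span_le.2 ?_
      rintro _ ⟨j, u, s, t, h, rfl⟩
      simp only [Submodule.comap_coe, Set.mem_preimage, LinearMap.mulRight_apply, SetLike.mem_coe]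
      by_cases e : (i, v) = (j + s, u)
      · obtain ⟨rfl, rfl⟩ := Prod.mk.inj e
        rw [monomial_mul_vert]
        exact monomial_mem_levelIdeal k h s t
      · rw [monomial_mul_vert_of_ne k e]
        exact Submodule.zero_mem _
    | a i v =>
      suffices levelIdeal k F ≤ (levelIdeal k F).comap (LinearMap.mulRight k (arrA k n i v)) from
        this
      refine Submodule.span_le.2 ?_
      rintro _ ⟨j, u, s, t, h, rfl⟩
      simp only [Submodule.comap_coe, Set.mem_preimage, LinearMap.mulRight_apply, SetLike.mem_coe]
      by_cases e : (i - 1, v) = (j + s, u)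
      · obtain ⟨e1, rfl⟩ := Prod.mk.inj e
        obtain rfl : i = j + s + 1 := by linear_combination e1
        rw [monomial_mul_arrA]
        exact monomial_mem_levelIdeal k h _ _
      · rw [← vert_mul_arrA, ← mul_assoc, monomial_mul_vert_of_ne k e, zero_mul]
        exact Submodule.zero_mem _
    | b i v =>
      suffices levelIdeal k F ≤ (levelIdeal k F).comap (LinearMap.mulRight k (arrB k n i v)) from
        this
      refine Submodule.span_le.2 ?_
      rintro _ ⟨j, u, s, t, h, rfl⟩
      simp only [Submodule.comap_coe, Set.mem_preimage, LinearMap.mulRight_apply, SetLike.mem_coe]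
      by_cases hs : level j u + s < n
      · by_cases e : (i, v - 1) = (j + s, u)
        · obtain ⟨rfl, e2⟩ := Prod.mk.inj e
          obtain rfl : v = u + 1 := by linear_combination e2
          rw [monomial_mul_arrB k hs]
          refine Submodule.smul_mem _ _ ?_
          by_cases hl : level j u = 0
          · rw [monomial_succ_eq_zero k hl]
            exact Submodule.zero_mem _
          · have := level_pred hl (j' := j) (u' := u + 1) (by ring)
            exact monomial_mem_levelIdeal k (hF _ _ _ _ h (by omega)) _ _
        · rw [← vert_mul_arrB, ← mul_assoc, monomial_mul_vert_of_ne k e, zero_mul]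
          exact Submodule.zero_mem _
      · rw [monomial_eq_zero k (by tauto), zero_mul]
        exact Submodule.zero_mem _

/-- The span is an ideal that contains every vertex, hence their sum 1. -/
theorem levelIdeal_univ : levelIdeal k (Set.univ : Set (ZMod n × ZMod n)) = ⊤ := by
  have h := levelIdeal_isTwoSided k (F := (Set.univ : Set (ZMod n × ZMod n)))
    (fun _ _ _ _ _ _ => trivial)
  refine eq_top_iff.2 fun a _ => ?_
  rw [← mul_one a, ← sum_vert]
  refine h.left _ _ (Submodule.sum_mem _ fun x _ => ?_)
  have : monomial k x.1 x.2 0 0 ∈ levelIdeal k (Set.univ : Set (ZMod n × ZMod n)) :=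
    monomial_mem_levelIdeal k (Set.mem_univ _) 0 0
  rwa [monomial_zero_zero] at this

variable {k} in
theorem monomial_induction {P : AuslanderTaft k n → Prop} (zero : P 0)
    (add : ∀ x y, P x → P y → P (x + y)) (smul : ∀ (c : k) x, P x → P (c • x))
    (monomial : ∀ j u s t, level j u + s < n → level j u + t < n → P (monomial k j u s t))
    (x : AuslanderTaft k n) : P x := by
  have hx : x ∈ levelIdeal k (Set.univ : Set (ZMod n × ZMod n)) :=
    (levelIdeal_univ k).ge Submodule.mem_top
  induction hx using Submodule.span_induction with
  | mem x hx =>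
    obtain ⟨j, u, s, t, -, rfl⟩ := hx
    by_cases h : level j u + s < n ∧ level j u + t < n
    · exact monomial j u s t h.1 h.2
    · rwa [monomial_eq_zero k h]
  | zero => exact zero
  | add x y _ _ hx hy => exact add x y hx hy
  | smul c x _ hx => exact smul c x hx

end NormalForm

/-! ### Linear independence of the normal forms -/

section Regular

variable {n : ℕ} (k : Type*) [CommRing k]

/-- The indices `(j, u, s, t)` of the normal forms `b^t a^s` passing through `(j, u)`. -/
abbrev Index (n : ℕ) : Type := ZMod n × ZMod n × ℕ × ℕ

/-- The operator on the regular representation defined by its values on paths. -/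
noncomputable def pathOp (f : ZMod n → ZMod n → ℕ → ℕ → Index n →₀ k) :
    Module.End k (Index n →₀ k) :=
  Finsupp.linearCombination k fun τ => f τ.1 τ.2.1 τ.2.2.1 τ.2.2.2

variable {k} in
@[simp] theorem pathOp_single (f : ZMod n → ZMod n → ℕ → ℕ → Index n →₀ k) (j u : ZMod n)
    (s t : ℕ) (c : k) : pathOp k f (Finsupp.single (j, u, s, t) c) = c • f j u s t := by
  simp [pathOp]

/-- The action of the vertex `(i, v)` on the regular representation. -/
noncomputable def regVert (i v : ZMod n) : Module.End k (Index n →₀ k) :=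
  pathOp k fun j u s t => if j = i ∧ u - t = v then Finsupp.single (j, u, s, t) 1 else 0

/-- The action of `a_{i,v}` on the regular representation. -/
noncomputable def regA (i v : ZMod n) : Module.End k (Index n →₀ k) :=
  pathOp k fun j u s t => if (j = i ∧ u - t = v) ∧ level j u ≠ 0 then
    (-1 : k) ^ t • Finsupp.single (j - 1, u, s + 1, t) 1 else 0

/-- The action of `b_{i,v}` on the regular representation. -/
noncomputable def regB (i v : ZMod n) : Module.End k (Index n →₀ k) :=
  pathOp k fun j u s t => if (j = i ∧ u - t = v) ∧ level j u + t + 1 < n then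
    Finsupp.single (j, u, s, t + 1) 1 else 0

/-- The action of the arrows on the regular representation. -/
noncomputable def regArrow : ∀ {x y : Vertex n}, (x ⟶ y) → Module.End k (Index n →₀ k)
  | _, _, .a i u _ => regA k i u
  | _, _, .b i u _ => regB k i u

variable {k} in
theorem end_ext {f g : Module.End k (Index n →₀ k)}
    (h : ∀ j u s t, f (Finsupp.single (j, u, s, t) 1) = g (Finsupp.single (j, u, s, t) 1)) :
    f = g :=
  Finsupp.lhom_ext' fun τ => LinearMap.ext_ring (h τ.1 τ.2.1 τ.2.2.1 τ.2.2.2)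

variable [NeZero n]

/-- The operators imitate left multiplication on the monomials. All exponents are allowed as
indices; the superfluous ones are harmless, since the coordinates of an element only read its action
on the trivial paths. -/
theorem reg_isRep :
    PathAlgebra.IsRep (fun x : Vertex n => regVert k x.left x.right) (regArrow k) where
  idem x := by
    refine end_ext fun j u s t => ?_
    by_cases h : j = x.left ∧ u - t = x.right <;> simp [regVert, h]
  ortho x y hxy := by
    refine end_ext fun j u s t => ?_
    by_cases h : j = y.left ∧ u - t = y.right
    · have h' : ¬(j = x.left ∧ u - t = x.right) := fun e =>
        hxy (Vertex.ext (e.1.symm.trans h.1) (e.2.symm.trans h.2))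
      simp only [regVert, Module.End.mul_apply, pathOp_single, one_smul, if_pos h, if_neg h',
        LinearMap.zero_apply]
    · simp [regVert, h]
  sum := by
    refine end_ext fun j u s t => ?_
    rw [LinearMap.sum_apply, Finset.sum_eq_single (Vertex.mk j (u - t))]
    · simp [regVert]
    · intro y _ hy
      have h' : ¬(j = y.left ∧ u - t = y.right) := fun e => hy (Vertex.ext e.1.symm e.2.symm)
      simp only [regVert, pathOp_single, if_neg h', smul_zero]
    · exact fun h => absurd (Finset.mem_univ _) h
  source f := by
    cases f using arrow_cases with
    | a i v _ =>
      refine end_ext fun j u s t => ?_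
      by_cases h : j = i ∧ u - t = v <;> simp [regVert, regArrow, regA, h]
    | b i v _ =>
      refine end_ext fun j u s t => ?_
      by_cases h : j = i ∧ u - t = v <;> simp [regVert, regArrow, regB, h]
  target f := by
    cases f using arrow_cases with
    | a i v _ =>
      refine end_ext fun j u s t => ?_
      by_cases h : (j = i ∧ u - t = v) ∧ level j u ≠ 0
      · obtain ⟨⟨rfl, rfl⟩, h⟩ := h
        simp [regVert, regArrow, regA, h]
      · simp only [regArrow, regA, Module.End.mul_apply, pathOp_single, one_smul, if_neg h, map_zero]
    | b i v _ =>
      refine end_ext fun j u s t => ?_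
      by_cases h : (j = i ∧ u - t = v) ∧ level j u + t + 1 < n
      · obtain ⟨⟨rfl, rfl⟩, h⟩ := h
        simp [regVert, regArrow, regB, h, sub_sub]
      · simp only [regArrow, regB, Module.End.mul_apply, pathOp_single, one_smul, if_neg h, map_zero]

/-- The sign `(-1) ^ t` in `regA` changes when `t` grows by one, which makes the squares
anticommute. -/
theorem regA_mul_regB {i v : ZMod n} (h : v ≠ i) :
    regA k i (v - 1) * regB k i v + regB k (i - 1) v * regA k i v = 0 := by
  refine end_ext fun j u s t => ?_
  by_cases e : j = i ∧ u - t = v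
  · obtain ⟨rfl, rfl⟩ := e
    -- The value `n` is the only one for which the two ways around the square could disagree: `b`
    -- would vanish before `a` is applied, but not after it.
    have hne : level j u + t + 1 ≠ n := fun e => h (eq_of_level_add e)
    by_cases hl : level j u = 0
    · by_cases ht : t + 1 < n <;> simp [regA, regB, hl, ht]
    · have hp := level_pred hl (j' := j - 1) (u' := u) (by ring)
      by_cases ht : level j u + t + 1 < n
      · have ht' : level (j - 1) u + t + 1 < n := by omega
        simp [regA, regB, hl, ht, ht', sub_sub, pow_succ]
      · have ht' : ¬(level (j - 1) u + t + 1 < n) := by omega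
        simp [regA, regB, hl, ht, ht']
  · simp [regA, regB, e]

theorem regA_mul_regB_boundary (i : ZMod n) : regA k i (i - 2) * regB k i (i - 1) = 0 := by
  refine end_ext fun j u s t => ?_
  by_cases e : (j = i ∧ u - t = i - 1) ∧ level j u + t + 1 < n
  · have h0 : level j u + t = 0 := by
      refine natCast_eq_zero_of_lt (n := n) (by omega) ?_
      push_cast
      rw [cast_level]
      linear_combination e.1.1 - e.1.2
    have hl : level j u = 0 := by omega
    simp only [regA, regB, Module.End.mul_apply, pathOp_single, one_smul, if_pos e]
    simp [hl]
  · simp only [regA, regB, Module.End.mul_apply, pathOp_single, one_smul, if_neg e, map_zero,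
      LinearMap.zero_apply]

theorem hom_arrowA {R : Type*} [Ring R] [Algebra k R] {e : Vertex n → R}
    {F : ∀ {x y : Vertex n}, (x ⟶ y) → R} (h : PathAlgebra.IsRep e F) (i u : ZMod n) :
    h.hom k (arrowA k n i u) = if hu : u ≠ i - 1 then
      F (x := Vertex.mk i u) (y := Vertex.mk (i - 1) u) (Arrow.a i u hu) else 0 := by
  rw [arrowA]
  split_ifs
  · exact h.hom_arrow _
  · exact map_zero _

theorem hom_arrowB {R : Type*} [Ring R] [Algebra k R] {e : Vertex n → R}
    {F : ∀ {x y : Vertex n}, (x ⟶ y) → R} (h : PathAlgebra.IsRep e F) (i u : ZMod n) :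
    h.hom k (arrowB k n i u) = if hu : u ≠ i then
      F (x := Vertex.mk i u) (y := Vertex.mk i (u - 1)) (Arrow.b i u hu) else 0 := by
  rw [arrowB]
  split_ifs
  · exact h.hom_arrow _
  · exact map_zero _

/-- The regular representation as a representation of the path algebra. -/
noncomputable def regHom : PathAlgebra k (Vertex n) →ₐ[k] Module.End k (Index n →₀ k) :=
  (reg_isRep k).hom k

theorem regHom_arrowA {i u : ZMod n} (h : u ≠ i - 1) :
    regHom k (arrowA k n i u) = regA k i u :=
  (hom_arrowA k (reg_isRep k) i u).trans (dif_pos h)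

theorem regHom_arrowB {i u : ZMod n} (h : u ≠ i) : regHom k (arrowB k n i u) = regB k i u :=
  (hom_arrowB k (reg_isRep k) i u).trans (dif_pos h)

theorem regHom_meshRelations (r : PathAlgebra k (Vertex n)) (hr : r ∈ meshRelations k n) :
    regHom k r = 0 := by
  obtain ⟨i, rfl⟩ | ⟨i, u, h, h', rfl⟩ := hr
  · rw [map_mul]
    by_cases h1 : i - 2 = i - 1
    · rw [show arrowA k n i (i - 2) = 0 by simp [arrowA, h1], map_zero, zero_mul]
    by_cases h2 : i - 1 = i
    · rw [show arrowB k n i (i - 1) = 0 by simp [arrowB, h2], map_zero, mul_zero]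
    rw [regHom_arrowA k h1, regHom_arrowB k h2]
    exact regA_mul_regB_boundary k i
  · have h1 : u - 1 ≠ i - 1 := fun e => h (sub_left_inj.1 e)
    rw [map_add, map_mul, map_mul, regHom_arrowA k h1, regHom_arrowB k h, regHom_arrowB k h',
      regHom_arrowA k h']
    exact regA_mul_regB k h

/-- The regular representation of the Auslander algebra. -/
noncomputable def reg : AuslanderTaft k n →ₐ[k] Module.End k (Index n →₀ k) :=
  liftHom (R := Module.End k (Index n →₀ k)) k (regHom k) (regHom_meshRelations k)

theorem reg_vert (i v : ZMod n) : reg k (vert k n i v) = regVert k i v :=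
  (reg_isRep k).hom_nil (Vertex.mk i v)

theorem reg_arrA {i v : ZMod n} (h : v ≠ i - 1) : reg k (arrA k n i v) = regA k i v :=
  regHom_arrowA k h

theorem reg_arrB {i v : ZMod n} (h : v ≠ i) : reg k (arrB k n i v) = regB k i v :=
  regHom_arrowB k h

/-- The coordinates with respect to the normal forms. -/
noncomputable def coords : AuslanderTaft k n →ₗ[k] Index n →₀ k :=
  (LinearMap.applyₗ (∑ x : Vertex n, Finsupp.single ((x.left, x.right, 0, 0) : Index n) (1 : k))) ∘ₗ
    (reg k).toLinearMap

theorem coords_mul (a b : AuslanderTaft k n) : coords k (a * b) = reg k a (coords k b) := by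
  simp [coords]

theorem coords_vert (j u : ZMod n) :
    coords k (vert k n j u) = Finsupp.single (j, u, 0, 0) 1 := by
  change reg k (vert k n j u) (∑ x : Vertex n, _) = _
  rw [reg_vert, map_sum, Finset.sum_eq_single (Vertex.mk j u)]
  · simp [regVert]
  · intro y _ hy
    have h' : ¬(y.left = j ∧ y.right - ((0 : ℕ) : ZMod n) = u) := fun e =>
      hy (Vertex.ext e.1 (by simpa using e.2))
    simp only [regVert, pathOp_single, if_neg h', smul_zero]
  · exact fun h => absurd (Finset.mem_univ _) h

theorem coords_aPath {j u : ZMod n} {s : ℕ} (h : level j u + s < n) :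
    coords k (aPath k j u s) = Finsupp.single (j, u, s, 0) 1 := by
  induction s generalizing j with
  | zero => exact coords_vert k j u
  | succ s ih =>
    have hl : level (j + 1) u = level j u + 1 :=
      level_shift (by omega) (by push_cast; ring)
    have hne : u ≠ j + 1 - 1 := fun e => by
      have := level_eq_zero_iff.2 e
      omega
    rw [aPath_succ', coords_mul, ih (by omega), reg_arrA k hne]
    simp [regA, hl]

/-- No sign appears, because every `a` acts before any `b`, that is, at `t = 0`. -/
theorem coords_monomial {j u : ZMod n} {s t : ℕ} (hs : level j u + s < n)
    (ht : level j u + t < n) :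
    coords k (monomial k j u s t) = Finsupp.single (j, u, s, t) 1 := by
  induction t with
  | zero => rw [monomial, bPath, vert_mul_aPath, coords_aPath k hs]
  | succ t ih =>
    have hne : u - t ≠ j := fun e => by
      have h1 : ((level j u + t + 1 : ℕ) : ZMod n) = 0 := by
        push_cast
        rw [cast_level]
        linear_combination -e
      exact absurd (natCast_eq_zero_of_lt (by omega) h1) (by omega)
    rw [← arrB_mul_monomial, coords_mul, ih (by omega), reg_arrB k hne]
    have ht : level j u + t + 1 < n := ht
    simp [regB, ht]

theorem linearCombination_coords (a : AuslanderTaft k n) :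
    Finsupp.linearCombination k (fun τ : Index n => monomial k τ.1 τ.2.1 τ.2.2.1 τ.2.2.2)
      (coords k a) = a := by
  induction a using monomial_induction with
  | zero => simp
  | add x y hx hy => rw [map_add, map_add, hx, hy]
  | smul c x hx => rw [map_smul, map_smul, hx]
  | monomial j u s t hs ht => rw [coords_monomial k hs ht]; simp

theorem coords_injective : Function.Injective (coords k (n := n)) :=
  Function.LeftInverse.injective (linearCombination_coords k)

theorem coords_apply_eq_zero {F : Set (ZMod n × ZMod n)} {x : AuslanderTaft k n}
    (hx : x ∈ levelIdeal k F) {j u : ZMod n} (h : (j, u) ∉ F) (s t : ℕ) :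
    coords k x (j, u, s, t) = 0 := by
  induction hx using Submodule.span_induction with
  | mem x hx =>
    obtain ⟨j', u', s', t', h', rfl⟩ := hx
    by_cases hv : level j' u' + s' < n ∧ level j' u' + t' < n
    · rw [coords_monomial k hv.1 hv.2, Finsupp.single_eq_of_ne]
      rintro ⟨⟩
      exact h h'
    · rw [monomial_eq_zero k hv, map_zero, Finsupp.zero_apply]
  | zero => rw [map_zero, Finsupp.zero_apply]
  | add x y _ _ hx hy => rw [map_add, Finsupp.add_apply, hx, hy, add_zero]
  | smul c x _ hx => rw [map_smul, Finsupp.smul_apply, hx, smul_zero]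

/-- The coordinates of the product with an arrow `a_{j,u}`. -/
theorem coords_mul_arrA {j u : ZMod n} (h : level j u ≠ 0) (a : AuslanderTaft k n) :
    coords k (a * arrA k n j u) =
      Finsupp.lmapDomain k k (fun τ : Index n => (τ.1, τ.2.1, τ.2.2.1 + 1, τ.2.2.2))
        (coords k (a * vert k n (j - 1) u)) := by
  induction a using monomial_induction with
  | zero => simp
  | add x y hx hy => simp only [add_mul, map_add, hx, hy]
  | smul c x hx => simp only [smul_mul_assoc, map_smul, hx]
  | monomial i v s t hs ht =>
    by_cases e : (j - 1, u) = (i + s, v)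
    · obtain ⟨e1, rfl⟩ := Prod.mk.inj e
      obtain rfl : j = i + s + 1 := by linear_combination e1
      -- Equality would put `(j, u)` at level 0, where `a_{j,u}` does not exist; so the lengthened
      -- monomial is again a basis element.
      have hs' : level i u + (s + 1) < n := by
        refine lt_of_le_of_ne (by omega) fun e => h ?_
        have := eq_of_level_add (n := n) (j := i) (u := u) (t := s) (by omega)
        exact level_eq_zero_iff.2 (by linear_combination this)
      rw [monomial_mul_arrA, add_sub_cancel_right, monomial_mul_vert, coords_monomial k hs ht,
        coords_monomial k hs' ht]
      simp
    · rw [← vert_mul_arrA, ← mul_assoc, monomial_mul_vert_of_ne k e, zero_mul, map_zero, map_zero]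

/-- Right multiplication by the arrow raises `s` by one, and so carries distinct basis monomials
starting at `(j - 1, u)` to distinct basis monomials. This gives the injection of `A p` into `A e`.
-/
theorem mul_arrA_injective {j u : ZMod n} (h : level j u ≠ 0) {a : AuslanderTaft k n}
    (ha : a * arrA k n j u = 0) : a * vert k n (j - 1) u = 0 := by
  have h1 := coords_mul_arrA k h a
  rw [ha, map_zero] at h1
  have h2 : Function.Injective (fun τ : Index n => (τ.1, τ.2.1, τ.2.2.1 + 1, τ.2.2.2)) := by
    rintro ⟨a, b, c, d⟩ ⟨a', b', c', d'⟩ e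
    simp only [Prod.mk.injEq, add_left_inj] at e ⊢
    exact e
  refine coords_injective k (Finsupp.mapDomain_injective h2 ?_)
  rw [map_zero, Finsupp.mapDomain_zero]
  exact h1.symm

/-- The augmentation which maps the vertices to the standard idempotents and kills the arrows. -/
theorem augmentation_isRep : PathAlgebra.IsRep (fun x : Vertex n => (Pi.single x 1 : Vertex n → k))
    (fun _ => 0) where
  idem x := by simp [← Pi.single_mul]
  ortho x y h := by
    ext z
    by_cases hz : z = x
    · subst hz
      simp [h]
    · simp [hz]
  sum := Finset.univ_sum_single _
  source _ := zero_mul _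
  target _ := mul_zero _

/-- The augmentation of the Auslander algebra. -/
noncomputable def augmentation : AuslanderTaft k n →ₐ[k] (Vertex n → k) :=
  liftHom k ((augmentation_isRep k).hom k) (by
    have ha (i u) : (augmentation_isRep k (n := n)).hom k (arrowA k n i u) = 0 := by
      rw [hom_arrowA]
      split_ifs <;> rfl
    rintro _ (⟨i, rfl⟩ | ⟨i, u, h, h', rfl⟩)
    · rw [map_mul, ha, zero_mul]
    · rw [map_add, map_mul, map_mul, ha, ha, zero_mul, mul_zero, add_zero])

theorem augmentation_vertexIdem (x : Vertex n) :
    augmentation k (vertexIdem k n x) = Pi.single x 1 :=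
  (augmentation_isRep k).hom_nil x

end Regular

/-! ### Vanishing of the Hochschild homology -/

section Vanishing

variable (k : Type u) [Field k] {n : ℕ} [NeZero n]

/-- A set of vertices containing with a vertex all the vertices of smaller level. -/
def IsLevelClosed (F : Set (ZMod n × ZMod n)) : Prop :=
  ∀ j u j' u', (j, u) ∈ F → level j' u' < level j u → (j', u') ∈ F

/-- A monomial from `(j - 1, u)` to `(j, u)` would turn at `(j, u)` itself and have `s ≡ -1` modulo
`n`. Since the level of `(j, u)` is at least 1, the bound only allows `s < n - 1`. -/
theorem monomial_mul_vert_eq_zero {j u i v : ZMod n} (h : level j u ≠ 0) (s t : ℕ) :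
    vert k n j u * monomial k i v s t * vert k n (j - 1) u = 0 := by
  by_cases hv : level i v + s < n ∧ level i v + t < n
  · by_cases e1 : (j, u) = (i, v - t)
    · by_cases e2 : (j - 1, u) = (i + s, v)
      · exfalso
        obtain ⟨rfl, e1⟩ := Prod.mk.inj e1
        obtain ⟨e3, rfl⟩ := Prod.mk.inj e2
        have hs : ((s + 1 : ℕ) : ZMod n) = 0 := by
          push_cast
          linear_combination -e3
        exact absurd (natCast_eq_zero_of_lt (by omega) hs) (by omega)
      · rw [mul_assoc, monomial_mul_vert_of_ne k e2, mul_zero]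
    · rw [vert_mul_monomial_of_ne k e1, zero_mul]
  · rw [monomial_eq_zero k hv, mul_zero, zero_mul]

theorem vert_mul_mul_vert_pred {j u : ZMod n} (h : level j u ≠ 0) (a : AuslanderTaft k n) :
    vert k n j u * a * vert k n (j - 1) u = 0 := by
  induction a using monomial_induction with
  | zero => simp
  | add x y hx hy => rw [mul_add, add_mul, hx, hy, add_zero]
  | smul c x hx => rw [mul_smul_comm, smul_mul_assoc, hx, smul_zero]
  | monomial i v s t => exact monomial_mul_vert_eq_zero k h s t

/-- A monomial starting at `(j, u)` either has `s = 0` and is a power of `b`, or has `a_{j,u}` as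
its first arrow. -/
theorem mul_vert_mem (j u : ZMod n) (a : AuslanderTaft k n) :
    a * vert k n j u ∈
      Submodule.span k (Set.range fun t : {t // level j u + t < n} => bPath k j u t) ⊔
        LinearMap.range (LinearMap.mulRight k (arrA k n j u)) := by
  induction a using monomial_induction with
  | zero => rw [zero_mul]; exact Submodule.zero_mem _
  | add x y hx hy => rw [add_mul]; exact Submodule.add_mem _ hx hy
  | smul c x hx => rw [smul_mul_assoc]; exact Submodule.smul_mem _ c hx
  | monomial i v s t hs ht =>
    by_cases e : (j, u) = (i + s, v)
    · obtain ⟨rfl, rfl⟩ := Prod.mk.inj e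
      rw [monomial_mul_vert]
      cases s with
      | zero =>
        refine Submodule.mem_sup_left (Submodule.subset_span ⟨⟨t, ?_⟩, ?_⟩)
        · simpa using ht
        · simp [monomial, aPath, bPath_mul_vert]
      | succ s =>
        refine Submodule.mem_sup_right ⟨monomial k i u s t, ?_⟩
        rw [LinearMap.mulRight_apply, ← monomial_mul_arrA, Nat.cast_add, Nat.cast_one, add_assoc]
    · rw [monomial_mul_vert_of_ne k e]
      exact Submodule.zero_mem _

/-- A monomial ending at `(j, u)` either has `t = 0` and is a power of `a`, or turns strictly below
`(j, u)`, hence in `F`. -/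
theorem vert_mul_mem {F : Set (ZMod n × ZMod n)} {j u : ZMod n}
    (hF : ∀ i v, level i v < level j u → (i, v) ∈ F) (a : AuslanderTaft k n) :
    vert k n j u * a ∈
      Submodule.span k (Set.range fun s : {s // level j u + s < n} => aPath k j u s) ⊔
        levelIdeal k F := by
  induction a using monomial_induction with
  | zero => rw [mul_zero]; exact Submodule.zero_mem _
  | add x y hx hy => rw [mul_add]; exact Submodule.add_mem _ hx hy
  | smul c x hx => rw [mul_smul_comm]; exact Submodule.smul_mem _ c hx
  | monomial i v s t hs ht =>
    by_cases e : (j, u) = (i, v - t)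
    · obtain ⟨rfl, rfl⟩ := Prod.mk.inj e
      rw [vert_mul_monomial]
      cases t with
      | zero =>
        refine Submodule.mem_sup_left (Submodule.subset_span ⟨⟨s, ?_⟩, ?_⟩)
        · simpa using hs
        · simp [monomial, bPath, vert_mul_aPath]
      | succ t =>
        refine Submodule.mem_sup_right (monomial_mem_levelIdeal k (hF _ _ ?_) _ _)
        rw [level_shift ht (j' := j) (u' := v - (t + 1 : ℕ)) (by ring)]
        omega
    · rw [vert_mul_monomial_of_ne k e]
      exact Submodule.zero_mem _

/-- Elements of the ideal have zero coordinates at every index with turning vertex outside `F`,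
whereas these monomials are distinct basis elements turning at `(j, u)`. -/
theorem linearIndependent_monomial {F : Set (ZMod n × ZMod n)} {j u : ZMod n} (h : (j, u) ∉ F) :
    LinearIndependent k fun ts : {t // level j u + t < n} × {s // level j u + s < n} =>
      (levelIdeal k F).mkQ (bPath k j u ts.1 * aPath k j u ts.2) := by
  refine linearIndependent_iff.2 fun c hc => ?_
  have hmem : Finsupp.linearCombination k
      (fun ts : {t // level j u + t < n} × {s // level j u + s < n} =>
        monomial k j u ts.2 ts.1) c ∈ levelIdeal k F := by
    rw [← Submodule.ker_mkQ (levelIdeal k F), LinearMap.mem_ker, ← hc,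
      Finsupp.apply_linearCombination]
    rfl
  ext ⟨t, s⟩
  have h0 := coords_apply_eq_zero k hmem h s t
  rw [Finsupp.apply_linearCombination, Finsupp.linearCombination_apply, Finsupp.sum_apply,
    Finsupp.sum, Finset.sum_eq_single (t, s)] at h0
  · simpa [coords_monomial k s.2 t.2] using h0
  · rintro ⟨t', s'⟩ _ hne
    have : ((j, u, (s' : ℕ), (t' : ℕ)) : Index n) ≠ (j, u, (s : ℕ), (t : ℕ)) := by
      rintro e
      simp only [Prod.mk.injEq, true_and] at e
      exact hne (Prod.ext (Subtype.ext e.2) (Subtype.ext e.1))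
    simp [coords_monomial k s'.2 t'.2, Finsupp.single_eq_of_ne this.symm]
  · intro hts
    simp [Finsupp.notMem_support_iff.1 hts]

omit [NeZero n] in
theorem isLevelClosed_insert {F : Set (ZMod n × ZMod n)} {j u : ZMod n} (hF : IsLevelClosed F)
    (h : ∀ i v, level i v < level j u → (i, v) ∈ F) : IsLevelClosed (insert (j, u) F) := by
  rintro j₁ u₁ j₂ u₂ (⟨⟨⟩⟩ | h1) h2
  · exact Or.inr (h _ _ h2)
  · exact Or.inr (hF _ _ _ _ h1 h2)

theorem acyclic_quot_insert {F : Set (ZMod n × ZMod n)} {j u : ZMod n} (hF : IsLevelClosed F)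
    (hF' : IsLevelClosed (insert (j, u) F)) (hju : (j, u) ∉ F)
    (h : ∀ i v, level i v < level j u → (i, v) ∈ F)
    (ih : ∀ m, Ch.Acyclic (Bimod.quot _ (levelIdeal_isTwoSided k hF')) (m + 1)) (m : ℕ) :
    Ch.Acyclic (Bimod.quot _ (levelIdeal_isTwoSided k hF)) (m + 1) := by
  have hI := levelIdeal_isTwoSided k hF
  -- At level 0 there is no arrow `a_{j,u}`: then `α = 0`, and the presentation of the cokernel
  -- degenerates to `A e` itself, with `p = 0`.
  refine acyclic_quot_of_heredity hI (levelIdeal_isTwoSided k hF')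
    (e := vert k n j u) (p := if level j u = 0 then 0 else vert k n (j - 1) u)
    (α := arrA k n j u) (vert_mul_self k j u) ?_ ?_ (arrA_mul_vert k j u) ?_ ?_ ?_ ?_ ?_ ?_
    (fun t : {t // level j u + t < n} => bPath k j u t)
    (fun s : {s // level j u + s < n} => aPath k j u s) (mul_vert_mem k j u)
    (fun t => bPath_mul_vert k j u t) (vert_mul_mem k h) (linearIndependent_monomial k hju) ih m
  · split_ifs
    · exact mul_zero _
    · exact vert_mul_self k _ _
  · split_ifs with hl
    · rw [zero_mul, arrA_eq_zero k (level_eq_zero_iff.1 hl)]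
    · exact vert_mul_arrA k j u
  · by_cases hl : level j u = 0
    · rw [arrA_eq_zero k (level_eq_zero_iff.1 hl)]
      exact Submodule.zero_mem _
    · rw [← vert_mul_arrA]
      refine hI.right _ _ ?_
      rw [← monomial_zero_zero]
      have := level_pred hl (j' := j - 1) (u' := u) (by ring)
      exact monomial_mem_levelIdeal k (h _ _ (by omega)) _ _
  · intro a ha
    split_ifs with hl
    · exact mul_zero _
    · exact mul_arrA_injective k hl ha
  · intro a
    split_ifs with hl
    · rw [mul_zero]
      exact Submodule.zero_mem _
    · rw [vert_mul_mul_vert_pred k hl]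
      exact Submodule.zero_mem _
  · refine Submodule.span_mono ?_
    rintro _ ⟨i, v, s, t, hiv, rfl⟩
    exact ⟨i, v, s, t, Or.inr hiv, rfl⟩
  · rw [← monomial_zero_zero]
    exact monomial_mem_levelIdeal k (Or.inl rfl) _ _
  · refine Submodule.span_le.2 ?_
    rintro _ ⟨i, v, s, t, ⟨⟨⟩⟩ | hiv, rfl⟩
    · refine Submodule.mem_sup_right (Submodule.subset_span ⟨(bPath k j u t, aPath k j u s), ?_⟩)
      simp only [bPath_mul_vert, monomial]
    · exact Submodule.mem_sup_left (monomial_mem_levelIdeal k hiv s t)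

/-- Induction on the number of vertices missing from `F`. If none is missing the quotient is zero;
otherwise a missing vertex of least level is added, which keeps `F` closed. -/
theorem acyclic_quot_levelIdeal (N : ℕ) : ∀ (F : Finset (ZMod n × ZMod n))
    (hF : IsLevelClosed (F : Set (ZMod n × ZMod n))), Fᶜ.card = N →
    ∀ m, Ch.Acyclic (Bimod.quot _ (levelIdeal_isTwoSided k hF)) (m + 1) := by
  induction N with
  | zero =>
    intro F hF hN m
    have hu : (F : Set (ZMod n × ZMod n)) = Set.univ := by
      rw [Finset.card_eq_zero, Finset.compl_eq_empty_iff] at hN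
      rw [hN, Finset.coe_univ]
    have : Subsingleton (AuslanderTaft k n ⧸ levelIdeal k (F : Set (ZMod n × ZMod n))) := by
      rw [hu, levelIdeal_univ]
      infer_instance
    exact Ch.acyclic_of_subsingleton _ _
  | succ N ih =>
    intro F hF hN
    have hne : Fᶜ.Nonempty := Finset.card_pos.1 (by omega)
    obtain ⟨⟨j, u⟩, hju, hmin⟩ := Finset.exists_min_image Fᶜ (fun w => level w.1 w.2) hne
    have hlow (i v) (hlt : level i v < level j u) : (i, v) ∈ (F : Set (ZMod n × ZMod n)) := by
      by_contra hiv
      exact absurd (hmin (i, v) (by simpa using hiv)) (by simpa using hlt)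
    have hins : IsLevelClosed ((insert (j, u) F : Finset (ZMod n × ZMod n)) :
        Set (ZMod n × ZMod n)) := by
      rw [Finset.coe_insert]
      exact isLevelClosed_insert hF hlow
    have hcard : (insert (j, u) F)ᶜ.card = N := by
      rw [Finset.compl_insert, Finset.card_erase_of_mem hju, hN, Nat.add_sub_cancel]
    have ih' := ih _ hins hcard
    -- The bimodule depends on the set and on the proof of closedness, so the set underlying the
    -- enlarged finset is replaced by a variable before being identified.
    have key : ∀ (G : Set (ZMod n × ZMod n)) (hG : IsLevelClosed G),
        G = insert (j, u) (F : Set (ZMod n × ZMod n)) →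
        (∀ m, Ch.Acyclic (Bimod.quot _ (levelIdeal_isTwoSided k hG)) (m + 1)) →
        ∀ m, Ch.Acyclic (Bimod.quot _ (levelIdeal_isTwoSided k hF)) (m + 1) := by
      rintro _ hG rfl h
      exact acyclic_quot_insert k hF hG (by simpa using hju) hlow h
    exact key _ hins (Finset.coe_insert _ _) ih'

/-- The Hochschild homology of the Auslander algebra vanishes in positive degrees. -/
theorem acyclic_self (m : ℕ) : Ch.Acyclic (Bimod.self k (AuslanderTaft k n)) (m + 1) := by
  have hE : IsLevelClosed ((∅ : Finset (ZMod n × ZMod n)) : Set (ZMod n × ZMod n)) :=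
    fun _ _ _ _ h => absurd h (Finset.notMem_empty _)
  have hbot : levelIdeal k ((∅ : Finset (ZMod n × ZMod n)) : Set (ZMod n × ZMod n)) = ⊥ := by
    refine Submodule.span_eq_bot.2 ?_
    rintro _ ⟨j, u, s, t, h, rfl⟩
    exact absurd h (Finset.notMem_empty _)
  refine Ch.acyclic_of_bijective
    (e := LinearEquiv.ofBijective (Submodule.mkQ _) ⟨?_, Submodule.mkQ_surjective _⟩)
    ⟨fun a x => ?_, fun a x => ?_⟩ (acyclic_quot_levelIdeal k _ ∅ hE rfl m)
  · rw [← LinearMap.ker_eq_bot, Submodule.ker_mkQ, hbot]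
  · rfl
  · rfl

end Vanishing

/-! ### Comparison of the two models of the Hochschild complex -/

section Comparison

section

variable {k : Type*} [CommRing k] {A : Type*} [Ring A] [Algebra k A]

/-- The chain `x ⊗ a`. -/
noncomputable def chainSnoc {m : ℕ} : Chains k A m →ₗ[k] A →ₗ[k] Chains k A (m + 1) :=
  PiTensorProduct.lift (MultilinearMap.curryRight (M := fun _ : Fin (m + 2) => A)
    (PiTensorProduct.tprod k))

theorem chainSnoc_tprod {m : ℕ} (c : Fin (m + 1) → A) (a : A) :
    chainSnoc (PiTensorProduct.tprod k c) a =
      PiTensorProduct.tprod k (Fin.snoc (α := fun _ : Fin (m + 2) => A) c a) := by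
  rw [chainSnoc, PiTensorProduct.lift.tprod]
  rfl

variable (k A) in
/-- The isomorphism `A^{⊗(m+1)} ⊗ A ≅ A^{⊗(m+2)}`. -/
noncomputable def chainSnocEquiv (m : ℕ) : Chains k A m ⊗[k] A ≃ₗ[k] Chains k A (m + 1) :=
  LinearEquiv.ofLinearMap (TensorProduct.lift chainSnoc)
    (PiTensorProduct.lift (MultilinearMap.uncurryRight (M := fun _ : Fin (m + 2) => A)
      ((TensorProduct.mk k (Chains k A m) A).compMultilinearMap (PiTensorProduct.tprod k))))
    (by
      refine PiTensorProduct.ext (MultilinearMap.ext fun c => ?_)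
      simp only [LinearMap.compMultilinearMap_apply, LinearMap.comp_apply,
        PiTensorProduct.lift.tprod, MultilinearMap.uncurryRight_apply, TensorProduct.mk_apply,
        TensorProduct.lift.tmul, chainSnoc_tprod, LinearMap.id_apply]
      rw [Fin.snoc_init_self])
    (by
      refine TensorProduct.ext' fun x a => ?_
      suffices h : ((PiTensorProduct.lift (MultilinearMap.uncurryRight
          (M := fun _ : Fin (m + 2) => A) ((TensorProduct.mk k (Chains k A m) A).compMultilinearMap
          (PiTensorProduct.tprod k)))) ∘ₗ chainSnoc.flip a) =
          (TensorProduct.mk k (Chains k A m) A).flip a from LinearMap.congr_fun h x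
      refine PiTensorProduct.ext (MultilinearMap.ext fun c => ?_)
      simp [chainSnoc_tprod, Fin.init_snoc])

@[simp] theorem chainSnocEquiv_tmul {m : ℕ} (x : Chains k A m) (a : A) :
    chainSnocEquiv k A m (x ⊗ₜ a) = chainSnoc x a := rfl

theorem face_tprod (m : ℕ) (i : Fin (m + 1)) (c : Fin (m + 2) → A) :
    face k A m i (PiTensorProduct.tprod k c) =
      PiTensorProduct.tprod k (Fin.contractNth i.castSucc (fun x y : A => x * y) c) := by
  rw [face, PiTensorProduct.lift.tprod]
  rfl

theorem rotation_tprod (m : ℕ) (c : Fin (m + 1) → A) :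
    rotation k A m (PiTensorProduct.tprod k c) =
      PiTensorProduct.tprod k (fun i => c ((finRotate (m + 1)).symm i)) :=
  PiTensorProduct.reindex_tprod _ _

theorem rotation_chainSnoc {m : ℕ} (c : Fin (m + 1) → A) (a : A) :
    rotation k A (m + 1) (chainSnoc (PiTensorProduct.tprod k c) a) =
      PiTensorProduct.tprod k (Fin.cons (α := fun _ : Fin (m + 2) => A) a c) := by
  rw [chainSnoc_tprod, rotation_tprod]
  congr 1
  ext i
  obtain ⟨i, rfl⟩ := (finRotate (m + 2)).surjective i
  rw [Equiv.symm_apply_apply]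
  refine Fin.lastCases ?_ (fun i => ?_) i
  · simp
  · simp [Fin.snoc_castSucc]

theorem face_castSucc_chainSnoc {m : ℕ} (i : Fin (m + 1)) (x : Chains k A (m + 1)) (a : A) :
    face k A (m + 1) i.castSucc (chainSnoc x a) = chainSnoc (face k A m i x) a := by
  suffices face k A (m + 1) i.castSucc ∘ₗ chainSnoc.flip a = chainSnoc.flip a ∘ₗ face k A m i from
    LinearMap.congr_fun this x
  refine PiTensorProduct.ext (MultilinearMap.ext fun c => ?_)
  simp only [LinearMap.compMultilinearMap_apply, LinearMap.comp_apply, LinearMap.flip_apply,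
    chainSnoc_tprod, face_tprod]
  congr 1
  ext j
  have hi := i.isLt
  refine Fin.lastCases ?_ (fun j => ?_) j
  · rw [Fin.snoc_last, Fin.contractNth_apply_of_gt _ _ _ _ (by simp; omega), Fin.succ_last, Fin.snoc_last]
  · rw [Fin.snoc_castSucc]
    rcases lt_trichotomy (j : ℕ) (i : ℕ) with h | h | h
    · rw [Fin.contractNth_apply_of_lt _ _ _ _ (by simpa using h),
        Fin.contractNth_apply_of_lt _ _ _ _ (by simpa using h), Fin.snoc_castSucc]
    · rw [Fin.contractNth_apply_of_eq _ _ _ _ (by simpa using h),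
        Fin.contractNth_apply_of_eq _ _ _ _ (by simpa using h), Fin.snoc_castSucc,
        Fin.succ_castSucc, Fin.snoc_castSucc]
    · rw [Fin.contractNth_apply_of_gt _ _ _ _ (by simpa using h),
        Fin.contractNth_apply_of_gt _ _ _ _ (by simpa using h), Fin.succ_castSucc,
        Fin.snoc_castSucc]

theorem face_last_chainSnoc_chainSnoc {m : ℕ} (x : Chains k A m) (c a : A) :
    face k A (m + 1) (Fin.last (m + 1)) (chainSnoc (chainSnoc x c) a) = chainSnoc x (c * a) := by
  suffices face k A (m + 1) (Fin.last (m + 1)) ∘ₗ chainSnoc.flip a ∘ₗ chainSnoc.flip c =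
      chainSnoc.flip (c * a) from LinearMap.congr_fun this x
  refine PiTensorProduct.ext (MultilinearMap.ext fun d => ?_)
  simp only [LinearMap.compMultilinearMap_apply, LinearMap.comp_apply, LinearMap.flip_apply,
    chainSnoc_tprod, face_tprod]
  congr 1
  ext j
  refine Fin.lastCases ?_ (fun j => ?_) j
  · rw [Fin.contractNth_apply_of_eq _ _ _ _ (by simp), Fin.snoc_castSucc, Fin.snoc_last,
      Fin.succ_last, Fin.snoc_last, Fin.snoc_last]
  · rw [Fin.contractNth_apply_of_lt _ _ _ _ (by simp; omega), Fin.snoc_castSucc, Fin.snoc_castSucc,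
      Fin.snoc_castSucc]

/-- The cyclic face moves `a` to the front and merges it into the first factor, leaving `c` alone.
This is the recursion that defines `Ch.lmul`. -/
theorem face_zero_rotation_chainSnoc_chainSnoc {m : ℕ} (x : Chains k A m) (c a : A) :
    face k A (m + 1) 0 (rotation k A (m + 2) (chainSnoc (chainSnoc x c) a)) =
      chainSnoc (face k A m 0 (rotation k A (m + 1) (chainSnoc x a))) c := by
  suffices face k A (m + 1) 0 ∘ₗ rotation k A (m + 2) ∘ₗ chainSnoc.flip a ∘ₗ chainSnoc.flip c =
      chainSnoc.flip c ∘ₗ face k A m 0 ∘ₗ rotation k A (m + 1) ∘ₗ chainSnoc.flip a from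
    LinearMap.congr_fun this x
  refine PiTensorProduct.ext (MultilinearMap.ext fun d => ?_)
  simp only [LinearMap.compMultilinearMap_apply, LinearMap.comp_apply, LinearMap.flip_apply,
    rotation_chainSnoc]
  rw [chainSnoc_tprod, rotation_chainSnoc, Fin.cons_snoc_eq_snoc_cons, ← chainSnoc_tprod]
  exact face_castSucc_chainSnoc 0 _ c

variable (k A) in
/-- The chains of degree `0`. -/
noncomputable def chainZeroEquiv : A ≃ₗ[k] Chains k A 0 :=
  (PiTensorProduct.subsingletonEquiv (R := k) (s := fun _ : Fin 1 => A) 0).symm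

theorem chainZeroEquiv_apply (a : A) :
    chainZeroEquiv k A a = PiTensorProduct.tprod k (fun _ : Fin 1 => a) := by
  rw [chainZeroEquiv, LinearEquiv.symm_apply_eq, PiTensorProduct.subsingletonEquiv_apply_tprod]

theorem face_chainSnoc_zero (x a : A) :
    face k A 0 0 (chainSnoc (chainZeroEquiv k A x) a) = chainZeroEquiv k A (x * a) := by
  rw [chainZeroEquiv_apply, chainZeroEquiv_apply, chainSnoc_tprod, face_tprod]
  congr 1
  ext i
  obtain rfl : i = 0 := Fin.fin_one_eq_zero i
  rw [Fin.contractNth_apply_of_eq _ _ _ _ (by simp)]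
  simp [Fin.snoc]

theorem face_rotation_chainSnoc_zero (x a : A) :
    face k A 0 0 (rotation k A 1 (chainSnoc (chainZeroEquiv k A x) a)) =
      chainZeroEquiv k A (a * x) := by
  rw [chainZeroEquiv_apply, chainZeroEquiv_apply, rotation_chainSnoc, face_tprod]
  congr 1
  ext i
  obtain rfl : i = 0 := Fin.fin_one_eq_zero i
  rw [Fin.contractNth_apply_of_eq _ _ _ _ (by simp)]
  simp

end

variable (k A : Type u) [CommRing k] [Ring A] [Algebra k A]

/-- The comparison of the two models of the Hochschild chains. -/
noncomputable def chainEquiv : (m : ℕ) → Ch k A A m ≃ₗ[k] Chains k A m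
  | 0 => (Ch.zeroEquiv k A A).symm ≪≫ₗ chainZeroEquiv k A
  | m + 1 => (Ch.succEquiv k A A m).symm ≪≫ₗ
      TensorProduct.congr (chainEquiv m) (LinearEquiv.refl k A) ≪≫ₗ chainSnocEquiv k A m

variable {k A}

theorem chainEquiv_zero (a : A) :
    chainEquiv k A 0 (Ch.zeroEquiv k A A a) = chainZeroEquiv k A a := by
  simp [chainEquiv]

theorem chainEquiv_mk {m : ℕ} (x : Ch k A A m) (a : A) :
    chainEquiv k A (m + 1) (Ch.mk x a) = chainSnoc (chainEquiv k A m x) a := by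
  simp [chainEquiv]

theorem chainEquiv_rmul {m : ℕ} (x : Ch k A A m) (a : A) :
    chainEquiv k A m (Ch.rmul (Bimod.self k A) m x a) =
      face k A m (Fin.last m) (chainSnoc (chainEquiv k A m x) a) := by
  cases m with
  | zero =>
    obtain ⟨x, rfl⟩ := (Ch.zeroEquiv k A A).surjective x
    rw [Ch.rmul_zero_apply, chainEquiv_zero, chainEquiv_zero]
    exact (face_chainSnoc_zero x a).symm
  | succ m =>
    suffices (chainEquiv k A (m + 1)).toLinearMap ∘ₗ (Ch.rmul (Bimod.self k A) (m + 1)).flip a =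
        face k A (m + 1) (Fin.last (m + 1)) ∘ₗ chainSnoc.flip a ∘ₗ
          (chainEquiv k A (m + 1)).toLinearMap from LinearMap.congr_fun this x
    refine Ch.hom_ext fun y c => ?_
    simp only [LinearMap.comp_apply, LinearMap.flip_apply, LinearEquiv.coe_coe, Ch.rmul_mk,
      chainEquiv_mk, face_last_chainSnoc_chainSnoc]

theorem chainEquiv_lmul {m : ℕ} (x : Ch k A A m) (a : A) :
    chainEquiv k A m (Ch.lmul (Bimod.self k A) m x a) =
      face k A m 0 (rotation k A (m + 1) (chainSnoc (chainEquiv k A m x) a)) := by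
  suffices (chainEquiv k A m).toLinearMap ∘ₗ (Ch.lmul (Bimod.self k A) m).flip a =
      face k A m 0 ∘ₗ rotation k A (m + 1) ∘ₗ chainSnoc.flip a ∘ₗ (chainEquiv k A m).toLinearMap
    from LinearMap.congr_fun this x
  induction m with
  | zero =>
    refine Ch.zero_ext fun x => ?_
    simp only [LinearMap.comp_apply, LinearMap.flip_apply, LinearEquiv.coe_coe,
      Ch.lmul_zero_apply, chainEquiv_zero]
    exact (face_rotation_chainSnoc_zero x a).symm
  | succ m ih =>
    refine Ch.hom_ext fun y c => ?_
    have h := LinearMap.congr_fun (ih y) y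
    simp only [LinearMap.comp_apply, LinearMap.flip_apply, LinearEquiv.coe_coe] at h
    simp only [LinearMap.comp_apply, LinearMap.flip_apply, LinearEquiv.coe_coe, Ch.lmul_mk,
      chainEquiv_mk, face_zero_rotation_chainSnoc_chainSnoc, h]

/-- All inner faces but the last ignore the last factor; splitting that one off the alternating sum
yields the recursion of `Ch.bar`. -/
theorem chainEquiv_bar {m : ℕ} (x : Ch k A A (m + 1)) :
    chainEquiv k A m (Ch.bar (Bimod.self k A) m x) = barB k A m (chainEquiv k A (m + 1) x) := by
  suffices (chainEquiv k A m).toLinearMap ∘ₗ Ch.bar (Bimod.self k A) m =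
      barB k A m ∘ₗ (chainEquiv k A (m + 1)).toLinearMap from LinearMap.congr_fun this x
  induction m with
  | zero =>
    refine Ch.hom_ext fun x a => ?_
    simp only [LinearMap.comp_apply, LinearEquiv.coe_coe, Ch.bar_zero_mk, chainEquiv_rmul,
      chainEquiv_mk, barB]
    simp
  | succ m ih =>
    refine Ch.hom_ext fun x a => ?_
    have h := LinearMap.congr_fun (ih x) x
    simp only [LinearMap.comp_apply, LinearEquiv.coe_coe] at h
    simp only [LinearMap.comp_apply, LinearEquiv.coe_coe, Ch.bar_succ_mk, map_add, map_smul,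
      chainEquiv_rmul, chainEquiv_mk, h, barB, Fin.sum_univ_castSucc (n := m + 1),
      LinearMap.add_apply, LinearMap.sum_apply, LinearMap.smul_apply, map_sum,
      face_castSucc_chainSnoc, Fin.val_castSucc, Fin.val_last]

theorem chainEquiv_diff {m : ℕ} (x : Ch k A A (m + 1)) :
    chainEquiv k A m (Ch.diff (Bimod.self k A) m x) =
      hochschildB k A m (chainEquiv k A (m + 1) x) := by
  suffices (chainEquiv k A m).toLinearMap ∘ₗ Ch.cyc (Bimod.self k A) m =
      face k A m 0 ∘ₗ rotation k A (m + 1) ∘ₗ (chainEquiv k A (m + 1)).toLinearMap by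
    have h := LinearMap.congr_fun this x
    simp only [LinearMap.comp_apply, LinearEquiv.coe_coe] at h
    simp only [Ch.diff_apply, map_add, map_smul, chainEquiv_bar, h, hochschildB,
      LinearMap.add_apply, LinearMap.smul_apply, LinearMap.comp_apply]
  refine Ch.hom_ext fun x a => ?_
  simp only [LinearMap.comp_apply, LinearEquiv.coe_coe, Ch.cyc_mk, chainEquiv_lmul, chainEquiv_mk]

theorem barB_barB {m : ℕ} (x : Chains k A (m + 2)) : barB k A m (barB k A (m + 1) x) = 0 := by
  obtain ⟨x, rfl⟩ := (chainEquiv k A (m + 2)).surjective x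
  rw [← chainEquiv_bar, ← chainEquiv_bar, Ch.bar_bar, map_zero]

theorem hochschildB_hochschildB {m : ℕ} (x : Chains k A (m + 2)) :
    hochschildB k A m (hochschildB k A (m + 1) x) = 0 := by
  obtain ⟨x, rfl⟩ := (chainEquiv k A (m + 2)).surjective x
  rw [← chainEquiv_diff, ← chainEquiv_diff, Ch.diff_diff, map_zero]

theorem exists_hochschildB_eq {m : ℕ} (h : Ch.Acyclic (Bimod.self k A) (m + 1))
    (x : Chains k A (m + 1)) (hx : hochschildB k A m x = 0) :
    ∃ y, hochschildB k A (m + 1) y = x := by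
  obtain ⟨x, rfl⟩ := (chainEquiv k A (m + 1)).surjective x
  rw [← chainEquiv_diff, LinearEquiv.map_eq_zero_iff] at hx
  obtain ⟨y, hy⟩ := h x hx
  exact ⟨chainEquiv k A (m + 2) y, by rw [← chainEquiv_diff, hy]⟩

/-! ### Exactness of the bar complex -/

namespace Ch

variable (k A) in
/-- The contracting homotopy of the bar complex, which adds a factor `1` on the left. -/
noncomputable def consOne : (m : ℕ) → Ch k A A m →ₗ[k] Ch k A A (m + 1)
  | 0 => mk (zeroEquiv k A A 1) ∘ₗ (zeroEquiv k A A).symm.toLinearMap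
  | m + 1 => lift (mk ∘ₗ consOne m)

@[simp] theorem consOne_zero_apply (a : A) :
    consOne k A 0 (zeroEquiv k A A a) = mk (zeroEquiv k A A 1) a := by
  simp [consOne]

@[simp] theorem consOne_mk {m : ℕ} (x : Ch k A A m) (a : A) :
    consOne k A (m + 1) (mk x a) = mk (consOne k A m x) a := by
  simp [consOne]

theorem consOne_rmul {m : ℕ} (x : Ch k A A m) (a : A) :
    consOne k A m (rmul (Bimod.self k A) m x a) =
      rmul (Bimod.self k A) (m + 1) (consOne k A m x) a := by
  suffices consOne k A m ∘ₗ (rmul (Bimod.self k A) m).flip a =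
      (rmul (Bimod.self k A) (m + 1)).flip a ∘ₗ consOne k A m from LinearMap.congr_fun this x
  cases m with
  | zero => exact zero_ext fun x => by simp [Bimod.self]
  | succ m => exact hom_ext fun x c => by simp

theorem bar_consOne_zero (x : Ch k A A 0) :
    bar (Bimod.self k A) 0 (consOne k A 0 x) = x := by
  obtain ⟨x, rfl⟩ := (zeroEquiv k A A).surjective x
  simp [Bimod.self]

/-- The first face of `1 ⊗ x` is `x`; the other faces are those of `x`, moved by one place and hence
with the opposite sign. -/
theorem bar_consOne {m : ℕ} (x : Ch k A A (m + 1)) :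
    bar (Bimod.self k A) (m + 1) (consOne k A (m + 1) x) +
      consOne k A m (bar (Bimod.self k A) m x) = x := by
  suffices bar (Bimod.self k A) (m + 1) ∘ₗ consOne k A (m + 1) +
      consOne k A m ∘ₗ bar (Bimod.self k A) m = LinearMap.id from LinearMap.congr_fun this x
  induction m with
  | zero =>
    refine hom_ext fun x a => ?_
    simp [bar_consOne_zero, consOne_rmul]
  | succ m ih =>
    refine hom_ext fun x a => ?_
    have h : bar (Bimod.self k A) (m + 1) (consOne k A (m + 1) x) +
      consOne k A m (bar (Bimod.self k A) m x) = x := LinearMap.congr_fun (ih x) x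
    conv_rhs => rw [LinearMap.id_apply, ← h]
    simp only [LinearMap.add_apply, LinearMap.comp_apply, consOne_mk, bar_succ_mk, map_add,
      map_smul, consOne_rmul]
    module

end Ch

theorem barB_zero_surjective (x : Chains k A 0) : ∃ y, barB k A 0 y = x := by
  obtain ⟨x, rfl⟩ := (chainEquiv k A 0).surjective x
  exact ⟨_, by rw [← Ch.bar_consOne_zero x, chainEquiv_bar]⟩

theorem exists_barB_eq {m : ℕ} (x : Chains k A (m + 1)) (hx : barB k A m x = 0) :
    ∃ y, barB k A (m + 1) y = x := by
  obtain ⟨x, rfl⟩ := (chainEquiv k A (m + 1)).surjective x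
  rw [← chainEquiv_bar, LinearEquiv.map_eq_zero_iff] at hx
  have h := Ch.bar_consOne x
  rw [hx, map_zero, add_zero] at h
  exact ⟨chainEquiv k A (m + 2) (Ch.consOne k A (m + 1) x), by rw [← chainEquiv_bar, h]⟩

end Comparison

/-! ### The relations of the cyclic bicomplex -/

section Bicomplex

section

variable {R X Y Z ι : Type*} [Ring R] [AddCommGroup X] [Module R X] [AddCommGroup Y] [Module R Y]
  [AddCommGroup Z] [Module R Z]

theorem sum_linearMap_comp (s : Finset ι) (f : ι → Y →ₗ[R] Z) (g : X →ₗ[R] Y) :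
    (∑ i ∈ s, f i) ∘ₗ g = ∑ i ∈ s, f i ∘ₗ g := by
  ext x
  simp

theorem linearMap_comp_sum (s : Finset ι) (g : Y →ₗ[R] Z) (f : ι → X →ₗ[R] Y) :
    (g ∘ₗ ∑ i ∈ s, f i) = ∑ i ∈ s, g ∘ₗ f i := by
  ext x
  simp

end

/-! ### Operator identities behind b (1 - t) = (1 - t) b' and b' N = N b -/

section

variable {R X Y : Type*} [Ring R] [AddCommGroup X] [Module R X] [AddCommGroup Y] [Module R Y]
  {S : Module.End R X} {T : Module.End R Y} {m : ℕ} (d : X →ₗ[R] Y)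

/-- The two sums will be `b` and `b'`, with `S` and `T` the cyclic operators and `d` the face of
index 0. Composing with `S` on the right and extracting `T` on the left shifts the index by one. The
unmatched terms are `d S` in both cases, at `i = 0` because `S ^ (m + 2) = 1` and at `i = m + 1`
because `T ^ (m + 1) = 1`. -/
theorem sum_conj_comp_one_sub (hS : S ^ (m + 2) = 1) (hT : T ^ (m + 1) = 1) :
    (∑ i ∈ Finset.range (m + 2), (T ^ i) ∘ₗ d ∘ₗ (S ^ (m + 2 - i))) ∘ₗ (1 - S) =
      (1 - T) ∘ₗ ∑ i ∈ Finset.range (m + 1), (T ^ i) ∘ₗ d ∘ₗ (S ^ (m + 2 - i)) := by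
  have h1 : (∑ i ∈ Finset.range (m + 2), (T ^ i) ∘ₗ d ∘ₗ (S ^ (m + 2 - i))) ∘ₗ S =
      T ∘ₗ (∑ i ∈ Finset.range (m + 1), (T ^ i) ∘ₗ d ∘ₗ (S ^ (m + 2 - i))) + d ∘ₗ S := by
    rw [Finset.sum_range_succ', LinearMap.add_comp]
    congr 1
    · rw [sum_linearMap_comp, linearMap_comp_sum]
      refine Finset.sum_congr rfl fun i hi => ?_
      have hi := Finset.mem_range.1 hi
      rw [pow_succ', show m + 2 - i = (m + 2 - (i + 1)) + 1 by omega, pow_succ]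
      rfl
    · simp [hS]
      rfl
  have h2 : (∑ i ∈ Finset.range (m + 2), (T ^ i) ∘ₗ d ∘ₗ (S ^ (m + 2 - i))) =
      (∑ i ∈ Finset.range (m + 1), (T ^ i) ∘ₗ d ∘ₗ (S ^ (m + 2 - i))) + d ∘ₗ S := by
    rw [Finset.sum_range_succ, hT, show m + 2 - (m + 1) = 1 by omega, pow_one]
    rfl
  rw [LinearMap.comp_sub, h1, h2, LinearMap.sub_comp]
  change (_ + _) ∘ₗ LinearMap.id - _ = LinearMap.id ∘ₗ _ - _
  rw [LinearMap.comp_id, LinearMap.id_comp]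
  abel

theorem geom_mul_pow (hT : T ^ (m + 1) = 1) (j : ℕ) :
    (∑ i ∈ Finset.range (m + 1), T ^ i) * T ^ j = ∑ i ∈ Finset.range (m + 1), T ^ i := by
  have h : (∑ i ∈ Finset.range (m + 1), T ^ i) * T = ∑ i ∈ Finset.range (m + 1), T ^ i := by
    have := geom_sum_mul T (m + 1)
    rw [hT, sub_self, mul_sub, mul_one, sub_eq_zero] at this
    exact this
  induction j with
  | zero => rw [pow_zero, mul_one]
  | succ j ih => rw [pow_succ, ← mul_assoc, ih, h]

theorem pow_mul_geom (hT : T ^ (m + 1) = 1) (j : ℕ) :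
    T ^ j * (∑ i ∈ Finset.range (m + 1), T ^ i) = ∑ i ∈ Finset.range (m + 1), T ^ i := by
  rw [← (Commute.sum_left _ _ _ fun i _ => Commute.pow_pow_self T i j).eq, geom_mul_pow hT j]

/-- The norms absorb the powers of `S` and `T` next to them, and both sides become the norm of `T`,
then `d`, then the norm of `S`, composed from left to right. -/
theorem sum_conj_comp_geom (hS : S ^ (m + 2) = 1) (hT : T ^ (m + 1) = 1) :
    (∑ i ∈ Finset.range (m + 1), (T ^ i) ∘ₗ d ∘ₗ (S ^ (m + 2 - i))) ∘ₗ
        (∑ i ∈ Finset.range (m + 2), S ^ i) =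
      (∑ i ∈ Finset.range (m + 1), T ^ i) ∘ₗ
        ∑ i ∈ Finset.range (m + 2), (T ^ i) ∘ₗ d ∘ₗ (S ^ (m + 2 - i)) := by
  have h1 (i : ℕ) : (S ^ i) ∘ₗ (∑ i ∈ Finset.range (m + 2), S ^ i) =
      ∑ i ∈ Finset.range (m + 2), S ^ i := pow_mul_geom hS i
  have h2 (i : ℕ) : (∑ i ∈ Finset.range (m + 1), T ^ i) ∘ₗ (T ^ i) =
      ∑ i ∈ Finset.range (m + 1), T ^ i := geom_mul_pow hT i
  have h3 : ∑ i ∈ Finset.range (m + 2), S ^ (m + 2 - i) = ∑ i ∈ Finset.range (m + 2), S ^ i := by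
    rw [← pow_mul_geom hS 1, Finset.mul_sum,
      ← Finset.sum_range_reflect (fun i => S ^ 1 * S ^ i) (m + 2)]
    refine Finset.sum_congr rfl fun i hi => ?_
    have hi := Finset.mem_range.1 hi
    rw [← pow_add]
    congr 1
    omega
  rw [sum_linearMap_comp, linearMap_comp_sum]
  simp only [LinearMap.comp_assoc, h1]
  simp only [← LinearMap.comp_assoc, h2]
  simp only [← sum_linearMap_comp, ← linearMap_comp_sum, LinearMap.comp_assoc, h3]

end

variable (k A : Type*) [CommRing k] [Ring A] [Algebra k A]

theorem val_finRotate_iterate (m j : ℕ) (i : Fin (m + 1)) :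
    (((finRotate (m + 1))^[j] i : Fin (m + 1)) : ℕ) = (i + j) % (m + 1) := by
  induction j with
  | zero => simp [Nat.mod_eq_of_lt i.isLt]
  | succ j ih =>
    rw [Function.iterate_succ_apply', finRotate_apply, Fin.val_add, ih, Fin.val_one', ← Nat.add_mod,
      add_assoc]

theorem finRotate_symm_iterate (m : ℕ) (i : Fin (m + 1)) :
    (finRotate (m + 1)).symm^[m + 1] i = i := by
  have h : (finRotate (m + 1))^[m + 1] i = i := Fin.ext (by
    rw [val_finRotate_iterate, Nat.add_mod_right, Nat.mod_eq_of_lt i.isLt])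
  conv_lhs => rw [← h]
  exact ((finRotate (m + 1)).left_inv.iterate (m + 1)) i

theorem rotation_pow_tprod (m j : ℕ) (c : Fin (m + 1) → A) :
    (rotation k A m ^ j) (PiTensorProduct.tprod k c) =
      PiTensorProduct.tprod k (fun i => c (((finRotate (m + 1)).symm)^[j] i)) := by
  induction j with
  | zero => simp
  | succ j ih =>
    rw [pow_succ', Module.End.mul_apply, ih, rotation_tprod]
    congr 1

theorem rotation_pow (m : ℕ) : rotation k A m ^ (m + 1) = 1 := by
  refine PiTensorProduct.ext (MultilinearMap.ext fun c => ?_)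
  rw [LinearMap.compMultilinearMap_apply, rotation_pow_tprod]
  refine congrArg (PiTensorProduct.tprod k) (funext fun i => congrArg c ?_)
  exact finRotate_symm_iterate m i

/-- The rotation has this order, and the signs multiply to `(-1) ^ (m * (m + 1)) = 1`. -/
theorem cyclicT_pow (m : ℕ) : cyclicT k A m ^ (m + 1) = 1 := by
  rw [cyclicT, smul_pow, rotation_pow, ← pow_mul]
  have : Even (m * (m + 1)) := Nat.even_mul_succ_self m
  rw [this.neg_one_pow, one_smul]

omit [Ring A] in
theorem contractNth_succ_cons {m : ℕ} (i : Fin (m + 1)) (f : A → A → A) (a : A)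
    (d : Fin (m + 1) → A) :
    Fin.contractNth i.succ f (Fin.cons (α := fun _ : Fin (m + 2) => A) a d) =
      Fin.cons (α := fun _ : Fin (m + 1) => A) a (Fin.contractNth i f d) := by
  ext j
  refine Fin.cases ?_ (fun j => ?_) j
  · rw [Fin.contractNth_apply_of_lt _ _ _ _ (by simp)]
    rfl
  · rw [Fin.cons_succ]
    rcases lt_trichotomy (j : ℕ) (i : ℕ) with h | h | h
    · rw [Fin.contractNth_apply_of_lt _ _ _ _ (by simpa using h),
        Fin.contractNth_apply_of_lt _ _ _ _ h]
      rfl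
    · rw [Fin.contractNth_apply_of_eq _ _ _ _ (by simpa using h),
        Fin.contractNth_apply_of_eq _ _ _ _ h]
      rfl
    · rw [Fin.contractNth_apply_of_gt _ _ _ _ (by simpa using h),
        Fin.contractNth_apply_of_gt _ _ _ _ h]
      rfl

theorem rotation_face (m : ℕ) (i : Fin m) :
    rotation k A m ∘ₗ face k A m i.castSucc = face k A m i.succ ∘ₗ rotation k A (m + 1) := by
  obtain _ | m := m
  · exact i.elim0
  refine PiTensorProduct.ext (MultilinearMap.ext fun c => ?_)
  rw [← Fin.snoc_init_self c]
  simp only [LinearMap.compMultilinearMap_apply, LinearMap.comp_apply]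
  rw [← chainSnoc_tprod, face_castSucc_chainSnoc, face_tprod, rotation_chainSnoc,
    rotation_chainSnoc, face_tprod, ← Fin.succ_castSucc, contractNth_succ_cons]

/-- Rotation conjugates each inner face into the next, and the signs of the cyclic operators in the
two degrees differ by `-1`. As the operator on the source has order dividing `m + 2`, the exponent
`m + 2 - i` stands for `-i`. -/
theorem signed_face_eq (m : ℕ) (i : ℕ) (hi : i < m + 1) :
    (-1 : k) ^ i • face k A m ⟨i, hi⟩ =
      (cyclicT k A m ^ i) ∘ₗ face k A m 0 ∘ₗ (cyclicT k A (m + 1) ^ (m + 2 - i)) := by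
  induction i with
  | zero =>
    rw [Nat.sub_zero, cyclicT_pow, pow_zero, pow_zero, one_smul]
    rfl
  | succ i ih =>
    have h1 := rotation_face k A m ⟨i, by omega⟩
    have h2 : cyclicT k A m ∘ₗ ((-1 : k) ^ i • face k A m ⟨i, by omega⟩) =
        ((-1 : k) ^ (i + 1) • face k A m ⟨i + 1, hi⟩) ∘ₗ cyclicT k A (m + 1) := by
      simp only [cyclicT, LinearMap.smul_comp, LinearMap.comp_smul, smul_smul]
      rw [show face k A m ⟨i + 1, hi⟩ ∘ₗ rotation k A (m + 1) =
        rotation k A m ∘ₗ face k A m ⟨i, by omega⟩ from h1.symm]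
      congr 1
      ring
    have h3 : ((-1 : k) ^ (i + 1) • face k A m ⟨i + 1, hi⟩) ∘ₗ
        (cyclicT k A (m + 1) * cyclicT k A (m + 1) ^ (m + 1)) =
        (-1 : k) ^ (i + 1) • face k A m ⟨i + 1, hi⟩ := by
      rw [← pow_succ', cyclicT_pow]
      rfl
    rw [← h3, Module.End.mul_eq_comp, ← LinearMap.comp_assoc, ← h2, ih,
      pow_succ' (cyclicT k A m) i]
    simp only [Module.End.mul_eq_comp, LinearMap.comp_assoc]
    congr 3
    rw [← Module.End.mul_eq_comp, ← pow_add,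
      show m + 2 - i + (m + 1) = m + 2 - (i + 1) + (m + 2) by omega, pow_add, cyclicT_pow, mul_one]

theorem barB_eq (m : ℕ) : barB k A m = ∑ i ∈ Finset.range (m + 1),
    (cyclicT k A m ^ i) ∘ₗ face k A m 0 ∘ₗ (cyclicT k A (m + 1) ^ (m + 2 - i)) := by
  rw [barB, ← Fin.sum_univ_eq_sum_range
    (fun i => (cyclicT k A m ^ i) ∘ₗ face k A m 0 ∘ₗ (cyclicT k A (m + 1) ^ (m + 2 - i)))]
  exact Finset.sum_congr rfl fun i _ => signed_face_eq k A m i i.isLt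

/-- The cyclic face is the additional term `i = m + 1`, in which the left power of the cyclic
operator is the identity. -/
theorem hochschildB_eq (m : ℕ) : hochschildB k A m = ∑ i ∈ Finset.range (m + 2),
    (cyclicT k A m ^ i) ∘ₗ face k A m 0 ∘ₗ (cyclicT k A (m + 1) ^ (m + 2 - i)) := by
  rw [hochschildB, Finset.sum_range_succ, ← barB_eq, cyclicT_pow,
    show m + 2 - (m + 1) = 1 by omega, pow_one, cyclicT, LinearMap.comp_smul]
  rfl

variable {k A}

theorem hochschildB_sub_cyclicT {m : ℕ} (x : Chains k A (m + 1)) :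
    hochschildB k A m (x - cyclicT k A (m + 1) x) =
      barB k A m x - cyclicT k A m (barB k A m x) := by
  have := sum_conj_comp_one_sub (face k A m 0) (cyclicT_pow k A (m + 1)) (cyclicT_pow k A m)
  rw [← barB_eq, ← hochschildB_eq] at this
  exact LinearMap.congr_fun this x

theorem barB_cyclicN {m : ℕ} (x : Chains k A (m + 1)) :
    barB k A m (cyclicN k A (m + 1) x) = cyclicN k A m (hochschildB k A m x) := by
  have := sum_conj_comp_geom (face k A m 0) (cyclicT_pow k A (m + 1)) (cyclicT_pow k A m)
  rw [← barB_eq, ← hochschildB_eq] at this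
  exact LinearMap.congr_fun this x

theorem cyclicT_cyclicN {m : ℕ} (x : Chains k A m) :
    cyclicT k A m (cyclicN k A m x) = cyclicN k A m x := by
  have := pow_mul_geom (cyclicT_pow k A m) 1
  rw [pow_one] at this
  exact LinearMap.congr_fun this x

theorem cyclicN_cyclicT {m : ℕ} (x : Chains k A m) :
    cyclicN k A m (cyclicT k A m x) = cyclicN k A m x := by
  have := geom_mul_pow (cyclicT_pow k A m) 1
  rw [pow_one] at this
  exact LinearMap.congr_fun this x

end Bicomplex

/-! ### Cyclic homology of algebras with acyclic Hochschild complex -/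

section Cyclic

section

variable {k A : Type u} [CommRing k] [Ring A] [Algebra k A]

theorem cyclicTotD_apply_even {m : ℕ} (x : CyclicTot k A (m + 1)) (q : ℕ) (hq : q < m + 1)
    (h : Even (m - q)) : cyclicTotD k A m x ⟨q, hq⟩ =
      hochschildB k A q (x ⟨q + 1, by omega⟩) +
        (x ⟨q, by omega⟩ - cyclicT k A q (x ⟨q, by omega⟩)) := by
  rw [cyclicTotD, LinearMap.pi_apply, if_pos h]
  rfl

theorem cyclicTotD_apply_odd {m : ℕ} (x : CyclicTot k A (m + 1)) (q : ℕ) (hq : q < m + 1)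
    (h : ¬ Even (m - q)) : cyclicTotD k A m x ⟨q, hq⟩ =
      -barB k A q (x ⟨q + 1, by omega⟩) + cyclicN k A q (x ⟨q, by omega⟩) := by
  rw [cyclicTotD, LinearMap.pi_apply, if_neg h]
  rfl

theorem cyclicTotD_cyclicTotD {m : ℕ} (x : CyclicTot k A (m + 2)) :
    cyclicTotD k A m (cyclicTotD k A (m + 1) x) = 0 := by
  funext ⟨q, hq⟩
  have e1 : m + 1 - (q + 1) = m - q := by omega
  have e2 : m + 1 - q = m - q + 1 := by omega
  by_cases h : Even (m - q)
  · rw [cyclicTotD_apply_even _ q hq h, cyclicTotD_apply_even _ (q + 1) _ (e1 ▸ h),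
      cyclicTotD_apply_odd _ q _ (by rw [e2, Nat.even_add_one, not_not]; exact h), map_add,
      hochschildB_hochschildB, hochschildB_sub_cyclicT, map_add, map_neg, cyclicT_cyclicN]
    simp only [Pi.zero_apply]
    abel
  · rw [cyclicTotD_apply_odd _ q hq h, cyclicTotD_apply_odd _ (q + 1) _ (e1 ▸ h),
      cyclicTotD_apply_even _ q _ (by rw [e2, Nat.even_add_one]; exact h), map_add, map_neg,
      barB_barB, barB_cyclicN, map_add, map_sub, cyclicN_cyclicT]
    simp only [Pi.zero_apply]
    abel

/-- The periodicity map: the projection of the total complex that forgets the two columns on the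
left of the cyclic bicomplex. -/
noncomputable def periodicity (m : ℕ) : CyclicTot k A (m + 2) →ₗ[k] CyclicTot k A m :=
  LinearMap.pi fun q : Fin (m + 1) =>
    LinearMap.proj (R := k) (φ := fun q : Fin (m + 3) => Chains k A q) ⟨q, by omega⟩

theorem periodicity_apply {m : ℕ} (x : CyclicTot k A (m + 2)) (q : ℕ) (hq : q < m + 1) :
    periodicity m x ⟨q, hq⟩ = x ⟨q, by omega⟩ := rfl

theorem cyclicTotD_periodicity {m : ℕ} (x : CyclicTot k A (m + 3)) :
    cyclicTotD k A m (periodicity (m + 1) x) = periodicity m (cyclicTotD k A (m + 2) x) := by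
  funext ⟨q, hq⟩
  have e : m + 2 - q = m - q + 2 := by omega
  have e' : Even (m + 2 - q) ↔ Even (m - q) := by
    rw [e, Nat.even_add]
    simp
  rw [periodicity_apply]
  by_cases h : Even (m - q)
  · rw [cyclicTotD_apply_even _ q _ h, cyclicTotD_apply_even _ q _ (e'.2 h)]
    rfl
  · rw [cyclicTotD_apply_odd _ q _ h, cyclicTotD_apply_odd _ q _ (mt e'.1 h)]
    rfl

/-- Extension by zero, a section of the periodicity map. -/
noncomputable def extendZero {m : ℕ} (x : CyclicTot k A m) : CyclicTot k A (m + 2) := fun q =>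
  if h : (q : ℕ) < m + 1 then x ⟨q, h⟩ else 0

theorem periodicity_extendZero {m : ℕ} (x : CyclicTot k A m) :
    periodicity m (extendZero x) = x := by
  funext ⟨q, hq⟩
  rw [periodicity_apply, extendZero, dif_pos hq]

theorem periodicity_mem_cyclicCycles {m : ℕ} {z : CyclicTot k A (m + 2)}
    (hz : z ∈ cyclicCycles k A (m + 2)) : periodicity m z ∈ cyclicCycles k A m := by
  obtain _ | m := m
  · exact Submodule.mem_top
  · change cyclicTotD k A m (periodicity (m + 1) z) = 0
    rw [cyclicTotD_periodicity, show cyclicTotD k A (m + 2) z = 0 from hz, map_zero]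

theorem cyclicTotD_extendZero_apply {m : ℕ} {w : CyclicTot k A m}
    (hw : w ∈ cyclicCycles k A m) (q : ℕ) (hq : q < m) :
    cyclicTotD k A (m + 1) (extendZero w) ⟨q, by omega⟩ = 0 := by
  obtain _ | m := m
  · omega
  · rw [← periodicity_apply (cyclicTotD k A (m + 2) (extendZero w)) q hq, ← cyclicTotD_periodicity, periodicity_extendZero,
      show cyclicTotD k A m w = 0 from hw]
    rfl

end

/-! ### Periodicity from exactness of the first two columns -/

section

variable {k A : Type u} [CommRing k] [Ring A] [Algebra k A]

/-- The vanishing condition confines the cycle to columns 0 and 1, in rows `m + 1` and `m`. Column 1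
is solved first, by exactness of `b'`; its contribution to column 0 through `1 - t` is then
corrected by exactness of `b`. -/
theorem exists_cyclicTotD_eq (hA : ∀ m, Ch.Acyclic (Bimod.self k A) (m + 1)) {m : ℕ}
    (x : CyclicTot k A (m + 1)) (hx : cyclicTotD k A m x = 0)
    (h : ∀ (q : ℕ) (hq : q < m), x ⟨q, by omega⟩ = 0) :
    ∃ w : CyclicTot k A (m + 2), cyclicTotD k A (m + 1) w = x ∧
      ∀ (q : ℕ) (hq : q < m + 1), w ⟨q, by omega⟩ = 0 := by
  obtain ⟨y, hy⟩ : ∃ y, barB k A m y = x ⟨m, by omega⟩ := by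
    obtain _ | m := m
    · exact barB_zero_surjective _
    · refine exists_barB_eq _ ?_
      have := congrFun hx ⟨m, by omega⟩
      rw [cyclicTotD_apply_odd _ m _ (by simp), h m (by omega), map_zero, add_zero] at this
      exact neg_eq_zero.1 this
  have hm := congrFun hx ⟨m, by omega⟩
  rw [cyclicTotD_apply_even _ m _ (by simp)] at hm
  -- This is a `b`-cycle by `b (1 - t) = (1 - t) b'` and the cycle condition in row `m`.
  obtain ⟨v, hv⟩ := exists_hochschildB_eq (hA m)
    (x ⟨m + 1, by omega⟩ + (y - cyclicT k A (m + 1) y)) (by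
      rw [map_add, hochschildB_sub_cyclicT, hy]
      exact hm)
  -- The sign of `y` compensates for the sign of `b'` in odd columns.
  let w : CyclicTot k A (m + 2) :=
    Pi.single (M := fun q : Fin (m + 3) => Chains k A q) ⟨m + 1, by omega⟩ (-y) +
      Pi.single (M := fun q : Fin (m + 3) => Chains k A q) ⟨m + 2, by omega⟩ v
  have w0 (q : ℕ) (hq : q < m + 1) : w ⟨q, by omega⟩ = 0 := by
    simp only [w, Pi.add_apply]
    rw [Pi.single_eq_of_ne (by simp; omega), Pi.single_eq_of_ne (by simp; omega), add_zero]
  have w1 : w ⟨m + 1, by omega⟩ = -y := by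
    simp only [w, Pi.add_apply]
    rw [Pi.single_eq_same, Pi.single_eq_of_ne (by simp), add_zero]
  have w2 : w ⟨m + 2, by omega⟩ = v := by
    simp only [w, Pi.add_apply]
    rw [Pi.single_eq_same, Pi.single_eq_of_ne (by simp), zero_add]
  refine ⟨w, ?_, w0⟩
  funext ⟨q, hq⟩
  rcases lt_trichotomy q m with hqm | rfl | hqm
  · by_cases he : Even (m + 1 - q)
    · rw [cyclicTotD_apply_even _ q _ he, w0 q (by omega), w0 (q + 1) (by omega), h q hqm]
      simp
    · rw [cyclicTotD_apply_odd _ q _ he, w0 q (by omega), w0 (q + 1) (by omega), h q hqm]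
      simp
  · rw [cyclicTotD_apply_odd _ q _ (by simp), w0 q (by omega), w1, map_neg, neg_neg, hy, map_zero,
      add_zero]
  · obtain rfl : q = m + 1 := by omega
    rw [cyclicTotD_apply_even _ (m + 1) _ (by simp), w1, w2, hv, map_neg]
    abel

/-- The first isomorphism theorem for a surjection with prescribed kernel. -/
noncomputable def quotientEquivOfKerEq {R M N : Type*} [Ring R] [AddCommGroup M] [Module R M]
    [AddCommGroup N] [Module R N] (f : M →ₗ[R] N) (hf : Function.Surjective f)
    (p : Submodule R M) (hp : LinearMap.ker f = p) : (M ⧸ p) ≃ₗ[R] N :=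
  (Submodule.quotEquivOfEq _ _ hp.symm).trans (f.quotKerEquivOfSurjective hf)

/-- The periodicity map from cycles to homology. -/
noncomputable def periodicityClass (m : ℕ) : cyclicCycles k A (m + 2) →ₗ[k] CyclicHomology k A m :=
  Submodule.mkQ _ ∘ₗ ((periodicity m).restrict fun _ => periodicity_mem_cyclicCycles)

/-- The differential of the extension by zero of a cycle lives in the first two columns, so it is
also the differential of some `v` supported there; subtracting `v` gives a cycle with the same
image. -/
theorem periodicityClass_surjective (hA : ∀ m, Ch.Acyclic (Bimod.self k A) (m + 1)) (m : ℕ) :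
    Function.Surjective (periodicityClass (k := k) (A := A) m) := by
  intro c
  obtain ⟨⟨w, hw⟩, rfl⟩ := Submodule.mkQ_surjective _ c
  obtain ⟨v, hv, hv0⟩ := exists_cyclicTotD_eq hA (cyclicTotD k A (m + 1) (extendZero w))
    (cyclicTotD_cyclicTotD _) (cyclicTotD_extendZero_apply hw)
  refine ⟨⟨extendZero w - v, ?_⟩, ?_⟩
  · change cyclicTotD k A (m + 1) _ = 0
    rw [map_sub, hv, sub_self]
  · change Submodule.mkQ _ _ = _
    congr 1
    refine Subtype.ext ?_
    change periodicity m (extendZero w - v) = w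
    rw [map_sub, periodicity_extendZero, sub_eq_self]
    funext ⟨q, hq⟩
    exact hv0 q hq

/-- If the image of `z` is the boundary of `y`, subtracting from `z` the boundary of `y` extended by
zero leaves a cycle in the first two columns, which is a boundary. -/
theorem ker_periodicityClass (hA : ∀ m, Ch.Acyclic (Bimod.self k A) (m + 1)) (m : ℕ) :
    LinearMap.ker (periodicityClass (k := k) (A := A) m) =
      (LinearMap.range (cyclicTotD k A (m + 2))).submoduleOf (cyclicCycles k A (m + 2)) := by
  ext ⟨z, hz⟩
  rw [LinearMap.mem_ker]
  change Submodule.Quotient.mk _ = 0 ↔ z ∈ LinearMap.range (cyclicTotD k A (m + 2))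
  rw [Submodule.Quotient.mk_eq_zero]
  change periodicity m z ∈ LinearMap.range (cyclicTotD k A m) ↔ _
  constructor
  · rintro ⟨y, hy⟩
    obtain ⟨w, hw, -⟩ := exists_cyclicTotD_eq hA (z - cyclicTotD k A (m + 2) (extendZero y)) (by
      rw [map_sub, cyclicTotD_cyclicTotD, sub_zero]
      exact hz) fun q hq => by
        have : periodicity m (z - cyclicTotD k A (m + 2) (extendZero y)) = 0 := by
          rw [map_sub, ← cyclicTotD_periodicity, periodicity_extendZero, hy, sub_self]
        exact congrFun this ⟨q, hq⟩
    refine ⟨w + extendZero y, ?_⟩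
    rw [map_add, hw, sub_add_cancel]
  · rintro ⟨y, rfl⟩
    exact ⟨periodicity (m + 1) y, cyclicTotD_periodicity y⟩

/-- Periodicity of cyclic homology in the absence of higher Hochschild homology. -/
noncomputable def cyclicHomologyEquiv (hA : ∀ m, Ch.Acyclic (Bimod.self k A) (m + 1)) (m : ℕ) :
    CyclicHomology k A (m + 2) ≃ₗ[k] CyclicHomology k A m :=
  quotientEquivOfKerEq (periodicityClass m) (periodicityClass_surjective hA m) _
    (ker_periodicityClass hA m)

theorem subsingleton_cyclicHomology_odd (hA : ∀ m, Ch.Acyclic (Bimod.self k A) (m + 1)) (p : ℕ) :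
    Subsingleton (CyclicHomology k A (2 * p + 1)) := by
  induction p with
  | zero =>
    refine Submodule.Quotient.subsingleton_iff.2 (eq_top_iff.2 fun ⟨x, hx⟩ _ => ?_)
    -- In total degree 1 there are no further columns, so the support condition is empty.
    obtain ⟨w, hw, -⟩ := exists_cyclicTotD_eq hA x hx fun q hq => absurd hq (Nat.not_lt_zero q)
    exact ⟨w, hw⟩
  | succ p ih => exact (cyclicHomologyEquiv hA (2 * p + 1)).toEquiv.subsingleton

theorem nonempty_cyclicHomology_even_equiv (hA : ∀ m, Ch.Acyclic (Bimod.self k A) (m + 1)) (p : ℕ) :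
    Nonempty (CyclicHomology k A (2 * p) ≃ₗ[k] CyclicHomology k A 0) := by
  induction p with
  | zero => exact ⟨LinearEquiv.refl _ _⟩
  | succ p ih => exact ⟨(cyclicHomologyEquiv hA (2 * p)).trans ih.some⟩

theorem subsingleton_hochschildHomology {m : ℕ} (h : Ch.Acyclic (Bimod.self k A) (m + 1)) :
    Subsingleton (HochschildHomology k A (m + 1)) := by
  refine Submodule.Quotient.subsingleton_iff.2 (eq_top_iff.2 fun ⟨x, hx⟩ _ => ?_)
  obtain ⟨y, hy⟩ := exists_hochschildB_eq h x hx
  exact ⟨y, hy⟩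

end

/-! ### Cyclic homology in degree zero -/

section

variable (k A : Type u) [CommRing k] [Ring A] [Algebra k A]

theorem rotation_zero : rotation k A 0 = LinearMap.id := by
  refine PiTensorProduct.ext (MultilinearMap.ext fun c => ?_)
  rw [LinearMap.compMultilinearMap_apply, rotation_tprod]
  refine congrArg (PiTensorProduct.tprod k) (funext fun i => congrArg c (Subsingleton.elim (α := Fin 1) _ _))

/-- The total complex of the cyclic bicomplex in degree `0`. -/
noncomputable def cyclicTotZeroEquiv : CyclicTot k A 0 ≃ₗ[k] Chains k A 0 :=
  LinearEquiv.ofBijective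
    (LinearMap.proj (R := k) (φ := fun q : Fin (0 + 1) => Chains k A q) ⟨0, by omega⟩)
    ⟨fun x y h => funext fun ⟨q, hq⟩ => by
      obtain rfl : q = 0 := by omega
      exact h, fun y =>
      ⟨Pi.single (M := fun q : Fin (0 + 1) => Chains k A q) ⟨0, Nat.one_pos⟩ y, by
        rw [LinearMap.proj_apply, Pi.single_eq_same]⟩⟩

theorem cyclicTotZeroEquiv_apply (x : CyclicTot k A 0) :
    cyclicTotZeroEquiv k A x = x ⟨0, by omega⟩ := rfl

/-- In row 0 the cyclic operator is the identity, so `1 - t` contributes nothing and only `b` is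
left. -/
theorem cyclicTotZeroEquiv_cyclicTotD (x : CyclicTot k A (0 + 1)) :
    cyclicTotZeroEquiv k A (cyclicTotD k A 0 x) = hochschildB k A 0 (x ⟨0 + 1, by omega⟩) := by
  rw [cyclicTotZeroEquiv_apply, cyclicTotD_apply_even (m := 0) x 0 (by omega) (by simp), cyclicT,
    rotation_zero, pow_zero, one_smul, LinearMap.id_apply, sub_self, add_zero]

theorem range_cyclicTotD_zero : (LinearMap.range (cyclicTotD k A 0)).map
    (cyclicTotZeroEquiv k A : CyclicTot k A 0 →ₗ[k] Chains k A 0) =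
      LinearMap.range (hochschildB k A 0) := by
  apply le_antisymm
  · rintro _ ⟨_, ⟨x, rfl⟩, rfl⟩
    exact ⟨_, (cyclicTotZeroEquiv_cyclicTotD k A x).symm⟩
  · rintro _ ⟨y, rfl⟩
    refine ⟨_, ⟨Pi.single (M := fun q : Fin (0 + 2) => Chains k A q) ⟨0 + 1, by omega⟩ y, rfl⟩, ?_⟩
    refine (cyclicTotZeroEquiv_cyclicTotD k A _).trans ?_
    rw [Pi.single_eq_same]

/-- Cyclic and Hochschild homology agree in degree `0`. -/
noncomputable def cyclicHomologyZeroEquiv :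
    CyclicHomology k A 0 ≃ₗ[k] HochschildHomology k A 0 :=
  Submodule.Quotient.equiv _ _
    ((Submodule.topEquiv.trans (cyclicTotZeroEquiv k A)).trans Submodule.topEquiv.symm) (by
      ext ⟨x, hx⟩
      have := range_cyclicTotD_zero k A
      constructor
      · rintro ⟨⟨y, hy⟩, hy', he⟩
        change x ∈ LinearMap.range (hochschildB k A 0)
        rw [← this]
        exact ⟨y, hy', congrArg Subtype.val he⟩
      · intro h
        change x ∈ LinearMap.range (hochschildB k A 0) at h
        rw [← this] at h
        obtain ⟨y, hy, rfl⟩ := h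
        exact ⟨⟨y, Submodule.mem_top⟩, hy, rfl⟩)

end

end Cyclic

/-! ### Hochschild homology in degree zero -/

section DegreeZero

section

variable (k A : Type*) [CommRing k] [Ring A] [Algebra k A]

/-- The projection of an algebra onto its Hochschild homology in degree `0`. -/
noncomputable def hochschildZeroMk : A →ₗ[k] HochschildHomology k A 0 :=
  ((LinearMap.range (hochschildB k A 0)).submoduleOf (hochschildCycles k A 0)).mkQ ∘ₗ
    (chainZeroEquiv k A : A →ₗ[k] Chains k A 0).codRestrict (hochschildCycles k A 0)
      fun _ => Submodule.mem_top

variable {A}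

theorem hochschildZeroMk_apply (x : A) : hochschildZeroMk k A x = hochschildClassZero k A x :=
  congrArg Submodule.Quotient.mk (Subtype.ext (chainZeroEquiv_apply x))

theorem hochschildZeroMk_surjective : Function.Surjective (hochschildZeroMk k A) := by
  intro c
  obtain ⟨⟨y, hy⟩, rfl⟩ := Submodule.mkQ_surjective _ c
  obtain ⟨a, rfl⟩ := (chainZeroEquiv k A).surjective y
  exact ⟨a, rfl⟩

theorem hochschildB_zero_chainSnoc (x a : A) :
    hochschildB k A 0 (chainSnoc (chainZeroEquiv k A x) a) = chainZeroEquiv k A (x * a - a * x) := by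
  rw [hochschildB, barB, LinearMap.add_apply, LinearMap.smul_apply, LinearMap.comp_apply,
    face_rotation_chainSnoc_zero]
  simp [face_chainSnoc_zero, sub_eq_add_neg]

theorem hochschildZeroMk_mul_comm (x a : A) :
    hochschildZeroMk k A (x * a) = hochschildZeroMk k A (a * x) := by
  rw [← sub_eq_zero, ← map_sub]
  refine (Submodule.Quotient.mk_eq_zero
    ((LinearMap.range (hochschildB k A 0)).submoduleOf (hochschildCycles k A 0))).2 ?_
  exact ⟨_, hochschildB_zero_chainSnoc k x a⟩

/-- A trace descends to the Hochschild homology in degree `0`. -/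
theorem exists_hochschildZero_lift {N : Type*} [AddCommGroup N] [Module k N] (f : A →ₗ[k] N)
    (hf : ∀ x a, f (x * a) = f (a * x)) :
    ∃ g : HochschildHomology k A 0 →ₗ[k] N, ∀ x, g (hochschildZeroMk k A x) = f x := by
  have h : f ∘ₗ ((chainZeroEquiv k A).symm : Chains k A 0 →ₗ[k] A) ∘ₗ hochschildB k A 0 = 0 := by
    refine LinearMap.ext fun y => ?_
    obtain ⟨y, rfl⟩ := (chainSnocEquiv k A 0).surjective y
    induction y using TensorProduct.induction_on with
    | zero => simp
    | add y y' hy hy' => rw [map_add, map_add, hy, hy', map_add]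
    | tmul x a =>
      obtain ⟨x, rfl⟩ := (chainZeroEquiv k A).surjective x
      rw [chainSnocEquiv_tmul, LinearMap.comp_apply, LinearMap.comp_apply,
        hochschildB_zero_chainSnoc, LinearEquiv.coe_coe, LinearEquiv.symm_apply_apply, map_sub,
        hf, sub_self]
      rfl
  refine ⟨Submodule.liftQ _ (f ∘ₗ ((chainZeroEquiv k A).symm : Chains k A 0 →ₗ[k] A) ∘ₗ
    (hochschildCycles k A 0).subtype) ?_, fun x => ?_⟩
  · rintro ⟨_, _⟩ ⟨y, rfl⟩
    exact LinearMap.congr_fun h y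
  · change f ((chainZeroEquiv k A).symm (chainZeroEquiv k A x)) = f x
    rw [LinearEquiv.symm_apply_apply]

end

/-! ### Degree zero for the Auslander algebra -/

section

variable (k : Type*) [CommRing k] {n : ℕ} [NeZero n]

/-- The augmentation takes values in a commutative algebra, hence is a trace and descends to degree
0, where it sends the vertices to the standard basis. -/
theorem linearIndependent_hochschildClassZero : LinearIndependent k fun x : Vertex n =>
    hochschildClassZero k (AuslanderTaft k n) (vertexIdem k n x) := by
  obtain ⟨g, hg⟩ := exists_hochschildZero_lift k (augmentation (n := n) k).toLinearMap fun x a => by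
    simp [mul_comm]
  refine LinearIndependent.of_comp g ?_
  have h : (g ∘ fun x : Vertex n => hochschildClassZero k (AuslanderTaft k n) (vertexIdem k n x)) =
      fun x => Pi.single x 1 := by
    funext x
    rw [Function.comp_apply, ← hochschildZeroMk_apply, hg, AlgHom.toLinearMap_apply,
      augmentation_vertexIdem]
  rw [h]
  have := (Pi.basisFun k (Vertex n)).linearIndependent
  exact (funext fun x => Pi.basisFun_apply k _ x : ⇑(Pi.basisFun k (Vertex n)) = _) ▸ this

/-- A monomial whose ends differ is a commutator with the vertex at its end. If the ends agree, then
`s` and `t` vanish modulo `n`, hence vanish, and the monomial is a vertex. -/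
theorem hochschildZeroMk_monomial_mem (j u : ZMod n) {s t : ℕ} (hs : s < n) (ht : t < n) :
    hochschildZeroMk k (AuslanderTaft k n) (monomial k j u s t) ∈
      Submodule.span k (Set.range fun x : Vertex n =>
        hochschildClassZero k (AuslanderTaft k n) (vertexIdem k n x)) := by
  by_cases h : ((j, u - t) : ZMod n × ZMod n) = (j + s, u)
  · rw [Prod.mk.injEq] at h
    obtain rfl : s = 0 := natCast_eq_zero_of_lt hs (by simpa using h.1)
    obtain rfl : t = 0 := natCast_eq_zero_of_lt ht (by simpa using h.2)
    rw [monomial_zero_zero, hochschildZeroMk_apply]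
    exact Submodule.subset_span ⟨Vertex.mk j u, rfl⟩
  · rw [← vert_mul_monomial, hochschildZeroMk_mul_comm, monomial_mul_vert_of_ne, map_zero]
    · exact Submodule.zero_mem _
    · exact h

theorem span_hochschildClassZero : Submodule.span k (Set.range fun x : Vertex n =>
    hochschildClassZero k (AuslanderTaft k n) (vertexIdem k n x)) = ⊤ := by
  refine eq_top_iff.2 fun c _ => ?_
  obtain ⟨x, rfl⟩ := hochschildZeroMk_surjective k c
  induction x using monomial_induction with
  | zero => simp
  | add x y hx hy =>
    rw [map_add]
    exact Submodule.add_mem _ (hx trivial) (hy trivial)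
  | smul c x hx =>
    rw [map_smul]
    exact Submodule.smul_mem _ c (hx trivial)
  | monomial j u s t hs ht =>
    exact hochschildZeroMk_monomial_mem k j u (by omega) (by omega)

/-- The basis of the Hochschild homology in degree `0` given by the vertices. -/
noncomputable def hochschildZeroBasis :
    Module.Basis (Vertex n) k (HochschildHomology k (AuslanderTaft k n) 0) :=
  Module.Basis.mk (linearIndependent_hochschildClassZero k) (span_hochschildClassZero k).ge

theorem card_vertex : Fintype.card (Vertex n) = n ^ 2 := by
  change Fintype.card (ZMod n × ZMod n) = n ^ 2
  rw [Fintype.card_prod, ZMod.card, sq]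

/-- The functions on the vertices, in coordinates. -/
noncomputable def vertexFinsuppEquiv : (Vertex n →₀ k) ≃ₗ[k] (Fin (n ^ 2) → k) :=
  (Finsupp.linearEquivFunOnFinite k k (Vertex n)).trans
    (LinearEquiv.funCongrLeft k k (Fintype.equivFinOfCardEq card_vertex).symm)

end

end DegreeZero

end TaftAuslander

/-- Hochschild and cyclic homology of the Auslander algebra of the Taft algebra. -/
theorem mainTheorem1 (k : Type*) [Field k] [IsAlgClosed k] (n : ℕ) [NeZero n] (hn : 2 ≤ n) :
    (∃ B : Module.Basis (TaftAuslander.Vertex n) k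
        (TaftAuslander.HochschildHomology k (TaftAuslander.AuslanderTaft k n) 0),
      ∀ x, B x = TaftAuslander.hochschildClassZero k (TaftAuslander.AuslanderTaft k n)
        (TaftAuslander.vertexIdem k n x)) ∧
    Nonempty (TaftAuslander.HochschildHomology k (TaftAuslander.AuslanderTaft k n) 0
      ≃ₗ[k] (Fin (n ^ 2) → k)) ∧
    (∀ p : ℕ, 0 < p →
      Subsingleton (TaftAuslander.HochschildHomology k (TaftAuslander.AuslanderTaft k n) p)) ∧
    (∀ p : ℕ,
      Nonempty (TaftAuslander.CyclicHomology k (TaftAuslander.AuslanderTaft k n) (2 * p)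
        ≃ₗ[k] (TaftAuslander.Vertex n →₀ k)) ∧
      Nonempty (TaftAuslander.CyclicHomology k (TaftAuslander.AuslanderTaft k n) (2 * p)
        ≃ₗ[k] (Fin (n ^ 2) → k)) ∧
      Subsingleton
        (TaftAuslander.CyclicHomology k (TaftAuslander.AuslanderTaft k n) (2 * p + 1))) := by
  have hA := TaftAuslander.acyclic_self (n := n) k
  have e := (TaftAuslander.hochschildZeroBasis (n := n) k).repr
  refine ⟨⟨TaftAuslander.hochschildZeroBasis k, fun x => Module.Basis.mk_apply _ _ _⟩,
    ⟨e.trans (TaftAuslander.vertexFinsuppEquiv k)⟩, fun p hp => ?_, fun p => ?_⟩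
  · obtain _ | p := p
    · exact absurd hp (lt_irrefl 0)
    · exact TaftAuslander.subsingleton_hochschildHomology (hA p)
  · obtain ⟨f⟩ := TaftAuslander.nonempty_cyclicHomology_even_equiv hA p
    have g := (f.trans (TaftAuslander.cyclicHomologyZeroEquiv k _)).trans e
    exact ⟨⟨g⟩, ⟨g.trans (TaftAuslander.vertexFinsuppEquiv k)⟩,
      TaftAuslander.subsingleton_cyclicHomology_odd hA p⟩
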